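/- Let $D\subset\mathbb{C}^3$ be a domain and let $\alpha,\beta,\gamma,\delta$ be analytic functions of $(u_{n+1},u_n,u_{n-1})\in D$ such that $\partial\alpha/\partial u_{n+1}\neq 0$ and $\partial\alpha/\partial u_{n-1}\neq 0$ on $D$; assume that there is at least one sequence $(u_n)_{n\in\mathbb{Z}}$ with $(u_{n+1},u_n,u_{n-1})\in D$ for all $n$. Consider the chain $$u_{n,xy}=\alpha\,u_{n,x}u_{n,y}+\beta\,u_{n,x}+\gamma\,u_{n,y}+\delta,\qquad n\in\mathbb{Z},$$ with right-hand side $f_n$. Let $D_x$ be the total derivative in $x$ by virtue of the chain, and let $Y=\sum_i\bigl(u_{i,y}\frac{\partial}{\partial u_i}+f_i\frac{\partial}{\partial u_{i,x}}+D_x(f_i)\frac{\partial}{\partial u_{i,xx}}+\dots\bigr)$, $Y_i=[\partial/\partial u_{i,y},Y]$ be the characteristic operators in the direction $y$. Put $W_1=[Y_0,Y_1]$, $W_2=[Y_0,W_1]$, and $Z_0=Y_0$, $Z_1=Y_1$, $Z_2=Y_2$, $Z_3=[Y_1,Y_0]$, $Z_4=[Y_2,Y_1]$, $Z_5=[Y_2,Z_3]$,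 $Z_m=[Y_1,Z_{m-3}]$ for $m=6,7,8$. Consider the expansions $$W_2=\lambda W_1+\sigma Y_1+\delta' Y_0,\qquad Z_8=\sum_{m=0}^{7}c_mZ_m,\tag{E}$$ whose coefficients are locally analytic functions of the dynamical variables, on the set of all jets with $(u_{n+1},u_n,u_{n-1})\in D$ for all $n$. Let $(E')$ be the same pair of expansions for the direction $x$ (that is, with the roles of $x$ and $y$, and so of $\beta$ and $\gamma$, exchanged). Say that the chain reduces locally to a given form if near every sequence $(u_n)$ as above there is an invertible analytic point transformation $v_n=p_n(u_n)$ (with $p_n$ defined near $u_n$ and possibly depending on $n$) that carries it to a chain whose coefficients have that form in the variables $v_n$. Consider $$\alpha=\frac1{v_n-v_{n-1}}-\frac1{v_{n+1}-v_n},\tag{1}$$ $$\gamma=r'(v_n)-r(v_n)\,\alpha,\qquad r(v)=\tfrac{k_1}{2}v^2+k_2v+k_3,\tag{2}$$ $$\beta=\tilde r'(v_n)-\tilde r(v_n)\,\alpha,\qquad \tilde r(v)=\tfrac{\tilde k_1}{2}v^2+\tilde k_2v+\tilde k_3,\tag{3}$$ where the constants $k_i,\tilde k_i$ do not depend on $n$.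 Then: (a) (E) holds if and only if the chain reduces locally to the form (1), (2); (b) (E') holds if and only if the chain reduces locally to the form (1), (3); (c) (E) and (E') both hold if and only if the chain reduces locally to the form (1), (2), (3) (by one and the same transformation); (d) if $\alpha$ itself has the form $\alpha=\frac1{u_n-u_{n-1}}-\frac1{u_{n+1}-u_n}$ on $D$, then (E) holds if and only if $\gamma=r'(u_n)-r(u_n)\alpha$ on $D$ for some polynomial $r$ of degree at most two, and (E') holds if and only if $\beta=\tilde r'(u_n)-\tilde r(u_n)\alpha$ on $D$ for some polynomial $\tilde r$ of degree at most two. -/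

import Mathlib

open scoped Topology

namespace QChain

/-- The coefficients of the quasilinear chain
`u_{n,xy} = α u_{n,x} u_{n,y} + β u_{n,x} + γ u_{n,y} + δ`.
A triple `t` stands for `(u_{n+1}, u_n, u_{n-1})`. -/
structure Chain where
  α : ℂ × ℂ × ℂ → ℂ
  β : ℂ × ℂ × ℂ → ℂ
  γ : ℂ × ℂ × ℂ → ℂ
  δ : ℂ × ℂ × ℂ → ℂ

/-- The right-hand side of the chain, at `u_{n,x} = ξ`, `u_{n,y} = η`. -/
def Chain.rhs (C : Chain) (t : ℂ × ℂ × ℂ) (ξ η : ℂ) : ℂ :=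
  C.α t * ξ * η + C.β t * ξ + C.γ t * η + C.δ t

/-- The same chain with the names of the independent variables `x`, `y` exchanged. -/
def Chain.swap (C : Chain) : Chain := ⟨C.α, C.γ, C.β, C.δ⟩

/-- Dynamical variables: `Sum.inl (i, k)` is the `k`-th `x`-derivative of `u_i`
(so `Sum.inl (i, 0)` is `u_i`), and `Sum.inr i` is `u_{i,y}`. -/
abbrev Var : Type := (ℤ × ℕ) ⊕ ℤ

/-- A point of the jet space: a value for each dynamical variable. -/
abbrev Jet : Type := Var → ℂ

/-- The triple `(u_{n+1}, u_n, u_{n-1})` at a point of the jet space. -/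
def triple (j : Jet) (n : ℤ) : ℂ × ℂ × ℂ :=
  (j (Sum.inl (n + 1, 0)), j (Sum.inl (n, 0)), j (Sum.inl (n - 1, 0)))

/-- The part of the jet space on which the coefficients `α_n, β_n, γ_n, δ_n` are defined. -/
def phaseSpace (D : Set (ℂ × ℂ × ℂ)) : Set Jet := {j | ∀ n : ℤ, triple j n ∈ D}

/-- Locally analytic functions of the dynamical variables: near each point of `Ω` the function
is an analytic function of finitely many of the variables. -/
def IsDynamical (Ω : Set Jet) (g : Jet → ℂ) : Prop :=
  ∀ j ∈ Ω, ∃ (S : Finset Var) (G : (S → ℂ) → ℂ),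
    AnalyticAt ℂ G (fun s => j s) ∧ ∀ᶠ j' in 𝓝[Ω] j, g j' = G (fun s => j' s)

/-- Partial derivative with respect to a dynamical variable. -/
noncomputable def partialD (s : Var) (g : Jet → ℂ) : Jet → ℂ :=
  fun j => deriv (fun z => g (Function.update j s z)) (j s)

/-- Formal vector fields `∑ V_s ∂/∂s`, given by their coefficients. -/
abbrev VField : Type := Var → Jet → ℂ

/-- Action of a vector field on a function; the sum is finite on
functions of finitely many variables. -/
noncomputable def act (V : VField) (g : Jet → ℂ) : Jet → ℂ :=
  fun j => ∑ᶠ s : Var, V s j * partialD s g j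

/-- The commutator `[V, W]`. -/
noncomputable def bracket (V W : VField) : VField :=
  fun s j => act V (W s) j - act W (V s) j

/-- The right-hand side `f_n` of the `n`-th equation as a function on the jet space. -/
def Chain.f (C : Chain) (n : ℤ) : Jet → ℂ :=
  fun j => C.rhs (triple j n) (j (Sum.inl (n, 1))) (j (Sum.inr n))

/-- Total derivative in `x`, by virtue of the chain, on functions of `u, u_x, u_xx, …, u_y`. -/
def Chain.Dx (C : Chain) : VField
  | Sum.inl (i, k) => fun j => j (Sum.inl (i, k + 1))
  | Sum.inr i => C.f i

/-- The operator
`Y = ∑ i, (u_{i,y} ∂/∂u_i + f_i ∂/∂u_{i,x} + D_x(f_i) ∂/∂u_{i,xx} + …)`, through which the total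
derivative in `y` acts on functions of `u, u_x, u_xx, …`. -/
noncomputable def Chain.Y (C : Chain) : VField
  | Sum.inl (i, 0) => fun j => j (Sum.inr i)
  | Sum.inl (i, k + 1) => (act C.Dx)^[k] (C.f i)
  | Sum.inr _ => fun _ => 0

/-- The operator `X_i = ∂/∂u_{i,y}`. -/
def X (i : ℤ) : VField := fun s _ => if s = Sum.inr i then 1 else 0

/-- The characteristic operators `Y_i = [X_i, Y]`. -/
noncomputable def Chain.Yop (C : Chain) (i : ℤ) : VField := bracket (X i) C.Y

/-- First test sequence: `W_1 = [Y_0, Y_1]`, `W_{k+1} = [Y_0, W_k]` (and `W_0 = Y_1`). -/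
noncomputable def Chain.W (C : Chain) : ℕ → VField
  | 0 => C.Yop 1
  | k + 1 => bracket (C.Yop 0) (C.W k)

/-- Second test sequence: `Y_0, Y_1, Y_2, [Y_1, Y_0], [Y_2, Y_1], [Y_2, [Y_1, Y_0]]`, and
`Z_m = [Y_1, Z_{m-3}]` for `m ≥ 6`. -/
noncomputable def Chain.Z (C : Chain) : ℕ → VField
  | 0 => C.Yop 0
  | 1 => C.Yop 1
  | 2 => C.Yop 2
  | 3 => bracket (C.Yop 1) (C.Yop 0)
  | 4 => bracket (C.Yop 2) (C.Yop 1)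
  | 5 => bracket (C.Yop 2) (bracket (C.Yop 1) (C.Yop 0))
  | m + 6 => bracket (C.Yop 1) (C.Z (m + 3))

/-- `W_2 = λ W_1 + σ Y_1 + δ Y_0` with locally analytic coefficients. -/
def Chain.FirstExpansion (C : Chain) (D : Set (ℂ × ℂ × ℂ)) : Prop :=
  ∃ l σ d : Jet → ℂ,
    IsDynamical (phaseSpace D) l ∧ IsDynamical (phaseSpace D) σ ∧ IsDynamical (phaseSpace D) d ∧
    ∀ j ∈ phaseSpace D, ∀ s : Var,
      C.W 2 s j = l j * C.W 1 s j + σ j * C.Yop 1 s j + d j * C.Yop 0 s j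

/-- `Z_8` is a linear combination of `Z_7, …, Z_0` with locally analytic coefficients. -/
def Chain.SecondExpansion (C : Chain) (D : Set (ℂ × ℂ × ℂ)) : Prop :=
  ∃ c : ℕ → Jet → ℂ, (∀ m < 8, IsDynamical (phaseSpace D) (c m)) ∧
    ∀ j ∈ phaseSpace D, ∀ s : Var,
      C.Z 8 s j = ∑ m ∈ Finset.range 8, c m j * C.Z m s j

/-- Both expansions hold, for the characteristic algebra in the direction `y`. -/
def Chain.Expansions (C : Chain) (D : Set (ℂ × ℂ × ℂ)) : Prop :=
  C.FirstExpansion D ∧ C.SecondExpansion D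

/-- `1 / (u_n - u_{n-1}) - 1 / (u_{n+1} - u_n)`. -/
noncomputable def stdAlpha (t : ℂ × ℂ × ℂ) : ℂ := 1 / (t.2.1 - t.2.2) - 1 / (t.1 - t.2.1)

/-- At `t` neighbouring values are distinct and `α` has the standard form. -/
def Chain.AlphaForm (C : Chain) (t : ℂ × ℂ × ℂ) : Prop :=
  t.2.1 ≠ t.2.2 ∧ t.1 ≠ t.2.1 ∧ C.α t = stdAlpha t

/-- The polynomial `r(z) = (k₁ / 2) z² + k₂ z + k₃` (with `k = (k₁, k₂, k₃)`). -/
noncomputable def quad (k : ℂ × ℂ × ℂ) (z : ℂ) : ℂ := k.1 / 2 * z ^ 2 + k.2.1 * z + k.2.2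

/-- `γ = r'(u_n) - r(u_n) α` at `t`. -/
def Chain.GammaForm (C : Chain) (k t : ℂ × ℂ × ℂ) : Prop :=
  C.γ t = deriv (quad k) t.2.1 - quad k t.2.1 * C.α t

/-- `β = r̃'(u_n) - r̃(u_n) α` at `t`. -/
def Chain.BetaForm (C : Chain) (k t : ℂ × ℂ × ℂ) : Prop :=
  C.β t = deriv (quad k) t.2.1 - quad k t.2.1 * C.α t

/-- Configurations `(u_n)` all of whose triples of neighbours lie in `D`. -/
def IsConfig (D : Set (ℂ × ℂ × ℂ)) (q : ℤ → ℂ) : Prop :=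
  ∀ n : ℤ, (q (n + 1), q n, q (n - 1)) ∈ D

/-- Near the configuration `q`, the invertible point transformation `v_n = p_n(u_n)` carries the
chain `C` to the chain with coefficients `C' n` in the `n`-th equation, that is,
`v_{n,xy} = p_n' u_{n,xy} + p_n'' u_{n,x} u_{n,y}` is the right-hand side of the latter
at `v_{n,x} = p_n' u_{n,x}`, `v_{n,y} = p_n' u_{n,y}`. -/
def Chain.TransformsTo (C : Chain) (q : ℤ → ℂ) (p : ℤ → ℂ → ℂ) (C' : ℤ → Chain) : Prop :=
  ∀ n : ℤ, AnalyticAt ℂ (p n) (q n) ∧ deriv (p n) (q n) ≠ 0 ∧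
    ∀ᶠ t in 𝓝 ((q (n + 1), q n, q (n - 1)) : ℂ × ℂ × ℂ), ∀ ξ η : ℂ,
      deriv (p n) t.2.1 * C.rhs t ξ η + deriv (deriv (p n)) t.2.1 * ξ * η =
        (C' n).rhs (p (n + 1) t.1, p n t.2.1, p (n - 1) t.2.2)
          (deriv (p n) t.2.1 * ξ) (deriv (p n) t.2.1 * η)

/-- Near every configuration, some point transformation `v_n = p_n(u_n)` carries the chain to one
whose `n`-th coefficients satisfy `Φ k` near `(v_{n+1}, v_n, v_{n-1})` for all `n`,
with a parameter `k` that does not depend on `n`. -/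
def Chain.LocallyReducible {K : Type} (C : Chain) (D : Set (ℂ × ℂ × ℂ))
    (Φ : K → Chain → ℂ × ℂ × ℂ → Prop) : Prop :=
  ∀ q : ℤ → ℂ, IsConfig D q → ∃ (p : ℤ → ℂ → ℂ) (C' : ℤ → Chain) (k : K),
    C.TransformsTo q p C' ∧
    ∀ n : ℤ, ∀ᶠ v in 𝓝 ((p (n + 1) (q (n + 1)), p n (q n), p (n - 1) (q (n - 1))) : ℂ × ℂ × ℂ),
      Φ k (C' n) v

end QChain

/-! Write x, y, z for the three arguments u_{n+1}, u_n, u_{n-1} of a coefficient. The operators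
satisfy [D_x, Y_i] = -θ_i Y_i with θ_i = α_i u_{i,x} + γ_i (`Chain.Reg.dtot_Yd`), and a field that
commutes with D_x up to a factor is zero once it kills every u_m (`eq_zero_of_dtot`). Relations
between iterated brackets thus become differential equations for α and γ at neighbouring triples.
The first expansion alone forces λ = α_xy/α_x and the equations `FirstSys`
(`Chain.Reg.firstSys_of_expansion`). In the other direction, `FirstSys`, its mirror image and
`TripleSys` give W_2 = λ W_1 and Z_8 = -α_1 Z_5.

Solving `FirstSys` for α: an equation links two neighbouring triples, and differentiating in a
variable that occurs in only some of its terms gives α_xz = 0, λ + μ + 2α = 0 with μ = α_zy/α_z, and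
equality of α_x at one triple with α_z at the next (`alpha_link`). Then λ_x = -2α_x, which is
Liouville's equation (log α_x)_xy = -2α_x. Locally its solutions are α_x = p_{n+1}'(x) p_n'(y) /
(p_{n+1}(x) - p_n(y))². The functions p_n are obtained from λ by fractional linear changes, chosen
recursively in n so that one function per site serves both of its neighbours
(`exists_normalization`). Now λ and μ are explicit, hence so is α = -(λ + μ)/2, and the p_n are the
required point transformation.

Solving for γ: the ratio ρ = -γ_z/α_z turns out to depend on u_n only, and γ = ρ_y - ρα. The
remaining equation expresses ρ_{n+1}(x) through the second-order jet of ρ_n at a single point. This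
makes p_n' ρ_n a polynomial of degree at most two in p_n, and the same polynomial for all n
(`SysOn.exists_gammaOf`).

Conversely the explicit forms satisfy all three systems. The direction x is the case of the swapped
chain. The frame p_n is built from α alone, and the form of γ holds in every frame for α; so one
transformation serves both directions, and for standard α the identity is such a frame, after which
analytic continuation over the connected D gives the global statement. -/

namespace QChain

/-! ### Locally analytic functions of finitely many dynamical variables -/

/-- Restriction of a jet to finitely many variables. -/
def restr (S : Finset Var) (j : Jet) : S → ℂ := fun s => j s

/-- The germ condition of `IsDynamical` at a single point. -/
def DynAt (Ω : Set Jet) (g : Jet → ℂ) (j : Jet) : Prop :=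
  ∃ (S : Finset Var) (G : (S → ℂ) → ℂ),
    AnalyticAt ℂ G (restr S j) ∧ ∀ᶠ j' in 𝓝[Ω] j, g j' = G (restr S j')

theorem continuous_restr (S : Finset Var) : Continuous (restr S) := by
  unfold restr; fun_prop

/-- Restriction from a larger to a smaller set of variables. -/
noncomputable def shrink {S T : Finset Var} (h : S ⊆ T) : (T → ℂ) →L[ℂ] (S → ℂ) :=
  ContinuousLinearMap.pi fun s => ContinuousLinearMap.proj ⟨s.1, h s.2⟩

theorem shrink_restr {S T : Finset Var} (h : S ⊆ T) (j : Jet) :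
    shrink h (restr T j) = restr S j := rfl

theorem DynAt.congr {Ω : Set Jet} {g g' : Jet → ℂ} {j : Jet} (hg : DynAt Ω g j)
    (h : ∀ᶠ j' in 𝓝[Ω] j, g' j' = g j') : DynAt Ω g' j := by
  obtain ⟨S, G, hG, hgG⟩ := hg
  exact ⟨S, G, hG, by filter_upwards [h, hgG] with j' h1 h2; rw [h1, h2]⟩

/-- Two germs can be written over a common finite set of variables. -/
theorem DynAt.common {Ω : Set Jet} {g g' : Jet → ℂ} {j : Jet} (hg : DynAt Ω g j)
    (hg' : DynAt Ω g' j) : ∃ (S : Finset Var) (G G' : (S → ℂ) → ℂ),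
      AnalyticAt ℂ G (restr S j) ∧ AnalyticAt ℂ G' (restr S j) ∧
      (∀ᶠ j' in 𝓝[Ω] j, g j' = G (restr S j')) ∧ ∀ᶠ j' in 𝓝[Ω] j, g' j' = G' (restr S j') := by
  classical
  obtain ⟨S, G, hG, hgG⟩ := hg
  obtain ⟨S', G', hG', hgG'⟩ := hg'
  have h1 : S ⊆ S ∪ S' := Finset.subset_union_left
  have h2 : S' ⊆ S ∪ S' := Finset.subset_union_right
  refine ⟨S ∪ S', G ∘ shrink h1, G' ∘ shrink h2, ?_, ?_, hgG, hgG'⟩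
  · exact AnalyticAt.comp (by rwa [shrink_restr]) ((shrink h1).analyticAt _)
  · exact AnalyticAt.comp (by rwa [shrink_restr]) ((shrink h2).analyticAt _)

theorem DynAt.add {Ω : Set Jet} {g g' : Jet → ℂ} {j : Jet} (hg : DynAt Ω g j)
    (hg' : DynAt Ω g' j) : DynAt Ω (fun j => g j + g' j) j := by
  obtain ⟨S, G, G', hG, hG', e, e'⟩ := hg.common hg'
  exact ⟨S, fun v => G v + G' v, hG.add hG',
    by filter_upwards [e, e'] with j' h1 h2; rw [h1, h2]⟩

theorem DynAt.mul {Ω : Set Jet} {g g' : Jet → ℂ} {j : Jet} (hg : DynAt Ω g j)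
    (hg' : DynAt Ω g' j) : DynAt Ω (fun j => g j * g' j) j := by
  obtain ⟨S, G, G', hG, hG', e, e'⟩ := hg.common hg'
  exact ⟨S, fun v => G v * G' v, hG.mul hG',
    by filter_upwards [e, e'] with j' h1 h2; rw [h1, h2]⟩

theorem DynAt.const (Ω : Set Jet) (c : ℂ) (j : Jet) : DynAt Ω (fun _ => c) j :=
  ⟨∅, fun _ => c, analyticAt_const, Filter.Eventually.of_forall fun _ => rfl⟩

theorem DynAt.sum {Ω : Set Jet} {ι : Type*} (T : Finset ι) {g : ι → Jet → ℂ} {j : Jet}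
    (hg : ∀ i ∈ T, DynAt Ω (g i) j) : DynAt Ω (fun j => ∑ i ∈ T, g i j) j := by
  classical
  induction T using Finset.induction_on with
  | empty => simpa using DynAt.const Ω 0 j
  | insert a T ha ih =>
    simp only [Finset.sum_insert ha]
    exact (hg a (by simp)).add (ih fun i hi => hg i (by simp [hi]))

/-- One may move a little along each coordinate without leaving `Ω`. -/
class CoordOpen (Ω : Set Jet) : Prop where
  update_mem : ∀ j ∈ Ω, ∀ s : Var, ∀ᶠ z in 𝓝 (j s), Function.update j s z ∈ Ω

theorem tendsto_update {Ω : Set Jet} [CoordOpen Ω] {j : Jet} (hj : j ∈ Ω) (s : Var) :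
    Filter.Tendsto (fun z => Function.update j s z) (𝓝 (j s)) (𝓝[Ω] j) := by
  refine tendsto_nhdsWithin_iff.2 ⟨?_, CoordOpen.update_mem j hj s⟩
  have : Continuous fun z : ℂ => Function.update j s z := by fun_prop
  simpa using this.tendsto (j s)

/-- Germs are taken within `Ω`, which need not be open in the product topology. Openness along each
coordinate line is enough for a partial derivative to depend on the germ only. -/
theorem partialD_congr {Ω : Set Jet} [CoordOpen Ω] {g g' : Jet → ℂ} {j : Jet} (hj : j ∈ Ω)
    (h : ∀ᶠ j' in 𝓝[Ω] j, g j' = g' j') (s : Var) : partialD s g j = partialD s g' j :=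
  Filter.EventuallyEq.deriv_eq ((tendsto_update hj s).eventually h)

theorem restr_update_mem {S : Finset Var} {s : Var} (hs : s ∈ S) (j : Jet) (z : ℂ) :
    restr S (Function.update j s z) = Function.update (restr S j) ⟨s, hs⟩ z := by
  ext t
  by_cases h : t = ⟨s, hs⟩
  · subst h; simp [restr]
  · have h' : (t : Var) ≠ s := fun h' => h (Subtype.ext h')
    simp [restr, h, h']

theorem restr_update_not_mem {S : Finset Var} {s : Var} (hs : s ∉ S) (j : Jet) (z : ℂ) :
    restr S (Function.update j s z) = restr S j := by
  ext t
  have h' : (t : Var) ≠ s := fun h' => hs (h' ▸ t.2)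
  simp [restr, h']

open Classical in
/-- Partial derivative of a function of finitely many variables. -/
noncomputable def coordD {S : Finset Var} (G : (S → ℂ) → ℂ) (s : Var) (v : S → ℂ) : ℂ :=
  if h : s ∈ S then fderiv ℂ G v (Pi.single ⟨s, h⟩ 1) else 0

theorem hasDerivAt_slice {S : Finset Var} {G : (S → ℂ) → ℂ} {j : Jet}
    (hG : AnalyticAt ℂ G (restr S j)) (s : Var) :
    HasDerivAt (fun z => G (restr S (Function.update j s z))) (coordD G s (restr S j)) (j s) := by
  unfold coordD
  split_ifs with h
  · simp only [restr_update_mem h]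
    have h1 := hasDerivAt_update (restr S j) ⟨s, h⟩ (j s)
    have h2 : Function.update (restr S j) ⟨s, h⟩ (j s) = restr S j := by
      rw [← restr_update_mem h]; simp
    exact HasFDerivAt.comp_hasDerivAt (j s)
      (by rw [h2]; exact hG.differentiableAt.hasFDerivAt) h1
  · simp only [restr_update_not_mem h]
    exact hasDerivAt_const _ _

theorem analyticAt_coordD {S : Finset Var} {G : (S → ℂ) → ℂ} {v : S → ℂ}
    (hG : AnalyticAt ℂ G v) (s : Var) : AnalyticAt ℂ (coordD G s) v := by
  by_cases h : s ∈ S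
  · have : coordD G s = fun v => fderiv ℂ G v (Pi.single ⟨s, h⟩ 1) := by
      ext v; simp [coordD, h]
    rw [this]
    exact ((ContinuousLinearMap.apply ℂ ℂ (Pi.single (⟨s, h⟩ : S) (1 : ℂ))).analyticAt _).comp hG.fderiv
  · have : coordD G s = fun _ => 0 := by ext v; simp [coordD, h]
    rw [this]
    exact analyticAt_const

theorem coordD_comm {S : Finset Var} {G : (S → ℂ) → ℂ} {v : S → ℂ}
    (hG : AnalyticAt ℂ G v) (s t : Var) :
    coordD (coordD G s) t v = coordD (coordD G t) s v := by
  by_cases hs : s ∈ S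
  · by_cases ht : t ∈ S
    · have e : ∀ r (hr : r ∈ S),
          coordD G r = fun v => fderiv ℂ G v (Pi.single ⟨r, hr⟩ 1) := by
        intro r hr; ext v; simp [coordD, hr]
      have hd : DifferentiableAt ℂ (fderiv ℂ G) v := hG.fderiv.differentiableAt
      have key : ∀ r (hr : r ∈ S) (w : S → ℂ),
          fderiv ℂ (fun v => fderiv ℂ G v (Pi.single ⟨r, hr⟩ 1)) v w
            = fderiv ℂ (fderiv ℂ G) v w (Pi.single ⟨r, hr⟩ 1) := by
        intro r hr w
        rw [fderiv_clm_apply hd (by fun_prop)]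
        simp
      have hsymm := hG.contDiffAt.isSymmSndFDerivAt_of_omega
      rw [e s hs, e t ht]
      simp only [coordD, hs, ht, dif_pos]
      rw [key, key]
      exact hsymm _ _
    · have e1 : coordD G t = fun _ => 0 := by ext v; simp [coordD, ht]
      rw [e1]
      simp [coordD, ht, hs]
  · have e1 : coordD G s = fun _ => 0 := by ext v; simp [coordD, hs]
    rw [e1]
    simp [coordD, hs]

theorem eventually_analytic_restr {Ω : Set Jet} {S : Finset Var} {G : (S → ℂ) → ℂ} {j : Jet}
    (hG : AnalyticAt ℂ G (restr S j)) : ∀ᶠ j' in 𝓝[Ω] j, AnalyticAt ℂ G (restr S j') :=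
  ((continuous_restr S).tendsto j).mono_left nhdsWithin_le_nhds |>.eventually
    hG.eventually_analyticAt

theorem eventually_partialD {Ω : Set Jet} [CoordOpen Ω] {g : Jet → ℂ} {j : Jet}
    {S : Finset Var} {G : (S → ℂ) → ℂ} (hG : AnalyticAt ℂ G (restr S j))
    (h : ∀ᶠ j' in 𝓝[Ω] j, g j' = G (restr S j')) :
    ∀ᶠ j' in 𝓝[Ω] j, ∀ s, partialD s g j' = coordD G s (restr S j') := by
  have h1 := eventually_eventually_nhdsWithin.2 h
  filter_upwards [h1, eventually_analytic_restr (Ω := Ω) hG, self_mem_nhdsWithin]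
    with j' h1 h2 h3 s
  rw [partialD_congr h3 h1 s]
  exact (hasDerivAt_slice h2 s).deriv

theorem DynAt.partialD {Ω : Set Jet} [CoordOpen Ω] {g : Jet → ℂ} {j : Jet}
    (hg : DynAt Ω g j) (s : Var) : DynAt Ω (partialD s g) j := by
  obtain ⟨S, G, hG, e⟩ := hg
  exact ⟨S, coordD G s, analyticAt_coordD hG s,
    (eventually_partialD hG e).mono fun _ h => h s⟩

theorem DynAt.hasDerivAt {Ω : Set Jet} [CoordOpen Ω] {g : Jet → ℂ} {j : Jet} (hj : j ∈ Ω)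
    (hg : DynAt Ω g j) (s : Var) :
    HasDerivAt (fun z => g (Function.update j s z)) (QChain.partialD s g j) (j s) := by
  obtain ⟨S, G, hG, e⟩ := hg
  have h1 := hasDerivAt_slice hG s
  have h2 := (tendsto_update hj s).eventually e
  have h3 := h1.congr_of_eventuallyEq h2
  rw [QChain.partialD, h3.deriv]
  exact h3

theorem DynAt.partialD_comm {Ω : Set Jet} [CoordOpen Ω] {g : Jet → ℂ} {j : Jet} (hj : j ∈ Ω)
    (hg : DynAt Ω g j) (s t : Var) :
    QChain.partialD t (QChain.partialD s g) j = QChain.partialD s (QChain.partialD t g) j := by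
  obtain ⟨S, G, hG, e⟩ := hg
  have h := eventually_partialD hG e
  have key : ∀ s t, QChain.partialD t (QChain.partialD s g) j
      = coordD (coordD G s) t (restr S j) := by
    intro s t
    rw [partialD_congr hj (h.mono fun _ h => h s) t]
    exact (hasDerivAt_slice (analyticAt_coordD hG s) t).deriv
  rw [key, key, coordD_comm hG]

/-- Near each point all but finitely many partial derivatives vanish. -/
theorem DynAt.eventually_finite {Ω : Set Jet} [CoordOpen Ω] {g : Jet → ℂ} {j : Jet}
    (hg : DynAt Ω g j) : ∃ S : Finset Var, ∀ᶠ j' in 𝓝[Ω] j, ∀ s ∉ S, QChain.partialD s g j' = 0 := by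
  obtain ⟨S, G, hG, e⟩ := hg
  refine ⟨S, (eventually_partialD hG e).mono fun j' h s hs => ?_⟩
  rw [h s]; simp [coordD, hs]

/-! ### The algebra of dynamical functions and its derivations -/

open Classical in
/-- Extension by zero of a function on `Ω`. -/
noncomputable def ext0 {Ω : Set Jet} (g : Ω → ℂ) : Jet → ℂ :=
  fun j => if h : j ∈ Ω then g ⟨j, h⟩ else 0

theorem ext0_apply {Ω : Set Jet} (g : Ω → ℂ) (j : Ω) : ext0 g j = g j := by
  simp [ext0]

theorem ext0_of_mem {Ω : Set Jet} (g : Ω → ℂ) {j : Jet} (h : j ∈ Ω) : ext0 g j = g ⟨j, h⟩ := by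
  simp [ext0, h]

/-- The algebra of locally analytic functions of the dynamical variables on `Ω`. -/
noncomputable def dynAlg (Ω : Set Jet) : Subalgebra ℂ (Ω → ℂ) where
  carrier := {g | ∀ j ∈ Ω, DynAt Ω (ext0 g) j}
  mul_mem' := by
    intro a b ha hb j hj
    refine ((ha j hj).mul (hb j hj)).congr ?_
    filter_upwards [self_mem_nhdsWithin] with j' h
    simp [ext0_of_mem _ h]
  add_mem' := by
    intro a b ha hb j hj
    refine ((ha j hj).add (hb j hj)).congr ?_
    filter_upwards [self_mem_nhdsWithin] with j' h
    simp [ext0_of_mem _ h]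
  algebraMap_mem' := by
    intro c j hj
    refine (DynAt.const Ω c j).congr ?_
    filter_upwards [self_mem_nhdsWithin] with j' h
    simp [ext0_of_mem _ h]

variable {Ω : Set Jet}

/-- The element of `dynAlg Ω` given by a dynamical function. -/
noncomputable def toAlg (g : Jet → ℂ) (hg : IsDynamical Ω g) : dynAlg Ω :=
  ⟨fun j => g j, fun j hj => DynAt.congr (hg j hj) (by
    filter_upwards [self_mem_nhdsWithin] with j' h
    simp [ext0_of_mem _ h])⟩

theorem alg_ext {a b : dynAlg Ω} (h : ∀ j, a.1 j = b.1 j) : a = b :=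
  Subtype.ext (funext h)

@[simp] theorem alg_neg (a : dynAlg Ω) (j : Ω) : (-a).1 j = -a.1 j := rfl
@[simp] theorem alg_add (a b : dynAlg Ω) (j : Ω) : (a + b).1 j = a.1 j + b.1 j := rfl
@[simp] theorem alg_mul (a b : dynAlg Ω) (j : Ω) : (a * b).1 j = a.1 j * b.1 j := rfl
@[simp] theorem alg_sub (a b : dynAlg Ω) (j : Ω) : (a - b).1 j = a.1 j - b.1 j := rfl
@[simp] theorem alg_zero (j : Ω) : (0 : dynAlg Ω).1 j = 0 := rfl
@[simp] theorem alg_smul (c : ℂ) (a : dynAlg Ω) (j : Ω) : (c • a).1 j = c * a.1 j := rfl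

theorem alg_sum {ι : Type*} (S : Finset ι) (a : ι → dynAlg Ω) (j : Ω) :
    (∑ i ∈ S, a i).1 j = ∑ i ∈ S, (a i).1 j := by
  classical
  induction S using Finset.induction_on with
  | empty => simp
  | insert x S hx ih => simp [Finset.sum_insert hx, ih]

theorem alg_dynAt (a : dynAlg Ω) (j : Ω) : DynAt Ω (ext0 a.1) j := a.2 j j.2

theorem DynAt.coord (s : Var) (j : Jet) : DynAt Ω (fun j => j s) j :=
  ⟨{s}, fun v => v ⟨s, by simp⟩,
    (ContinuousLinearMap.proj (R := ℂ) (φ := fun _ : ({s} : Finset Var) => ℂ)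
      ⟨s, by simp⟩).analyticAt _, Filter.Eventually.of_forall fun _ => rfl⟩

/-- The dynamical variables as elements of the algebra. -/
noncomputable def crd (s : Var) : dynAlg Ω := toAlg (fun j => j s) fun j _ => DynAt.coord s j

@[simp] theorem crd_apply (s : Var) (j : Ω) : (crd s : dynAlg Ω).1 j = j.1 s := rfl

variable [CoordOpen Ω]

theorem partialD_ext0 (a : dynAlg Ω) {g : Jet → ℂ} (h : ∀ j : Ω, g j = a.1 j) (s : Var) (j : Ω) :
    partialD s g j = partialD s (ext0 a.1) j := by
  refine partialD_congr j.2 ?_ s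
  filter_upwards [self_mem_nhdsWithin] with j' hj'
  rw [ext0_of_mem _ hj']; exact h ⟨j', hj'⟩

theorem partialD_eq_of_hasDerivAt {g : Jet → ℂ} {j : Jet} (hj : j ∈ Ω) {s : Var} {h : ℂ → ℂ} {c : ℂ}
    (hh : HasDerivAt h c (j s))
    (e : ∀ z, Function.update j s z ∈ Ω → g (Function.update j s z) = h z) :
    partialD s g j = c := by
  refine (hh.congr_of_eventuallyEq ?_).deriv
  filter_upwards [CoordOpen.update_mem j hj s] with z hz using e z hz

/-- The partial derivative `∂/∂s` as a derivation of the algebra of dynamical functions. -/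
noncomputable def pd (s : Var) : Derivation ℂ (dynAlg Ω) (dynAlg Ω) :=
  Derivation.mk'
    { toFun := fun a => ⟨fun j => partialD s (ext0 a.1) j, fun j hj => by
        refine (DynAt.partialD (a.2 j hj) s).congr ?_
        filter_upwards [self_mem_nhdsWithin] with j' h
        simp [ext0_of_mem _ h]⟩
      map_add' := by
        intro a b
        refine alg_ext fun j => ?_
        refine partialD_eq_of_hasDerivAt j.2
          (((alg_dynAt a j).hasDerivAt j.2 s).add ((alg_dynAt b j).hasDerivAt j.2 s)) ?_
        intro z hz
        simp [ext0_of_mem _ hz]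
      map_smul' := by
        intro c a
        refine alg_ext fun j => ?_
        refine partialD_eq_of_hasDerivAt j.2 (((alg_dynAt a j).hasDerivAt j.2 s).const_mul c) ?_
        intro z hz
        simp [ext0_of_mem _ hz] }
    (by
      intro a b
      refine alg_ext fun j => ?_
      have h := ((alg_dynAt a j).hasDerivAt j.2 s).mul ((alg_dynAt b j).hasDerivAt j.2 s)
      simp only [Function.update_eq_self, ext0_apply] at h
      have h2 := partialD_eq_of_hasDerivAt (g := ext0 (a * b).1) j.2 h (by
        intro z hz
        simp [ext0_of_mem _ hz])
      simp only [LinearMap.coe_mk, AddHom.coe_mk, smul_eq_mul, alg_add, alg_mul]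
      rw [h2]; ring)

theorem partialD_eq_pd (a : dynAlg Ω) {g : Jet → ℂ} (h : ∀ j : Ω, g j = a.1 j) (s : Var) (j : Ω) :
    partialD s g j = (pd s a).1 j := partialD_ext0 a h s j

theorem pd_comm (s t : Var) (a : dynAlg Ω) : pd s (pd t a) = pd t (pd s a) := by
  refine alg_ext fun j => ?_
  have key : ∀ s t, (pd s (pd t a)).1 j = partialD s (partialD t (ext0 a.1)) j := by
    intro s t
    exact (partialD_ext0 (pd t a) (fun _ => rfl) s j).symm
  rw [key, key]
  exact ((alg_dynAt a j).partialD_comm j.2 t s)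

theorem pd_local {a b : dynAlg Ω} {j : Ω} (h : ∀ᶠ j' in 𝓝[Ω] j.1, ext0 a.1 j' = ext0 b.1 j')
    (s : Var) : (pd s a).1 j = (pd s b).1 j := partialD_congr j.2 h s

theorem exists_finset (a : dynAlg Ω) (j : Ω) :
    ∃ S : Finset Var, ∀ᶠ j' in 𝓝[Ω] j.1, ∀ s ∉ S, ∀ h : j' ∈ Ω, (pd s a).1 ⟨j', h⟩ = 0 := by
  obtain ⟨S, hS⟩ := (alg_dynAt a j).eventually_finite
  refine ⟨S, hS.mono fun j' h s hs hj' => ?_⟩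
  exact h s hs

theorem exists_finset_at (a : dynAlg Ω) (j : Ω) : ∃ S : Finset Var, ∀ s ∉ S, (pd s a).1 j = 0 := by
  obtain ⟨S, hS⟩ := exists_finset a j
  exact ⟨S, fun s hs => hS.self_of_nhdsWithin j.2 s hs j.2⟩

theorem finsum_pd_eq {a : dynAlg Ω} {j : Ω} {S : Finset Var} (hS : ∀ s ∉ S, (pd s a).1 j = 0)
    (V : Var → ℂ) : ∑ᶠ s, V s * (pd s a).1 j = ∑ s ∈ S, V s * (pd s a).1 j := by
  refine finsum_eq_sum_of_support_subset _ fun s hs => ?_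
  by_contra h
  exact hs (by simp [hS s h])

theorem pd_finite (a : dynAlg Ω) (j : Ω) (V : Var → ℂ) :
    (Function.support fun s => V s * (pd s a).1 j).Finite := by
  obtain ⟨S, hS⟩ := exists_finset_at a j
  refine S.finite_toSet.subset fun s hs => ?_
  by_contra h
  exact hs (by simp [hS s h])

/-- The derivation `∑ V_s ∂/∂s`. -/
noncomputable def vf (V : Var → dynAlg Ω) : Derivation ℂ (dynAlg Ω) (dynAlg Ω) :=
  Derivation.mk'
    { toFun := fun a => ⟨fun j => ∑ᶠ s, (V s).1 j * (pd s a).1 j, fun j hj => by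
        -- Near `j` one finite set of variables carries all nonzero partial derivatives of `a`, so
        -- the formally infinite sum is locally a fixed finite one.
        obtain ⟨S, hS⟩ := exists_finset a ⟨j, hj⟩
        have h1 : DynAt Ω (fun j' => ∑ s ∈ S, ext0 (V s).1 j' * ext0 (pd s a).1 j') j :=
          DynAt.sum S fun s _ => ((V s).2 j hj).mul ((pd s a).2 j hj)
        refine h1.congr ?_
        filter_upwards [self_mem_nhdsWithin, hS] with j' h h2
        simp only [ext0_of_mem _ h]
        exact finsum_pd_eq (fun s hs => h2 s hs h) _⟩
      map_add' := by
        intro a b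
        refine alg_ext fun j => ?_
        simp only [map_add, alg_add, mul_add]
        exact finsum_add_distrib (pd_finite a j _) (pd_finite b j _)
      map_smul' := by
        intro c a
        refine alg_ext fun j => ?_
        change ∑ᶠ s, (V s).1 j * (pd s (c • a)).1 j = c * ∑ᶠ s, (V s).1 j * (pd s a).1 j
        rw [mul_finsum]
        exact finsum_congr fun s => by
          rw [Derivation.map_smul, alg_smul]; ring }
    (by
      intro a b
      refine alg_ext fun j => ?_
      simp only [LinearMap.coe_mk, AddHom.coe_mk, Derivation.leibniz, smul_eq_mul, alg_add,
        alg_mul, mul_add, mul_left_comm _ (a.1 j), mul_left_comm _ (b.1 j)]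
      rw [mul_finsum, mul_finsum]
      refine finsum_add_distrib ?_ ?_
      · exact (pd_finite b j fun s => a.1 j * (V s).1 j).subset fun s hs => by
          simpa [mul_assoc] using hs
      · exact (pd_finite a j fun s => b.1 j * (V s).1 j).subset fun s hs => by
          simpa [mul_assoc] using hs)

theorem vf_apply (V : Var → dynAlg Ω) (a : dynAlg Ω) (j : Ω) :
    (vf V a).1 j = ∑ᶠ s, (V s).1 j * (pd s a).1 j := rfl

theorem pd_crd (s t : Var) : pd s (crd t : dynAlg Ω) = if s = t then 1 else 0 := by
  refine alg_ext fun j => ?_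
  by_cases h : s = t
  · subst h
    rw [if_pos rfl]
    exact partialD_eq_of_hasDerivAt j.2 (hasDerivAt_id _) fun z hz => by
      rw [ext0_of_mem _ hz, crd_apply]; simp
  · rw [if_neg h]
    exact partialD_eq_of_hasDerivAt j.2 (hasDerivAt_const (j.1 s) (j.1 t)) fun z hz => by
      rw [ext0_of_mem _ hz, crd_apply]; simp [Function.update_of_ne (Ne.symm h)]

@[simp] theorem vf_crd (V : Var → dynAlg Ω) (t : Var) : vf V (crd t) = V t := by
  refine alg_ext fun j => ?_
  rw [vf_apply, finsum_eq_single _ t]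
  · simp [pd_crd]
  · intro s hs
    simp [pd_crd, hs]

/-- Derivations that are (locally finite) combinations of the partial derivatives. -/
def IsVF (T : Derivation ℂ (dynAlg Ω) (dynAlg Ω)) : Prop := T = vf fun s => T (crd s)

theorem isVF_vf (V : Var → dynAlg Ω) : IsVF (vf V) := by
  unfold IsVF; simp

theorem IsVF.apply {T : Derivation ℂ (dynAlg Ω) (dynAlg Ω)} (hT : IsVF T) (a : dynAlg Ω) (j : Ω) :
    (T a).1 j = ∑ᶠ s, (T (crd s)).1 j * (pd s a).1 j := by
  conv_lhs => rw [hT]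
  rfl

theorem isVF_of_apply {T : Derivation ℂ (dynAlg Ω) (dynAlg Ω)}
    (h : ∀ a j, (T a).1 j = ∑ᶠ s, (T (crd s)).1 j * (pd s a).1 j) : IsVF T := by
  refine Derivation.ext fun a => alg_ext fun j => ?_
  rw [h]; rfl

/-- The predicate `IsVF` is what lets values on the coordinates determine a derivation of this large
algebra; equalities of operators are all checked this way. -/
theorem IsVF.ext {T T' : Derivation ℂ (dynAlg Ω) (dynAlg Ω)} (hT : IsVF T) (hT' : IsVF T')
    (h : ∀ s, T (crd s) = T' (crd s)) : T = T' := by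
  rw [hT, hT']; simp only [h]

theorem IsVF.smul {T : Derivation ℂ (dynAlg Ω) (dynAlg Ω)} (hT : IsVF T) (a : dynAlg Ω) :
    IsVF (a • T) := by
  refine isVF_of_apply fun b j => ?_
  simp only [Derivation.smul_apply, smul_eq_mul, alg_mul, mul_assoc]
  rw [hT.apply, mul_finsum]

theorem IsVF.add {T T' : Derivation ℂ (dynAlg Ω) (dynAlg Ω)} (hT : IsVF T) (hT' : IsVF T') :
    IsVF (T + T') := by
  refine isVF_of_apply fun b j => ?_
  simp only [Derivation.add_apply, alg_add, add_mul]
  rw [hT.apply, hT'.apply, finsum_add_distrib (pd_finite b j _) (pd_finite b j _)]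

theorem IsVF.sub {T T' : Derivation ℂ (dynAlg Ω) (dynAlg Ω)} (hT : IsVF T) (hT' : IsVF T') :
    IsVF (T - T') := by
  refine isVF_of_apply fun b j => ?_
  simp only [Derivation.sub_apply, alg_sub, sub_mul]
  rw [hT.apply, hT'.apply, finsum_sub_distrib (pd_finite b j _) (pd_finite b j _)]

theorem IsVF.local {T : Derivation ℂ (dynAlg Ω) (dynAlg Ω)} (hT : IsVF T) {a b : dynAlg Ω} {j : Ω}
    (h : ∀ᶠ j' in 𝓝[Ω] j.1, ext0 a.1 j' = ext0 b.1 j') : (T a).1 j = (T b).1 j := by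
  rw [hT.apply, hT.apply]
  exact finsum_congr fun s => by rw [pd_local h s]

/-- The composite of two fields splits into a first-order part and a second-order part whose
coefficients are products of those of `T` and `T'`. -/
theorem IsVF.comp_apply {T T' : Derivation ℂ (dynAlg Ω) (dynAlg Ω)} (hT : IsVF T) (hT' : IsVF T')
    {a : dynAlg Ω} {j : Ω} {S : Finset Var}
    (hS : ∀ᶠ j' in 𝓝[Ω] j.1, ∀ s ∉ S, ∀ h : j' ∈ Ω, (pd s a).1 ⟨j', h⟩ = 0) :
    (T (T' a)).1 j = ∑ s ∈ S, (T (T' (crd s))).1 j * (pd s a).1 j +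
      ∑ s ∈ S, ∑ r ∈ S, (T' (crd s)).1 j * ((T (crd r)).1 j * (pd r (pd s a)).1 j) := by
  have h1 : ∀ᶠ j' in 𝓝[Ω] j.1,
      ext0 (T' a).1 j' = ext0 (∑ s ∈ S, T' (crd s) * pd s a : dynAlg Ω).1 j' := by
    filter_upwards [hS, self_mem_nhdsWithin] with j' h hj'
    rw [ext0_of_mem _ hj', ext0_of_mem _ hj', hT'.apply, finsum_pd_eq (fun s hs => h s hs hj'),
      alg_sum]
    rfl
  -- Partial derivatives commute and `pd r a` is zero in a whole neighbourhood, so the same `S`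
  -- works for every `pd s a`.
  have h2 : ∀ s, ∀ r ∉ S, (pd r (pd s a)).1 j = 0 := by
    intro s r hr
    rw [pd_comm]
    have : ∀ᶠ j' in 𝓝[Ω] j.1, ext0 (pd r a).1 j' = ext0 (0 : dynAlg Ω).1 j' := by
      filter_upwards [hS, self_mem_nhdsWithin] with j' h hj'
      rw [ext0_of_mem _ hj', ext0_of_mem _ hj', h r hr hj']; rfl
    rw [pd_local this s, map_zero]; rfl
  rw [hT.local h1, map_sum, alg_sum, ← Finset.sum_add_distrib]
  refine Finset.sum_congr rfl fun s _ => ?_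
  rw [Derivation.leibniz, alg_add, smul_eq_mul, smul_eq_mul, alg_mul, alg_mul, hT.apply (pd s a),
    finsum_pd_eq (h2 s), Finset.mul_sum]
  ring

/-- The second-order parts of the two composites agree by symmetry of second derivatives and cancel.
-/
theorem IsVF.bracket {T T' : Derivation ℂ (dynAlg Ω) (dynAlg Ω)} (hT : IsVF T) (hT' : IsVF T') :
    IsVF ⁅T, T'⁆ := by
  refine isVF_of_apply fun a j => ?_
  obtain ⟨S, hS⟩ := exists_finset a j
  rw [finsum_pd_eq (fun s hs => hS.self_of_nhdsWithin j.2 s hs j.2)]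
  simp only [Derivation.commutator_apply, alg_sub, sub_mul, Finset.sum_sub_distrib]
  rw [hT.comp_apply hT' hS, hT'.comp_apply hT hS,
    Finset.sum_comm (f := fun s r => (T (crd s)).1 j * ((T' (crd r)).1 j * (pd r (pd s a)).1 j))]
  have : ∀ s r : Var, (T (crd r)).1 j * ((T' (crd s)).1 j * (pd s (pd r a)).1 j)
      = (T' (crd s)).1 j * ((T (crd r)).1 j * (pd r (pd s a)).1 j) := by
    intro s r
    rw [pd_comm s r]; ring
  simp only [this]
  ring

/-- The formal vector field `V` acts on `Ω` as the derivation `T`. -/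
def Rep (V : VField) (T : Derivation ℂ (dynAlg Ω) (dynAlg Ω)) : Prop :=
  IsVF T ∧ ∀ s, ∀ j : Ω, V s j = (T (crd s)).1 j

theorem Rep.act {V : VField} {T : Derivation ℂ (dynAlg Ω) (dynAlg Ω)} (h : Rep V T)
    {g : Jet → ℂ} {a : dynAlg Ω} (hg : ∀ j : Ω, g j = a.1 j) (j : Ω) :
    act V g j = (T a).1 j := by
  rw [h.1.apply, QChain.act]
  exact finsum_congr fun s => by rw [h.2 s j, partialD_eq_pd a hg]

/-- Transfers the coefficientwise bracket of formal fields to the commutator of derivations, where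
the Leibniz rule and the Jacobi identity come for free. -/
theorem Rep.bracket {V V' : VField} {T T' : Derivation ℂ (dynAlg Ω) (dynAlg Ω)} (h : Rep V T)
    (h' : Rep V' T') : Rep (bracket V V') ⁅T, T'⁆ := by
  refine ⟨h.1.bracket h'.1, fun s j => ?_⟩
  rw [QChain.bracket, h.act (h'.2 s), h'.act (h.2 s), Derivation.commutator_apply, alg_sub]

theorem rep_vf {V : VField} {V' : Var → dynAlg Ω} (h : ∀ s, ∀ j : Ω, V s j = (V' s).1 j) :
    Rep V (vf V') :=
  ⟨isVF_vf _, fun s j => by rw [vf_crd]; exact h s j⟩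

end QChain

namespace QChain

/-! ### Lie algebra computations -/

section Abstract

variable {A : Type*} [CommRing A] [Algebra ℂ A]

/-- Commutation of `D` with `[Y_a, [Y_a, Y_b]] - ν [Y_a, Y_b]`. -/
theorem pair_commutation (D Ya Yb : Derivation ℂ A A) (θa θb ν : A)
    (ha : ∀ f, D (Ya f) = Ya (D f) - θa * Ya f) (hb : ∀ f, D (Yb f) = Yb (D f) - θb * Yb f)
    (f : A) :
    D ((⁅Ya, ⁅Ya, Yb⁆⁆ - ν • ⁅Ya, Yb⁆) f) =
      (⁅Ya, ⁅Ya, Yb⁆⁆ - ν • ⁅Ya, Yb⁆) (D f)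
        - (2 * θa + θb) * (⁅Ya, ⁅Ya, Yb⁆⁆ - ν • ⁅Ya, Yb⁆) f
        - (D ν + θa * ν + 2 * Ya θb + Ya θa) * ⁅Ya, Yb⁆ f
        + (2 * Ya (Yb θa) - Yb (Ya θa) - ν * Yb θa) * Ya f
        - (Ya (Ya θb) - ν * Ya θb) * Yb f := by
  simp only [Derivation.sub_apply, Derivation.smul_apply, Derivation.commutator_apply, map_sub,
    map_add, ha, hb, Derivation.leibniz, smul_eq_mul]
  ring

/-- Commutation of `D` with `[Y₁, [Y₂, [Y₁, Y₀]]] + a [Y₂, [Y₁, Y₀]]`. -/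
theorem triple_commutation (D Y0 Y1 Y2 : Derivation ℂ A A) (θ0 θ1 θ2 a l m : A)
    (h0 : ∀ f, D (Y0 f) = Y0 (D f) - θ0 * Y0 f) (h1 : ∀ f, D (Y1 f) = Y1 (D f) - θ1 * Y1 f)
    (h2 : ∀ f, D (Y2 f) = Y2 (D f) - θ2 * Y2 f) (h20 : ∀ f, Y2 (Y0 f) = Y0 (Y2 f))
    (e20 : Y2 θ0 = 0) (e210 : Y2 (Y1 θ0) = 0) (e02 : Y0 θ2 = 0) (e012 : Y0 (Y1 θ2) = 0)
    (hl : ⁅Y1, ⁅Y1, Y2⁆⁆ = l • ⁅Y1, Y2⁆) (hm : ⁅Y1, ⁅Y1, Y0⁆⁆ = m • ⁅Y1, Y0⁆)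
    (c5 : D a + a * θ1 = Y1 θ0 + Y1 θ1 + Y1 θ2)
    (c3 : Y1 (Y2 θ1) + (m + a) * Y2 θ1 = 0) (c4 : Y1 (Y0 θ1) + (l + a) * Y0 θ1 = 0)
    (c1 : Y2 (Y0 θ1) = 0) (c1' : ⁅Y2, ⁅Y1, Y0⁆⁆ θ1 = 0) (f : A) :
    D ((⁅Y1, ⁅Y2, ⁅Y1, Y0⁆⁆⁆ + a • ⁅Y2, ⁅Y1, Y0⁆⁆) f) =
      (⁅Y1, ⁅Y2, ⁅Y1, Y0⁆⁆⁆ + a • ⁅Y2, ⁅Y1, Y0⁆⁆) (D f)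
        - (θ0 + 2 * θ1 + θ2) * (⁅Y1, ⁅Y2, ⁅Y1, Y0⁆⁆⁆ + a • ⁅Y2, ⁅Y1, Y0⁆⁆) f := by
  have hl' := DFunLike.congr_fun hl f
  have hm' := DFunLike.congr_fun hm f
  simp only [Derivation.smul_apply, Derivation.commutator_apply, map_sub, smul_eq_mul,
    h20] at hl' hm' c1'
  have e1 : Y2 (Y1 (Y0 θ1)) = Y0 (Y2 (Y1 θ1)) + Y1 (Y0 (Y2 θ1)) - Y0 (Y1 (Y2 θ1)) := by
    linear_combination c1'
  have e2 : Y0 (Y2 θ1) = 0 := by rw [← h20]; exact c1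
  simp only [Derivation.add_apply, Derivation.smul_apply, Derivation.commutator_apply, map_sub,
    map_add, h0, h1, h2, Derivation.leibniz, smul_eq_mul, h20, e20, e210, e02, e012, map_zero, e1,
    e2]
  linear_combination (Y1 (Y0 f) - Y0 (Y1 f)) * (-c3) + (Y2 (Y1 f) - Y1 (Y2 f)) * c4
    + (Y2 (Y1 (Y0 f)) - Y1 (Y0 (Y2 f)) - Y0 (Y2 (Y1 f)) + Y0 (Y1 (Y2 f))) * c5
    - Y2 θ1 * hm' - Y0 θ1 * hl'

end Abstract

end QChain

namespace QChain

/-! ### Partial derivatives on `ℂ³` -/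

/-- Partial derivative in the first variable. -/
noncomputable def dx (a : ℂ × ℂ × ℂ → ℂ) (t : ℂ × ℂ × ℂ) : ℂ :=
  deriv (fun z => a (z, t.2.1, t.2.2)) t.1

/-- Partial derivative in the second variable. -/
noncomputable def dy (a : ℂ × ℂ × ℂ → ℂ) (t : ℂ × ℂ × ℂ) : ℂ :=
  deriv (fun z => a (t.1, z, t.2.2)) t.2.1

/-- Partial derivative in the third variable. -/
noncomputable def dz (a : ℂ × ℂ × ℂ → ℂ) (t : ℂ × ℂ × ℂ) : ℂ :=
  deriv (fun z => a (t.1, t.2.1, z)) t.2.2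

variable {a b : ℂ × ℂ × ℂ → ℂ} {t : ℂ × ℂ × ℂ}

theorem hasDerivAt_fst (t : ℂ × ℂ × ℂ) :
    HasDerivAt (fun z : ℂ => (z, t.2.1, t.2.2)) ((1, 0, 0) : ℂ × ℂ × ℂ) t.1 :=
  (hasDerivAt_id _).prodMk ((hasDerivAt_const _ _).prodMk (hasDerivAt_const _ _))

theorem hasDerivAt_snd (t : ℂ × ℂ × ℂ) :
    HasDerivAt (fun z : ℂ => (t.1, z, t.2.2)) ((0, 1, 0) : ℂ × ℂ × ℂ) t.2.1 :=
  (hasDerivAt_const _ _).prodMk ((hasDerivAt_id _).prodMk (hasDerivAt_const _ _))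

theorem hasDerivAt_trd (t : ℂ × ℂ × ℂ) :
    HasDerivAt (fun z : ℂ => (t.1, t.2.1, z)) ((0, 0, 1) : ℂ × ℂ × ℂ) t.2.2 :=
  (hasDerivAt_const _ _).prodMk ((hasDerivAt_const _ _).prodMk (hasDerivAt_id _))

theorem hasDerivAt_dx (h : AnalyticAt ℂ a t) :
    HasDerivAt (fun z => a (z, t.2.1, t.2.2)) (dx a t) t.1 := by
  have := HasFDerivAt.comp_hasDerivAt t.1 (f := fun z : ℂ => (z, t.2.1, t.2.2)) (f' := (1, 0, 0))
    h.differentiableAt.hasFDerivAt (hasDerivAt_fst t)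
  exact this.differentiableAt.hasDerivAt

theorem hasDerivAt_dy (h : AnalyticAt ℂ a t) :
    HasDerivAt (fun z => a (t.1, z, t.2.2)) (dy a t) t.2.1 := by
  have := HasFDerivAt.comp_hasDerivAt t.2.1 (f := fun z : ℂ => (t.1, z, t.2.2)) (f' := (0, 1, 0))
    h.differentiableAt.hasFDerivAt (hasDerivAt_snd t)
  exact this.differentiableAt.hasDerivAt

theorem hasDerivAt_dz (h : AnalyticAt ℂ a t) :
    HasDerivAt (fun z => a (t.1, t.2.1, z)) (dz a t) t.2.2 := by
  have := HasFDerivAt.comp_hasDerivAt t.2.2 (f := fun z : ℂ => (t.1, t.2.1, z)) (f' := (0, 0, 1))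
    h.differentiableAt.hasFDerivAt (hasDerivAt_trd t)
  exact this.differentiableAt.hasDerivAt

theorem dx_eq_fderiv (h : AnalyticAt ℂ a t) : dx a t = fderiv ℂ a t (1, 0, 0) :=
  (HasFDerivAt.comp_hasDerivAt t.1 (f := fun z : ℂ => (z, t.2.1, t.2.2)) (f' := (1, 0, 0))
    h.differentiableAt.hasFDerivAt (hasDerivAt_fst t)).deriv

theorem dy_eq_fderiv (h : AnalyticAt ℂ a t) : dy a t = fderiv ℂ a t (0, 1, 0) :=
  (HasFDerivAt.comp_hasDerivAt t.2.1 (f := fun z : ℂ => (t.1, z, t.2.2)) (f' := (0, 1, 0))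
    h.differentiableAt.hasFDerivAt (hasDerivAt_snd t)).deriv

theorem dz_eq_fderiv (h : AnalyticAt ℂ a t) : dz a t = fderiv ℂ a t (0, 0, 1) :=
  (HasFDerivAt.comp_hasDerivAt t.2.2 (f := fun z : ℂ => (t.1, t.2.1, z)) (f' := (0, 0, 1))
    h.differentiableAt.hasFDerivAt (hasDerivAt_trd t)).deriv

theorem analyticAt_fderiv_apply (h : AnalyticAt ℂ a t) (e : ℂ × ℂ × ℂ) :
    AnalyticAt ℂ (fun t => fderiv ℂ a t e) t :=
  ((ContinuousLinearMap.apply ℂ ℂ e).analyticAt _).comp h.fderiv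

theorem dx_eventuallyEq (h : AnalyticAt ℂ a t) :
    dx a =ᶠ[𝓝 t] fun t => fderiv ℂ a t (1, 0, 0) :=
  h.eventually_analyticAt.mono fun _ h => dx_eq_fderiv h

theorem dy_eventuallyEq (h : AnalyticAt ℂ a t) :
    dy a =ᶠ[𝓝 t] fun t => fderiv ℂ a t (0, 1, 0) :=
  h.eventually_analyticAt.mono fun _ h => dy_eq_fderiv h

theorem dz_eventuallyEq (h : AnalyticAt ℂ a t) :
    dz a =ᶠ[𝓝 t] fun t => fderiv ℂ a t (0, 0, 1) :=
  h.eventually_analyticAt.mono fun _ h => dz_eq_fderiv h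

theorem _root_.AnalyticAt.dx (h : AnalyticAt ℂ a t) : AnalyticAt ℂ (dx a) t :=
  (analyticAt_fderiv_apply h _).congr (dx_eventuallyEq h).symm

theorem _root_.AnalyticAt.dy (h : AnalyticAt ℂ a t) : AnalyticAt ℂ (dy a) t :=
  (analyticAt_fderiv_apply h _).congr (dy_eventuallyEq h).symm

theorem _root_.AnalyticAt.dz (h : AnalyticAt ℂ a t) : AnalyticAt ℂ (dz a) t :=
  (analyticAt_fderiv_apply h _).congr (dz_eventuallyEq h).symm

theorem _root_.AnalyticOnNhd.dx {D : Set (ℂ × ℂ × ℂ)} (h : AnalyticOnNhd ℂ a D) :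
    AnalyticOnNhd ℂ (QChain.dx a) D := fun t ht => (h t ht).dx

theorem _root_.AnalyticOnNhd.dy {D : Set (ℂ × ℂ × ℂ)} (h : AnalyticOnNhd ℂ a D) :
    AnalyticOnNhd ℂ (QChain.dy a) D := fun t ht => (h t ht).dy

theorem _root_.AnalyticOnNhd.dz {D : Set (ℂ × ℂ × ℂ)} (h : AnalyticOnNhd ℂ a D) :
    AnalyticOnNhd ℂ (QChain.dz a) D := fun t ht => (h t ht).dz

theorem fderiv_fderiv_symm (h : AnalyticAt ℂ a t) (e e' : ℂ × ℂ × ℂ) :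
    fderiv ℂ (fun t => fderiv ℂ a t e) t e' = fderiv ℂ (fun t => fderiv ℂ a t e') t e := by
  have key : ∀ v w, fderiv ℂ (fun t => fderiv ℂ a t v) t w = fderiv ℂ (fderiv ℂ a) t w v := by
    intro v w
    rw [fderiv_clm_apply h.fderiv.differentiableAt (by fun_prop)]
    simp
  rw [key, key]
  exact h.contDiffAt.isSymmSndFDerivAt_of_omega _ _

theorem dx_dy_comm (h : AnalyticAt ℂ a t) : dx (dy a) t = dy (dx a) t := by
  rw [dx_eq_fderiv h.dy, dy_eq_fderiv h.dx, (dy_eventuallyEq h).fderiv_eq,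
    (dx_eventuallyEq h).fderiv_eq, fderiv_fderiv_symm h]

theorem dx_dz_comm (h : AnalyticAt ℂ a t) : dx (dz a) t = dz (dx a) t := by
  rw [dx_eq_fderiv h.dz, dz_eq_fderiv h.dx, (dz_eventuallyEq h).fderiv_eq,
    (dx_eventuallyEq h).fderiv_eq, fderiv_fderiv_symm h]

theorem dy_dz_comm (h : AnalyticAt ℂ a t) : dy (dz a) t = dz (dy a) t := by
  rw [dy_eq_fderiv h.dz, dz_eq_fderiv h.dy, (dz_eventuallyEq h).fderiv_eq,
    (dy_eventuallyEq h).fderiv_eq, fderiv_fderiv_symm h]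

theorem tendsto_fst (t : ℂ × ℂ × ℂ) :
    Filter.Tendsto (fun z : ℂ => (z, t.2.1, t.2.2)) (𝓝 t.1) (𝓝 t) :=
  (hasDerivAt_fst t).continuousAt.tendsto

theorem tendsto_snd (t : ℂ × ℂ × ℂ) :
    Filter.Tendsto (fun z : ℂ => (t.1, z, t.2.2)) (𝓝 t.2.1) (𝓝 t) :=
  (hasDerivAt_snd t).continuousAt.tendsto

theorem tendsto_trd (t : ℂ × ℂ × ℂ) :
    Filter.Tendsto (fun z : ℂ => (t.1, t.2.1, z)) (𝓝 t.2.2) (𝓝 t) :=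
  (hasDerivAt_trd t).continuousAt.tendsto

theorem dx_congr (h : a =ᶠ[𝓝 t] b) : dx a t = dx b t :=
  Filter.EventuallyEq.deriv_eq ((tendsto_fst t).eventually h)

theorem dy_congr (h : a =ᶠ[𝓝 t] b) : dy a t = dy b t :=
  Filter.EventuallyEq.deriv_eq ((tendsto_snd t).eventually h)

theorem dz_congr (h : a =ᶠ[𝓝 t] b) : dz a t = dz b t :=
  Filter.EventuallyEq.deriv_eq ((tendsto_trd t).eventually h)

/-- `α_{xy} / α_x`. -/
noncomputable def lam (α : ℂ × ℂ × ℂ → ℂ) (t : ℂ × ℂ × ℂ) : ℂ := dy (dx α) t / dx α t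

/-- `α_{zy} / α_z`. -/
noncomputable def mu (α : ℂ × ℂ × ℂ → ℂ) (t : ℂ × ℂ × ℂ) : ℂ := dy (dz α) t / dz α t

theorem _root_.AnalyticAt.lam (h : AnalyticAt ℂ a t) (h0 : dx a t ≠ 0) : AnalyticAt ℂ (lam a) t :=
  h.dx.dy.div h.dx h0

theorem _root_.AnalyticAt.mu (h : AnalyticAt ℂ a t) (h0 : dz a t ≠ 0) : AnalyticAt ℂ (mu a) t :=
  h.dz.dy.div h.dz h0

end QChain

namespace QChain

/-! ### The characteristic operators as derivations -/

variable {D : Set (ℂ × ℂ × ℂ)}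

/-- The phase space imposes infinitely many conditions and need not be open, but u_i occurs only in
the triples numbered i-1, i, i+1. -/
theorem coordOpen_phaseSpace (hD : IsOpen D) : CoordOpen (phaseSpace D) where
  update_mem := by
    intro j hj s
    rcases s with ⟨i, k⟩ | i
    · have h1 : ∀ n ∈ Finset.Icc (i - 1) (i + 1), ∀ᶠ z in 𝓝 (j (Sum.inl (i, k))),
          triple (Function.update j (Sum.inl (i, k)) z) n ∈ D := by
        intro n _
        have hc : Continuous fun z : ℂ => triple (Function.update j (Sum.inl (i, k)) z) n := by
          unfold triple
          have := fun s : Var => (continuous_apply s).comp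
            (continuous_const.update (Sum.inl (i, k)) continuous_id :
              Continuous fun z : ℂ => Function.update j (Sum.inl (i, k)) z)
          exact (this _).prodMk ((this _).prodMk (this _))
        refine hc.continuousAt.eventually_mem (hD.mem_nhds ?_)
        simpa using hj n
      filter_upwards [(Finset.eventually_all _).2 h1] with z hz n
      by_cases hn : n ∈ Finset.Icc (i - 1) (i + 1)
      · exact hz n hn
      · have h2 : triple (Function.update j (Sum.inl (i, k)) z) n = triple j n := by
          simp only [Finset.mem_Icc, not_and_or, not_le] at hn
          unfold triple
          rw [Function.update_of_ne, Function.update_of_ne, Function.update_of_ne] <;>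
          · simp only [ne_eq, Sum.inl.injEq, Prod.mk.injEq, not_and]
            omega
        rw [h2]; exact hj n
    · refine Filter.Eventually.of_forall fun z n => ?_
      have h2 : triple (Function.update j (Sum.inr i) z) n = triple j n := by
        simp [triple]
      rw [h2]; exact hj n

instance [h : Fact (IsOpen D)] : CoordOpen (phaseSpace D) := coordOpen_phaseSpace h.out

theorem isDynamical_triple {a : ℂ × ℂ × ℂ → ℂ} (ha : AnalyticOnNhd ℂ a D) (n : ℤ) :
    IsDynamical (phaseSpace D) fun j => a (triple j n) := by
  intro j hj
  let S : Finset Var := {Sum.inl (n + 1, 0), Sum.inl (n, 0), Sum.inl (n - 1, 0)}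
  let p : ∀ s ∈ S, (S → ℂ) →L[ℂ] ℂ := fun s hs =>
    ContinuousLinearMap.proj (R := ℂ) (φ := fun _ : S => ℂ) ⟨s, hs⟩
  let π : (S → ℂ) →L[ℂ] ℂ × ℂ × ℂ := (p (Sum.inl (n + 1, 0)) (by simp [S])).prod
    ((p (Sum.inl (n, 0)) (by simp [S])).prod (p (Sum.inl (n - 1, 0)) (by simp [S])))
  have h1 : AnalyticAt ℂ (a ∘ π) (restr S j) :=
    AnalyticAt.comp (x := restr S j) (show AnalyticAt ℂ a (π (restr S j)) from ha _ (hj n))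
      (π.analyticAt _)
  exact ⟨S, a ∘ π, h1, Filter.Eventually.of_forall fun _ => rfl⟩

/-- The element `a(u_{n+1}, u_n, u_{n-1})` of the algebra of dynamical functions. -/
noncomputable def base {a : ℂ × ℂ × ℂ → ℂ} (ha : AnalyticOnNhd ℂ a D) (n : ℤ) :
    dynAlg (phaseSpace D) := toAlg (fun j => a (triple j n)) (isDynamical_triple ha n)

@[simp] theorem base_apply {a : ℂ × ℂ × ℂ → ℂ} (ha : AnalyticOnNhd ℂ a D) (n : ℤ)
    (j : phaseSpace D) : (base ha n).1 j = a (triple j n) := rfl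

/-- The standing assumptions on a chain. -/
structure Chain.Reg (C : Chain) (D : Set (ℂ × ℂ × ℂ)) : Prop where
  α : AnalyticOnNhd ℂ C.α D
  β : AnalyticOnNhd ℂ C.β D
  γ : AnalyticOnNhd ℂ C.γ D
  δ : AnalyticOnNhd ℂ C.δ D
  next : ∀ t ∈ D, dx C.α t ≠ 0
  prev : ∀ t ∈ D, dz C.α t ≠ 0

variable {C : Chain}

/-- `∂ f_n / ∂ u_{n,y} = α_n u_{n,x} + γ_n`. -/
noncomputable def Chain.Reg.θ (h : C.Reg D) (n : ℤ) : dynAlg (phaseSpace D) :=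
  base h.α n * crd (Sum.inl (n, 1)) + base h.γ n

/-- The right-hand sides as elements of the algebra. -/
noncomputable def Chain.Reg.fA (h : C.Reg D) (n : ℤ) : dynAlg (phaseSpace D) :=
  h.θ n * crd (Sum.inr n) + (base h.β n * crd (Sum.inl (n, 1)) + base h.δ n)

theorem Chain.Reg.f_eq (h : C.Reg D) (n : ℤ) (j : phaseSpace D) : C.f n j = (h.fA n).1 j := by
  simp only [Chain.f, Chain.rhs, Chain.Reg.fA, Chain.Reg.θ, alg_add, alg_mul, base_apply, crd_apply]
  ring

variable [Fact (IsOpen D)]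

theorem pd_base_next {a : ℂ × ℂ × ℂ → ℂ} (ha : AnalyticOnNhd ℂ a D) (n : ℤ) :
    pd (Sum.inl (n + 1, 0)) (base ha n) = base ha.dx n := by
  refine alg_ext fun j => ?_
  refine partialD_eq_of_hasDerivAt j.2 (hasDerivAt_dx (ha _ (j.2 n))) fun z hz => ?_
  rw [ext0_of_mem _ hz, base_apply]
  have h1 : n - 1 ≠ n + 1 := by omega
  simp [triple, h1]

theorem pd_base_self {a : ℂ × ℂ × ℂ → ℂ} (ha : AnalyticOnNhd ℂ a D) (n : ℤ) :
    pd (Sum.inl (n, 0)) (base ha n) = base ha.dy n := by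
  refine alg_ext fun j => ?_
  refine partialD_eq_of_hasDerivAt j.2 (hasDerivAt_dy (ha _ (j.2 n))) fun z hz => ?_
  rw [ext0_of_mem _ hz, base_apply]
  simp [triple]

theorem pd_base_prev {a : ℂ × ℂ × ℂ → ℂ} (ha : AnalyticOnNhd ℂ a D) (n : ℤ) :
    pd (Sum.inl (n - 1, 0)) (base ha n) = base ha.dz n := by
  refine alg_ext fun j => ?_
  refine partialD_eq_of_hasDerivAt j.2 (hasDerivAt_dz (ha _ (j.2 n))) fun z hz => ?_
  rw [ext0_of_mem _ hz, base_apply]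
  have h1 : n + 1 ≠ n - 1 := by omega
  have h2 : n ≠ n - 1 := by omega
  simp [triple, h1, h2]

theorem pd_base_other {a : ℂ × ℂ × ℂ → ℂ} (ha : AnalyticOnNhd ℂ a D) (n : ℤ) {s : Var}
    (h1 : s ≠ Sum.inl (n + 1, 0)) (h2 : s ≠ Sum.inl (n, 0)) (h3 : s ≠ Sum.inl (n - 1, 0)) :
    pd s (base ha n) = 0 := by
  refine alg_ext fun j => ?_
  refine partialD_eq_of_hasDerivAt j.2 (hasDerivAt_const _ (a (triple j n))) fun z hz => ?_
  rw [ext0_of_mem _ hz, base_apply]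
  simp [triple, Function.update_of_ne h1.symm, Function.update_of_ne h2.symm,
    Function.update_of_ne h3.symm]

theorem IsVF.base {T : Derivation ℂ (dynAlg (phaseSpace D)) (dynAlg (phaseSpace D))} (hT : IsVF T)
    {a : ℂ × ℂ × ℂ → ℂ} (ha : AnalyticOnNhd ℂ a D) (n : ℤ) :
    T (base ha n) = QChain.base ha.dx n * T (crd (Sum.inl (n + 1, 0)))
      + QChain.base ha.dy n * T (crd (Sum.inl (n, 0)))
      + QChain.base ha.dz n * T (crd (Sum.inl (n - 1, 0))) := by
  refine alg_ext fun j => ?_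
  rw [hT.apply, finsum_pd_eq
    (S := {Sum.inl (n + 1, 0), Sum.inl (n, 0), Sum.inl (n - 1, 0)})]
  · have h1 : n + 1 ≠ n - 1 := by omega
    have h2 : n ≠ n - 1 := by omega
    rw [Finset.sum_insert (by simp [h1]), Finset.sum_insert (by simp [h2]), Finset.sum_singleton,
      pd_base_next, pd_base_self, pd_base_prev]
    simp only [alg_add, alg_mul]
    ring
  · intro s hs
    simp only [Finset.mem_insert, Finset.mem_singleton, not_or] at hs
    rw [pd_base_other ha n hs.1 hs.2.1 hs.2.2]; rfl

/-- The total derivative `D_x`. -/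
noncomputable def Chain.Reg.Dfull (h : C.Reg D) :
    Derivation ℂ (dynAlg (phaseSpace D)) (dynAlg (phaseSpace D)) :=
  vf fun s => match s with
    | Sum.inl (i, k) => crd (Sum.inl (i, k + 1))
    | Sum.inr i => h.fA i

/-- The total derivative `D_x` on functions of `u, u_x, u_xx, …`. -/
noncomputable def dtot (D : Set (ℂ × ℂ × ℂ)) [Fact (IsOpen D)] :
    Derivation ℂ (dynAlg (phaseSpace D)) (dynAlg (phaseSpace D)) :=
  vf fun s => match s with
    | Sum.inl (i, k) => crd (Sum.inl (i, k + 1))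
    | Sum.inr _ => 0

/-- The coefficients of the operator `Y`. -/
noncomputable def Chain.Reg.ycoef (h : C.Reg D) : Var → dynAlg (phaseSpace D)
  | Sum.inl (i, 0) => crd (Sum.inr i)
  | Sum.inl (i, k + 1) => h.Dfull^[k] (h.fA i)
  | Sum.inr _ => 0

/-- The characteristic operator `Y_i`. -/
noncomputable def Chain.Reg.Yd (h : C.Reg D) (i : ℤ) :
    Derivation ℂ (dynAlg (phaseSpace D)) (dynAlg (phaseSpace D)) :=
  vf fun s => pd (Sum.inr i) (h.ycoef s)

theorem Chain.Reg.rep_Dx (h : C.Reg D) : Rep C.Dx h.Dfull := by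
  refine rep_vf fun s j => ?_
  rcases s with ⟨i, k⟩ | i
  · rfl
  · exact h.f_eq i j

theorem Chain.Reg.iterate_Dx (h : C.Reg D) (n : ℤ) (k : ℕ) :
    ∀ j : phaseSpace D, (act C.Dx)^[k] (C.f n) j = (h.Dfull^[k] (h.fA n)).1 j := by
  induction k with
  | zero => exact h.f_eq n
  | succ k ih =>
    intro j
    rw [Function.iterate_succ_apply', Function.iterate_succ_apply']
    exact h.rep_Dx.act ih j

theorem Chain.Reg.Y_eq (h : C.Reg D) (s : Var) (j : phaseSpace D) :
    C.Y s j = (h.ycoef s).1 j := by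
  rcases s with ⟨i, _ | k⟩ | i
  · rfl
  · exact h.iterate_Dx i k j
  · rfl

theorem isVF_pd {Ω : Set Jet} [CoordOpen Ω] (s : Var) : IsVF (pd s : Derivation ℂ (dynAlg Ω) _) := by
  refine isVF_of_apply fun a j => ?_
  rw [finsum_eq_single _ s]
  · simp [pd_crd]
  · intro t ht
    simp [pd_crd, Ne.symm ht]

theorem rep_X {Ω : Set Jet} [CoordOpen Ω] (i : ℤ) :
    Rep (X i) (pd (Sum.inr i) : Derivation ℂ (dynAlg Ω) _) := by
  refine ⟨isVF_pd _, fun s j => ?_⟩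
  rw [pd_crd, X]
  by_cases hs : s = Sum.inr i
  · simp [hs]
  · simp [hs, Ne.symm hs]

theorem Chain.Reg.rep_Yop (h : C.Reg D) (i : ℤ) : Rep (C.Yop i) (h.Yd i) := by
  refine rep_vf fun s j => ?_
  -- The coefficients of `X i` are constant, so the bracket just differentiates the coefficients of
  -- `C.Y` in u_{i,y}.
  have h0 : act C.Y (X i s) j = 0 := by
    unfold act
    refine finsum_eq_zero_of_forall_eq_zero fun r => ?_
    simp [partialD, X]
  rw [Chain.Yop, bracket, h0, sub_zero]
  exact (rep_X i).act (h.Y_eq s) j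

theorem Chain.Reg.pd_fA (h : C.Reg D) (i m : ℤ) :
    pd (Sum.inr i) (h.fA m) = if i = m then h.θ m else 0 := by
  have hb : ∀ {a : ℂ × ℂ × ℂ → ℂ} (ha : AnalyticOnNhd ℂ a D),
      pd (Sum.inr i) (base ha m) = 0 := fun ha => pd_base_other ha m (by simp) (by simp) (by simp)
  by_cases him : i = m
  · subst him
    simp [Chain.Reg.fA, Chain.Reg.θ, Derivation.leibniz, hb, pd_crd]
  · simp [Chain.Reg.fA, Chain.Reg.θ, Derivation.leibniz, hb, pd_crd, him]

theorem Chain.Reg.pd_θ (h : C.Reg D) (i m : ℤ) : pd (Sum.inr i) (h.θ m) = 0 := by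
  have hb : ∀ {a : ℂ × ℂ × ℂ → ℂ} (ha : AnalyticOnNhd ℂ a D),
      pd (Sum.inr i) (base ha m) = 0 := fun ha => pd_base_other ha m (by simp) (by simp) (by simp)
  simp [Chain.Reg.θ, Derivation.leibniz, hb, pd_crd]

/-- The relation [∂/∂u_{i,y}, D_x] = θ_i ∂/∂u_{i,y}: the total derivative contains u_{i,y} only in
its term f_i ∂/∂u_{i,y}, and f_i is affine in u_{i,y} with slope θ_i. -/
theorem Chain.Reg.pd_Dfull (h : C.Reg D) (i : ℤ) (a : dynAlg (phaseSpace D)) :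
    pd (Sum.inr i) (h.Dfull a) = h.Dfull (pd (Sum.inr i) a) + h.θ i * pd (Sum.inr i) a := by
  have hv : IsVF h.Dfull := isVF_vf _
  have key : ⁅(pd (Sum.inr i) : Derivation ℂ (dynAlg (phaseSpace D)) _), h.Dfull⁆
      = h.θ i • pd (Sum.inr i) := by
    refine ((isVF_pd _).bracket hv).ext ((isVF_pd _).smul _) fun s => ?_
    rw [Derivation.commutator_apply, Derivation.smul_apply, smul_eq_mul, pd_crd]
    rcases s with ⟨m, k⟩ | m
    · simp [Chain.Reg.Dfull, pd_crd]
    · have : h.Dfull (crd (Sum.inr m)) = h.fA m := by simp [Chain.Reg.Dfull]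
      rw [this, h.pd_fA]
      by_cases him : i = m
      · subst him; simp
      · simp [him]
  have := DFunLike.congr_fun key a
  rw [Derivation.commutator_apply, Derivation.smul_apply, smul_eq_mul] at this
  linear_combination this

/-- The coefficients of the Y_i are free of all u_{m,y}, so `h.Dfull` may be replaced by `dtot D`,
which ignores these variables. -/
theorem Chain.Reg.Dfull_eq (h : C.Reg D) {a : dynAlg (phaseSpace D)}
    (ha : ∀ i, pd (Sum.inr i) a = 0) : h.Dfull a = dtot D a := by
  refine alg_ext fun j => ?_
  rw [Chain.Reg.Dfull, dtot, vf_apply, vf_apply]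
  refine finsum_congr fun s => ?_
  rcases s with ⟨i, k⟩ | i
  · rfl
  · simp [ha]

@[simp] theorem Chain.Reg.Yd_inr (h : C.Reg D) (i m : ℤ) : h.Yd i (crd (Sum.inr m)) = 0 := by
  simp [Chain.Reg.Yd, Chain.Reg.ycoef]

@[simp] theorem Chain.Reg.Yd_zero (h : C.Reg D) (i m : ℤ) :
    h.Yd i (crd (Sum.inl (m, 0))) = if i = m then 1 else 0 := by
  simp [Chain.Reg.Yd, Chain.Reg.ycoef, pd_crd]

theorem Chain.Reg.Yd_succ (h : C.Reg D) (i m : ℤ) (k : ℕ) :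
    h.Yd i (crd (Sum.inl (m, k + 1))) = pd (Sum.inr i) (h.Dfull^[k] (h.fA m)) := by
  simp [Chain.Reg.Yd, Chain.Reg.ycoef]

@[simp] theorem Chain.Reg.Yd_one (h : C.Reg D) (i m : ℤ) :
    h.Yd i (crd (Sum.inl (m, 1))) = if i = m then h.θ m else 0 := by
  rw [h.Yd_succ i m 0, Function.iterate_zero, id, h.pd_fA]

/-- Each D_x^k(f_m) is affine in u_{m,y}. In the induction this appears as commutation of D_x with
∂/∂u_{r,y} up to the factor θ_r, itself free of these variables. -/
theorem Chain.Reg.pd_Yd_crd (h : C.Reg D) (i m r : ℤ) (k : ℕ) :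
    pd (Sum.inr r) (h.Yd i (crd (Sum.inl (m, k)))) = 0 := by
  induction k with
  | zero => rw [h.Yd_zero]; split_ifs <;> simp
  | succ k ih =>
    cases k with
    | zero => rw [h.Yd_one]; split_ifs <;> simp [h.pd_θ]
    | succ k =>
      rw [h.Yd_succ] at ih
      rw [h.Yd_succ, Function.iterate_succ_apply', h.pd_Dfull]
      rw [map_add, Derivation.leibniz, h.pd_Dfull, h.pd_θ]
      simp [ih]

@[simp] theorem dtot_inl (m : ℤ) (k : ℕ) :
    dtot D (crd (Sum.inl (m, k))) = crd (Sum.inl (m, k + 1)) := by simp [dtot]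

@[simp] theorem dtot_inr (m : ℤ) : dtot D (crd (Sum.inr m)) = 0 := by simp [dtot]

theorem isVF_dtot : IsVF (dtot D) := isVF_vf _

theorem Chain.Reg.isVF_Yd (h : C.Reg D) (i : ℤ) : IsVF (h.Yd i) := isVF_vf _

/-- This recursion for the coefficients is [D_x, Y_i] = -θ_i Y_i evaluated on coordinates. -/
theorem Chain.Reg.Yd_step (h : C.Reg D) (i m : ℤ) (k : ℕ) :
    h.Yd i (crd (Sum.inl (m, k + 1))) =
      dtot D (h.Yd i (crd (Sum.inl (m, k)))) + h.θ i * h.Yd i (crd (Sum.inl (m, k))) := by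
  cases k with
  | zero =>
    rw [h.Yd_one, h.Yd_zero]
    by_cases him : i = m
    · subst him; simp
    · simp [him]
  | succ k =>
    rw [← h.Dfull_eq fun r => h.pd_Yd_crd i m r (k + 1)]
    simp only [h.Yd_succ]
    rw [Function.iterate_succ_apply', h.pd_Dfull]

/-- `[D_x, Y_i] = -θ_i Y_i`. -/
theorem Chain.Reg.dtot_Yd (h : C.Reg D) (i : ℤ) (a : dynAlg (phaseSpace D)) :
    dtot D (h.Yd i a) = h.Yd i (dtot D a) - h.θ i * h.Yd i a := by
  have key : ⁅dtot D, h.Yd i⁆ = (-h.θ i) • h.Yd i := by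
    refine (isVF_dtot.bracket (h.isVF_Yd i)).ext ((h.isVF_Yd i).smul _) fun s => ?_
    rw [Derivation.commutator_apply, Derivation.smul_apply, smul_eq_mul]
    rcases s with ⟨m, k⟩ | m
    · rw [dtot_inl, h.Yd_step]; ring
    · simp
  have := DFunLike.congr_fun key a
  rw [Derivation.commutator_apply, Derivation.smul_apply, smul_eq_mul] at this
  linear_combination this

/-- A vector field commuting with `D_x` up to a factor vanishes if it kills all `u_i`. -/
theorem eq_zero_of_dtot {T : Derivation ℂ (dynAlg (phaseSpace D)) (dynAlg (phaseSpace D))}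
    (hT : IsVF T) {c : dynAlg (phaseSpace D)} (hc : ∀ a, dtot D (T a) = T (dtot D a) - c * T a)
    (h0 : ∀ m, T (crd (Sum.inl (m, 0))) = 0) (h1 : ∀ m, T (crd (Sum.inr m)) = 0) : T = 0 := by
  rw [hT]
  have : ∀ s, T (crd s) = 0 := by
    rintro (⟨m, k⟩ | m)
    · induction k with
      | zero => exact h0 m
      | succ k ih =>
        have := hc (crd (Sum.inl (m, k)))
        rw [dtot_inl, ih] at this
        simpa using this.symm
    · exact h1 m
  refine Derivation.ext fun a => alg_ext fun j => ?_
  simp [this, vf_apply]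

end QChain

namespace QChain

/-! ### Differential equations for the coefficients -/

/-- The equations on the coefficients at neighbouring triples `t₀ = (u_{n+1}, u_n, u_{n-1})` and
`t₁ = (u_{n+2}, u_{n+1}, u_n)` that are equivalent to
`[Y_n, [Y_n, Y_{n+1}]] = λ_n [Y_n, Y_{n+1}]`. -/
structure FirstSys (α γ : ℂ × ℂ × ℂ → ℂ) (t0 t1 : ℂ × ℂ × ℂ) : Prop where
  alpha_prev : dz (dz α) t1 = lam α t0 * dz α t1
  gamma_prev : dz (dz γ) t1 = lam α t0 * dz γ t1
  gamma_next : dy (dx γ) t0 + γ t0 * dx α t0 - α t0 * dx γ t0 = lam α t0 * dx γ t0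
  lam_next : dx (lam α) t0 + 2 * dz α t1 = 0
  lam_self : dy (lam α) t0 + α t0 * lam α t0 + dy α t0 + α t0 ^ 2 = 0
  lam_prev : dz (lam α) t0 = 0
  gamma_self : γ t0 * lam α t0 + 2 * dz γ t1 + dy γ t0 + α t0 * γ t0 = 0

/-- The mirror image of `FirstSys`, equivalent to
`[Y_{n+1}, [Y_{n+1}, Y_n]] = μ_{n+1} [Y_{n+1}, Y_n]`. -/
structure MirrorSys (α γ : ℂ × ℂ × ℂ → ℂ) (t0 t1 : ℂ × ℂ × ℂ) : Prop where
  alpha_next : dx (dx α) t0 = mu α t1 * dx α t0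
  gamma_next : dx (dx γ) t0 = mu α t1 * dx γ t0
  gamma_prev : dy (dz γ) t1 + γ t1 * dz α t1 - α t1 * dz γ t1 = mu α t1 * dz γ t1
  mu_prev : dz (mu α) t1 + 2 * dx α t0 = 0
  mu_self : dy (mu α) t1 + α t1 * mu α t1 + dy α t1 + α t1 ^ 2 = 0
  mu_next : dx (mu α) t1 = 0
  gamma_self : γ t1 * mu α t1 + 2 * dx γ t0 + dy γ t1 + α t1 * γ t1 = 0

/-- The equations at three neighbouring triples used for `Z_8 = -α_1 Z_5`. -/
structure TripleSys (α γ : ℂ × ℂ × ℂ → ℂ) (t0 t1 t2 : ℂ × ℂ × ℂ) : Prop where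
  alpha_prev : dz α t1 = dx α t0
  alpha_next : dx α t1 = dz α t2
  gamma_sum : dx γ t0 + dy γ t1 + dz γ t2 = 0
  lam_mu : lam α t1 + 2 * α t1 + mu α t1 = 0
  gamma_next : dy (dx γ) t1 + dx α t1 * γ t1 + (mu α t1 + α t1) * dx γ t1 = 0
  gamma_prev : dy (dz γ) t1 + dz α t1 * γ t1 + (lam α t1 + α t1) * dz γ t1 = 0
  alpha_mixed : dz (dx α) t1 = 0
  gamma_mixed : dz (dx γ) t1 = 0

variable {D : Set (ℂ × ℂ × ℂ)} {C : Chain}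

theorem lam_mul {α : ℂ × ℂ × ℂ → ℂ} {t : ℂ × ℂ × ℂ} (h : dx α t ≠ 0) :
    dy (dx α) t = lam α t * dx α t := by
  unfold lam; field_simp

theorem mu_mul {α : ℂ × ℂ × ℂ → ℂ} {t : ℂ × ℂ × ℂ} (h : dz α t ≠ 0) :
    dy (dz α) t = mu α t * dz α t := by
  unfold mu; field_simp

theorem Chain.Reg.lam (h : C.Reg D) : AnalyticOnNhd ℂ (lam C.α) D :=
  fun t ht => (h.α t ht).lam (h.next t ht)

theorem Chain.Reg.mu (h : C.Reg D) : AnalyticOnNhd ℂ (mu C.α) D :=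
  fun t ht => (h.α t ht).mu (h.prev t ht)

variable [Fact (IsOpen D)]

theorem Chain.Reg.Yd_base (h : C.Reg D) {a : ℂ × ℂ × ℂ → ℂ} (ha : AnalyticOnNhd ℂ a D) (i n : ℤ) :
    h.Yd i (base ha n) = if i = n + 1 then base ha.dx n else if i = n then base ha.dy n
      else if i = n - 1 then base ha.dz n else 0 := by
  rw [(h.isVF_Yd i).base ha, h.Yd_zero, h.Yd_zero, h.Yd_zero]
  split_ifs <;> first | omega | simp

theorem dtot_base {a : ℂ × ℂ × ℂ → ℂ} (ha : AnalyticOnNhd ℂ a D) (n : ℤ) :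
    dtot D (base ha n) = base ha.dx n * crd (Sum.inl (n + 1, 1))
      + base ha.dy n * crd (Sum.inl (n, 1)) + base ha.dz n * crd (Sum.inl (n - 1, 1)) := by
  rw [isVF_dtot.base ha]; simp

theorem Chain.Reg.bracket_zero (h : C.Reg D) (i k m : ℤ) :
    ⁅h.Yd i, h.Yd k⁆ (crd (Sum.inl (m, 0))) = 0 := by
  rw [Derivation.commutator_apply, h.Yd_zero, h.Yd_zero]
  split_ifs <;> simp

theorem Chain.Reg.Yd_ite (h : C.Reg D) (i : ℤ) (p : Prop) [Decidable p] :
    h.Yd i (if p then 1 else 0) = 0 := by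
  split_ifs <;> simp

/-- By `pair_commutation` the difference of the two sides commutes with D_x up to a factor once
three coefficients vanish, and it kills every u_m, so it is zero. The equations of `FirstSys` say
exactly that these coefficients vanish. -/
theorem Chain.Reg.first_bracket (h : C.Reg D) (n : ℤ)
    (hs : ∀ j : phaseSpace D, FirstSys C.α C.γ (triple j n) (triple j (n + 1))) :
    ⁅h.Yd n, ⁅h.Yd n, h.Yd (n + 1)⁆⁆ = base h.lam n • ⁅h.Yd n, h.Yd (n + 1)⁆ := by
  have n3 : n ≠ n + 1 + 1 := by omega
  -- This coefficient is affine in u_{n+1,x}, u_{n,x}, u_{n-1,x}; its four parts are `lam_next`,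
  -- `lam_self`, `lam_prev` and `gamma_self`.
  have hκ : dtot D (base h.lam n) + h.θ n * base h.lam n + 2 * h.Yd n (h.θ (n + 1))
      + h.Yd n (h.θ n) = 0 := by
    refine alg_ext fun j => ?_
    have s := hs j
    simp only [dtot_base, Chain.Reg.θ, two_mul, map_add, Derivation.leibniz, h.Yd_base, h.Yd_one]
    simp [n3]
    linear_combination (j.1 (Sum.inl (n + 1, 1))) * s.lam_next +
      (j.1 (Sum.inl (n, 1))) * s.lam_self + (j.1 (Sum.inl (n - 1, 1))) * s.lam_prev + s.gamma_self
  have hA : 2 * h.Yd n (h.Yd (n + 1) (h.θ n)) - h.Yd (n + 1) (h.Yd n (h.θ n))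
      - base h.lam n * h.Yd (n + 1) (h.θ n) = 0 := by
    refine alg_ext fun j => ?_
    have s := hs j
    have e1 := lam_mul (h.next _ (j.2 n))
    have e2 := dx_dy_comm (h.α _ (j.2 n))
    have e3 := dx_dy_comm (h.γ _ (j.2 n))
    simp only [Chain.Reg.θ, two_mul, map_add, Derivation.leibniz, h.Yd_base, h.Yd_one]
    simp [Chain.Reg.θ, Derivation.leibniz, h.Yd_base, h.Yd_one]
    linear_combination s.gamma_next + j.1 (Sum.inl (n, 1)) * e1
      - j.1 (Sum.inl (n, 1)) * e2 - e3
  have hB : h.Yd n (h.Yd n (h.θ (n + 1))) - base h.lam n * h.Yd n (h.θ (n + 1)) = 0 := by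
    refine alg_ext fun j => ?_
    have s := hs j
    simp only [Chain.Reg.θ, map_add, Derivation.leibniz, h.Yd_base, h.Yd_one]
    simp [Derivation.leibniz, h.Yd_base, h.Yd_one, n3]
    linear_combination s.gamma_prev + j.1 (Sum.inl (n + 1, 1)) * s.alpha_prev
  rw [← sub_eq_zero]
  have hV := (h.isVF_Yd n).bracket (h.isVF_Yd (n + 1))
  refine eq_zero_of_dtot (((h.isVF_Yd n).bracket hV).sub (hV.smul _))
    (c := 2 * h.θ n + h.θ (n + 1)) ?_ ?_ ?_
  · intro a
    rw [pair_commutation _ _ _ _ _ _ (h.dtot_Yd n) (h.dtot_Yd (n + 1)), hκ, hA, hB]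
    ring
  · intro m
    rw [Derivation.sub_apply, Derivation.smul_apply, Derivation.commutator_apply, h.bracket_zero,
      h.Yd_zero, map_zero]
    rw [Derivation.commutator_apply, h.Yd_ite, h.Yd_ite]
    simp
  · intro m
    simp [Derivation.commutator_apply]

/-- The argument of `Chain.Reg.first_bracket` with the order of the sites reversed. It is needed for
the double bracket that appears when Z_8 is commuted with D_x. -/
theorem Chain.Reg.mirror_bracket (h : C.Reg D) (n : ℤ)
    (hs : ∀ j : phaseSpace D, MirrorSys C.α C.γ (triple j n) (triple j (n + 1))) :
    ⁅h.Yd (n + 1), ⁅h.Yd (n + 1), h.Yd n⁆⁆ = base h.mu (n + 1) • ⁅h.Yd (n + 1), h.Yd n⁆ := by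
  have n3 : n ≠ n + 1 + 1 := by omega
  have hκ : dtot D (base h.mu (n + 1)) + h.θ (n + 1) * base h.mu (n + 1)
      + 2 * h.Yd (n + 1) (h.θ n) + h.Yd (n + 1) (h.θ (n + 1)) = 0 := by
    refine alg_ext fun j => ?_
    have s := hs j
    simp only [dtot_base, Chain.Reg.θ, two_mul, map_add, Derivation.leibniz, h.Yd_base, h.Yd_one]
    simp
    linear_combination (j.1 (Sum.inl (n, 1))) * s.mu_prev +
      (j.1 (Sum.inl (n + 1, 1))) * s.mu_self + (j.1 (Sum.inl (n + 1 + 1, 1))) * s.mu_next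
      + s.gamma_self
  have hA : 2 * h.Yd (n + 1) (h.Yd n (h.θ (n + 1))) - h.Yd n (h.Yd (n + 1) (h.θ (n + 1)))
      - base h.mu (n + 1) * h.Yd n (h.θ (n + 1)) = 0 := by
    refine alg_ext fun j => ?_
    have s := hs j
    have e1 := mu_mul (h.prev _ (j.2 (n + 1)))
    have e2 := dy_dz_comm (h.α _ (j.2 (n + 1)))
    have e3 := dy_dz_comm (h.γ _ (j.2 (n + 1)))
    simp only [Chain.Reg.θ, two_mul, map_add, Derivation.leibniz, h.Yd_base, h.Yd_one]
    simp [Chain.Reg.θ, Derivation.leibniz, h.Yd_base, h.Yd_one, n3]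
    linear_combination s.gamma_prev + j.1 (Sum.inl (n + 1, 1)) * e1
      + j.1 (Sum.inl (n + 1, 1)) * e2 + e3
  have hB : h.Yd (n + 1) (h.Yd (n + 1) (h.θ n)) - base h.mu (n + 1) * h.Yd (n + 1) (h.θ n)
      = 0 := by
    refine alg_ext fun j => ?_
    have s := hs j
    simp only [Chain.Reg.θ, map_add, Derivation.leibniz, h.Yd_base, h.Yd_one]
    simp [Derivation.leibniz, h.Yd_base, h.Yd_one]
    linear_combination s.gamma_next + j.1 (Sum.inl (n, 1)) * s.alpha_next
  rw [← sub_eq_zero]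
  have hV := (h.isVF_Yd (n + 1)).bracket (h.isVF_Yd n)
  refine eq_zero_of_dtot (((h.isVF_Yd (n + 1)).bracket hV).sub (hV.smul _))
    (c := 2 * h.θ (n + 1) + h.θ n) ?_ ?_ ?_
  · intro a
    rw [pair_commutation _ _ _ _ _ _ (h.dtot_Yd (n + 1)) (h.dtot_Yd n), hκ, hA, hB]
    ring
  · intro m
    rw [Derivation.sub_apply, Derivation.smul_apply, Derivation.commutator_apply, h.bracket_zero,
      h.Yd_zero, map_zero]
    rw [Derivation.commutator_apply, h.Yd_ite, h.Yd_ite]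
    simp
  · intro m
    simp [Derivation.commutator_apply]

end QChain

/-! ### Bracket relations for three sites, and the equations forced by the first expansion -/

namespace QChain

variable {D : Set (ℂ × ℂ × ℂ)} {C : Chain}

/-- The jet with prescribed `u_i`, prescribed `u_{i,x}`, and zero `u_{i,y}`. -/
def mkJet (q ξ : ℤ → ℂ) : Jet
  | Sum.inl (i, 0) => q i
  | Sum.inl (i, _ + 1) => ξ i
  | Sum.inr _ => 0

theorem mkJet_mem {q : ℤ → ℂ} (hq : IsConfig D q) (ξ : ℤ → ℂ) : mkJet q ξ ∈ phaseSpace D := hq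

variable [Fact (IsOpen D)]

theorem Chain.Reg.kills_base (h : C.Reg D)
    {T : Derivation ℂ (dynAlg (phaseSpace D)) (dynAlg (phaseSpace D))} (hT : IsVF T)
    (h0 : ∀ m, T (crd (Sum.inl (m, 0))) = 0) (n : ℤ) :
    T (h.θ n) = base h.α n * T (crd (Sum.inl (n, 1))) := by
  simp [Chain.Reg.θ, Derivation.leibniz, hT.base, h0]

/-- Sites at distance two do not interact: θ_n involves only u_{n±1}, u_n and u_{n,x}, so Y_{n+2}
θ_n = Y_n θ_{n+2} = 0 and the bracket commutes with D_x up to a factor. -/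
theorem Chain.Reg.Yd_comm (h : C.Reg D) (n : ℤ) : ⁅h.Yd (n + 1 + 1), h.Yd n⁆ = 0 := by
  refine eq_zero_of_dtot ((h.isVF_Yd _).bracket (h.isVF_Yd _)) (c := h.θ (n + 1 + 1) + h.θ n)
    ?_ (h.bracket_zero _ _) ?_
  · intro a
    have n1 : n ≠ n + 1 + 1 := by omega
    have n3 : n ≠ n + 1 + 1 + 1 := by omega
    have n4 : n + 1 + 1 ≠ n - 1 := by omega
    have e1 : h.Yd (n + 1 + 1) (h.θ n) = 0 := by
      simp [Chain.Reg.θ, Derivation.leibniz, h.Yd_base, n1.symm, n4]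
    have e2 : h.Yd n (h.θ (n + 1 + 1)) = 0 := by
      simp [Chain.Reg.θ, Derivation.leibniz, h.Yd_base, n1, n3]
    simp only [Derivation.commutator_apply, map_sub, h.dtot_Yd, Derivation.leibniz, e1, e2]
    simp only [smul_eq_mul]
    ring
  · intro m
    simp [Derivation.commutator_apply]

/-- For n = 0 this is Z_8 + α_1 Z_5 = 0. The method is again `eq_zero_of_dtot`; `triple_commutation`
isolates the conditions, and the double brackets arising there are reduced by the two pair
relations. -/
theorem Chain.Reg.triple_bracket (h : C.Reg D) (n : ℤ)
    (hl : ∀ j : phaseSpace D, FirstSys C.α C.γ (triple j (n + 1)) (triple j (n + 1 + 1)))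
    (hm : ∀ j : phaseSpace D, MirrorSys C.α C.γ (triple j n) (triple j (n + 1)))
    (hs : ∀ j : phaseSpace D,
      TripleSys C.α C.γ (triple j n) (triple j (n + 1)) (triple j (n + 1 + 1))) :
    ⁅h.Yd (n + 1), ⁅h.Yd (n + 1 + 1), ⁅h.Yd (n + 1), h.Yd n⁆⁆⁆
      + base h.α (n + 1) • ⁅h.Yd (n + 1 + 1), ⁅h.Yd (n + 1), h.Yd n⁆⁆ = 0 := by
  have n1 : n ≠ n + 1 + 1 := by omega
  have n3 : n ≠ n + 1 + 1 + 1 := by omega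
  have n4 : n + 1 + 1 ≠ n - 1 := by omega
  have n5 : n + 1 ≠ n + 1 + 1 + 1 := by omega
  have hV3 := (h.isVF_Yd (n + 1)).bracket (h.isVF_Yd n)
  have hV5 := (h.isVF_Yd (n + 1 + 1)).bracket hV3
  have z5 : ∀ m, ⁅h.Yd (n + 1 + 1), ⁅h.Yd (n + 1), h.Yd n⁆⁆ (crd (Sum.inl (m, 0))) = 0 := by
    intro m
    rw [Derivation.commutator_apply, h.bracket_zero, map_zero, h.Yd_zero]
    rw [Derivation.commutator_apply, h.Yd_ite, h.Yd_ite]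
    simp
  -- The outer neighbours see only the mixed derivatives α_xz and γ_xz at the middle site, and both
  -- vanish.
  have hc1 : h.Yd (n + 1 + 1) (h.Yd n (h.θ (n + 1))) = 0 := by
    refine alg_ext fun j => ?_
    have s := hs j
    have e1 := dx_dz_comm (h.α _ (j.2 (n + 1)))
    have e2 := dx_dz_comm (h.γ _ (j.2 (n + 1)))
    simp only [Chain.Reg.θ, map_add, Derivation.leibniz, h.Yd_base, h.Yd_one]
    simp [Derivation.leibniz, h.Yd_base, h.Yd_one, n1]
    linear_combination s.gamma_mixed + j.1 (Sum.inl (n + 1, 1)) * s.alpha_mixed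
      + j.1 (Sum.inl (n + 1, 1)) * e1 + e2
  refine eq_zero_of_dtot (((h.isVF_Yd _).bracket hV5).add (hV5.smul _))
    (c := h.θ n + 2 * h.θ (n + 1) + h.θ (n + 1 + 1)) ?_ ?_ ?_
  · intro a
    refine triple_commutation (dtot D) (h.Yd n) (h.Yd (n + 1)) (h.Yd (n + 1 + 1)) _ _ _ _
      (base h.lam (n + 1)) (base h.mu (n + 1)) (h.dtot_Yd n)
      (h.dtot_Yd _) (h.dtot_Yd _) ?_ ?_ ?_ ?_ ?_ (h.first_bracket (n + 1) hl)
      (h.mirror_bracket n hm) ?_ ?_ ?_ hc1 ?_ a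
    · intro f
      have := DFunLike.congr_fun (h.Yd_comm n) f
      rw [Derivation.commutator_apply] at this
      exact sub_eq_zero.1 this
    · simp [Chain.Reg.θ, Derivation.leibniz, h.Yd_base, n1.symm, n4]
    · simp [Chain.Reg.θ, Derivation.leibniz, h.Yd_base, n1.symm, n4]
    · simp [Chain.Reg.θ, Derivation.leibniz, h.Yd_base, n1, n3]
    · simp [Chain.Reg.θ, Derivation.leibniz, h.Yd_base, n1, n3, n5]
    · refine alg_ext fun j => ?_
      have s := hs j
      simp only [dtot_base, Chain.Reg.θ, map_add, Derivation.leibniz, h.Yd_base, h.Yd_one]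
      simp [n5]
      linear_combination j.1 (Sum.inl (n, 1)) * s.alpha_prev
        + j.1 (Sum.inl (n + 1 + 1, 1)) * s.alpha_next - s.gamma_sum
    · refine alg_ext fun j => ?_
      have s := hs j
      have e1 := lam_mul (h.next _ (j.2 (n + 1)))
      simp only [Chain.Reg.θ, map_add, Derivation.leibniz, h.Yd_base, h.Yd_one]
      simp [Chain.Reg.θ, Derivation.leibniz, h.Yd_base, h.Yd_one]
      linear_combination s.gamma_next + j.1 (Sum.inl (n + 1, 1)) * e1
        + j.1 (Sum.inl (n + 1, 1)) * dx C.α (triple j (n + 1)) * s.lam_mu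
    · refine alg_ext fun j => ?_
      have s := hs j
      have e1 := mu_mul (h.prev _ (j.2 (n + 1)))
      simp only [Chain.Reg.θ, map_add, Derivation.leibniz, h.Yd_base, h.Yd_one]
      simp [Chain.Reg.θ, Derivation.leibniz, h.Yd_base, h.Yd_one, n1]
      linear_combination s.gamma_prev + j.1 (Sum.inl (n + 1, 1)) * e1
        + j.1 (Sum.inl (n + 1, 1)) * dz C.α (triple j (n + 1)) * s.lam_mu
    · rw [h.kills_base hV5 z5, Derivation.commutator_apply, Derivation.commutator_apply,
        h.Yd_one, h.Yd_one, h.Yd_one, if_pos rfl, if_neg (by omega), if_neg (by omega)]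
      simp [hc1]
  · intro m
    rw [Derivation.add_apply, Derivation.smul_apply, Derivation.commutator_apply, z5, map_zero,
      h.Yd_zero]
    rw [Derivation.commutator_apply, Derivation.commutator_apply, Derivation.commutator_apply,
      h.Yd_ite, h.Yd_ite]
    simp [h.Yd_ite]
  · intro m
    simp [Derivation.commutator_apply]

theorem Chain.Reg.expansions (h : C.Reg D)
    (hl : ∀ (j : phaseSpace D) n, FirstSys C.α C.γ (triple j n) (triple j (n + 1)))
    (hm : ∀ (j : phaseSpace D) n, MirrorSys C.α C.γ (triple j n) (triple j (n + 1)))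
    (hs : ∀ (j : phaseSpace D) n,
      TripleSys C.α C.γ (triple j n) (triple j (n + 1)) (triple j (n + 1 + 1))) :
    C.Expansions D := by
  have hc : ∀ c : ℂ, IsDynamical (phaseSpace D) fun _ => c := fun c j _ => DynAt.const _ c j
  constructor
  -- The coefficient λ is α_xy/α_x globally, although the systems are obtained from local
  -- coordinates.
  · refine ⟨fun j => QChain.lam C.α (triple j 0), fun _ => 0, fun _ => 0,
      isDynamical_triple h.lam 0, hc 0, hc 0, fun j hj s => ?_⟩
    have r1 : Rep (C.W 1) ⁅h.Yd 0, h.Yd 1⁆ := (h.rep_Yop 0).bracket (h.rep_Yop 1)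
    have r2 : Rep (C.W 2) ⁅h.Yd 0, ⁅h.Yd 0, h.Yd 1⁆⁆ := (h.rep_Yop 0).bracket r1
    rw [r1.2 s ⟨j, hj⟩, r2.2 s ⟨j, hj⟩]
    have := h.first_bracket 0 fun j => hl j 0
    rw [zero_add] at this
    rw [this]
    simp
  · refine ⟨fun m => if m = 5 then fun j => -C.α (triple j 1) else fun _ => 0, fun m _ => ?_,
      fun j hj s => ?_⟩
    · dsimp only
      split_ifs
      · exact isDynamical_triple h.α.neg 1
      · exact hc 0
    · have r3 : Rep (bracket (C.Yop 1) (C.Yop 0)) ⁅h.Yd 1, h.Yd 0⁆ :=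
        (h.rep_Yop 1).bracket (h.rep_Yop 0)
      have r5 : Rep (C.Z 5) ⁅h.Yd 2, ⁅h.Yd 1, h.Yd 0⁆⁆ := (h.rep_Yop 2).bracket r3
      have r8 : Rep (C.Z 8) ⁅h.Yd 1, ⁅h.Yd 2, ⁅h.Yd 1, h.Yd 0⁆⁆⁆ := (h.rep_Yop 1).bracket r5
      have := h.triple_bracket 0 (fun j => hl j _) (fun j => hm j _) fun j => hs j _
      rw [zero_add, one_add_one_eq_two] at this
      have e := congrArg (fun a => a.1 ⟨j, hj⟩) (DFunLike.congr_fun this (crd s))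
      simp only [Derivation.add_apply, Derivation.smul_apply, smul_eq_mul, alg_add, alg_mul,
        base_apply, Derivation.zero_apply, alg_zero] at e
      simp only [Finset.sum_range_succ, Finset.sum_range_zero]
      simp only [Nat.reduceEqDiff, if_false, if_true, zero_mul, zero_add, add_zero,
        OfNat.one_ne_ofNat, OfNat.zero_ne_ofNat]
      rw [r8.2 s ⟨j, hj⟩, r5.2 s ⟨j, hj⟩]
      linear_combination e

/-- W_1 and W_2 kill every u_m, so evaluation on u_0 and u_1 removes the terms with Y_0 and Y_1.
What remains is proportionality of W_2 to W_1, stated by cross products so that the unknown λ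
disappears. -/
theorem Chain.Reg.first_cross (h : C.Reg D) (he : C.FirstExpansion D) (s t : Var) :
    ⁅h.Yd 0, h.Yd 1⁆ (crd t) * ⁅h.Yd 0, ⁅h.Yd 0, h.Yd 1⁆⁆ (crd s)
      = ⁅h.Yd 0, ⁅h.Yd 0, h.Yd 1⁆⁆ (crd t) * ⁅h.Yd 0, h.Yd 1⁆ (crd s) := by
  obtain ⟨l, σ, d, -, -, -, he⟩ := he
  have r1 : Rep (C.W 1) ⁅h.Yd 0, h.Yd 1⁆ := (h.rep_Yop 0).bracket (h.rep_Yop 1)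
  have r2 : Rep (C.W 2) ⁅h.Yd 0, ⁅h.Yd 0, h.Yd 1⁆⁆ := (h.rep_Yop 0).bracket r1
  refine alg_ext fun j => ?_
  have e := he j j.2
  simp only [fun s => r1.2 s j, fun s => r2.2 s j, fun s => (h.rep_Yop 0).2 s j,
    fun s => (h.rep_Yop 1).2 s j] at e
  have z2 : ∀ m, ⁅h.Yd 0, ⁅h.Yd 0, h.Yd 1⁆⁆ (crd (Sum.inl (m, 0))) = 0 := by
    intro m
    rw [Derivation.commutator_apply, h.bracket_zero, h.Yd_zero, map_zero]
    rw [Derivation.commutator_apply, h.Yd_ite, h.Yd_ite]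
    simp
  have hd : d j = 0 := by
    have := e (Sum.inl (0, 0))
    rw [z2, h.bracket_zero, h.Yd_zero, h.Yd_zero] at this
    simpa using this.symm
  have hσ : σ j = 0 := by
    have := e (Sum.inl (1, 0))
    rw [z2, h.bracket_zero, h.Yd_zero, h.Yd_zero] at this
    simpa using this.symm
  simp only [hd, hσ, zero_mul, add_zero] at e
  rw [alg_mul, alg_mul, e s, e t]
  ring

theorem mkJet_one (q ξ : ℤ → ℂ) (n : ℤ) : mkJet q ξ (Sum.inl (n, 1)) = ξ n := rfl

theorem Chain.Reg.bracket_crd_zero (h : C.Reg D) :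
    ⁅h.Yd 0, h.Yd 1⁆ (crd (Sum.inl (0, 1))) = -h.Yd 1 (h.θ 0) := by
  simp [Derivation.commutator_apply]

theorem Chain.Reg.bracket_crd_one (h : C.Reg D) :
    ⁅h.Yd 0, h.Yd 1⁆ (crd (Sum.inl (1, 1))) = h.Yd 0 (h.θ 1) := by
  simp [Derivation.commutator_apply]

theorem Chain.Reg.double_bracket_crd_zero (h : C.Reg D) : ⁅h.Yd 0, ⁅h.Yd 0, h.Yd 1⁆⁆ (crd (Sum.inl (0, 1)))
    = -(2 * h.Yd 0 (h.Yd 1 (h.θ 0)) - h.Yd 1 (h.Yd 0 (h.θ 0))) := by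
  rw [Derivation.commutator_apply, h.bracket_crd_zero, h.Yd_one, if_pos rfl,
    Derivation.commutator_apply, map_neg]
  ring

theorem Chain.Reg.double_bracket_crd_one (h : C.Reg D) :
    ⁅h.Yd 0, ⁅h.Yd 0, h.Yd 1⁆⁆ (crd (Sum.inl (1, 1))) = h.Yd 0 (h.Yd 0 (h.θ 1)) := by
  rw [Derivation.commutator_apply, h.bracket_crd_one, h.Yd_one, if_neg (by norm_num), map_zero,
    sub_zero]

theorem Chain.Reg.value_next (h : C.Reg D) (j : phaseSpace D) : (h.Yd 1 (h.θ 0)).1 j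
    = dx C.α (triple j 0) * j.1 (Sum.inl (0, 1)) + dx C.γ (triple j 0) := by
  simp [Chain.Reg.θ, Derivation.leibniz, h.Yd_base, mul_comm]

theorem Chain.Reg.value_prev (h : C.Reg D) (j : phaseSpace D) : (h.Yd 0 (h.θ 1)).1 j
    = dz C.α (triple j 1) * j.1 (Sum.inl (1, 1)) + dz C.γ (triple j 1) := by
  simp [Chain.Reg.θ, Derivation.leibniz, h.Yd_base, mul_comm]

theorem Chain.Reg.value_prev_prev (h : C.Reg D) (j : phaseSpace D) : (h.Yd 0 (h.Yd 0 (h.θ 1))).1 j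
    = dz (dz C.α) (triple j 1) * j.1 (Sum.inl (1, 1)) + dz (dz C.γ) (triple j 1) := by
  simp [Chain.Reg.θ, Derivation.leibniz, h.Yd_base, mul_comm]

theorem Chain.Reg.value_mixed (h : C.Reg D) (j : phaseSpace D) :
    (2 * h.Yd 0 (h.Yd 1 (h.θ 0)) - h.Yd 1 (h.Yd 0 (h.θ 0)) : dynAlg (phaseSpace D)).1 j
      = dy (dx C.α) (triple j 0) * j.1 (Sum.inl (0, 1)) + (dy (dx C.γ) (triple j 0)
        + C.γ (triple j 0) * dx C.α (triple j 0) - C.α (triple j 0) * dx C.γ (triple j 0)) := by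
  have e2 := dx_dy_comm (h.α _ (j.2 0))
  have e3 := dx_dy_comm (h.γ _ (j.2 0))
  simp only [Chain.Reg.θ, two_mul, map_add, Derivation.leibniz, h.Yd_base, h.Yd_one]
  simp [Chain.Reg.θ, Derivation.leibniz, h.Yd_base, h.Yd_one]
  linear_combination -j.1 (Sum.inl (0, 1)) * e2 - e3

/-- The cross product for u_{0,x} and u_{1,x} is an identity of bilinear polynomials in these two
free variables, a product of two affine factors on each side. Comparing the four coefficients, with
α_x and α_z nonzero, identifies λ with α_xy/α_x and yields the three equations. -/
theorem Chain.Reg.first_order (h : C.Reg D) (he : C.FirstExpansion D) {q : ℤ → ℂ} (hq : IsConfig D q) :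
    dz (dz C.α) (q 2, q 1, q 0) = QChain.lam C.α (q 1, q 0, q (-1)) * dz C.α (q 2, q 1, q 0) ∧
    dz (dz C.γ) (q 2, q 1, q 0) = QChain.lam C.α (q 1, q 0, q (-1)) * dz C.γ (q 2, q 1, q 0) ∧
    dy (dx C.γ) (q 1, q 0, q (-1)) + C.γ (q 1, q 0, q (-1)) * dx C.α (q 1, q 0, q (-1))
      - C.α (q 1, q 0, q (-1)) * dx C.γ (q 1, q 0, q (-1))
      = QChain.lam C.α (q 1, q 0, q (-1)) * dx C.γ (q 1, q 0, q (-1)) := by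
  have hx : dx C.α (q 1, q 0, q (-1)) ≠ 0 := h.next _ (by simpa using hq 0)
  have hz : dz C.α (q 2, q 1, q 0) ≠ 0 := h.prev _ (by simpa using hq 1)
  have t0 : ∀ ξ, triple (mkJet q ξ) 0 = (q 1, q 0, q (-1)) := fun ξ => rfl
  have t1 : ∀ ξ, triple (mkJet q ξ) 1 = (q 2, q 1, q 0) := fun ξ => rfl
  have cross := h.first_cross he (Sum.inl (1, 1)) (Sum.inl (0, 1))
  rw [h.bracket_crd_zero, h.bracket_crd_one, h.double_bracket_crd_zero,
    h.double_bracket_crd_one] at cross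
  have cr : ∀ ξ : ℤ → ℂ,
      (dx C.α (q 1, q 0, q (-1)) * ξ 0 + dx C.γ (q 1, q 0, q (-1)))
        * (dz (dz C.α) (q 2, q 1, q 0) * ξ 1 + dz (dz C.γ) (q 2, q 1, q 0))
      = (dy (dx C.α) (q 1, q 0, q (-1)) * ξ 0 + (dy (dx C.γ) (q 1, q 0, q (-1))
        + C.γ (q 1, q 0, q (-1)) * dx C.α (q 1, q 0, q (-1))
        - C.α (q 1, q 0, q (-1)) * dx C.γ (q 1, q 0, q (-1))))
        * (dz C.α (q 2, q 1, q 0) * ξ 1 + dz C.γ (q 2, q 1, q 0)) := by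
    intro ξ
    have := congrArg (fun a => a.1 ⟨mkJet q ξ, mkJet_mem hq ξ⟩) cross
    simp only [alg_mul, alg_neg, h.value_next, h.value_prev, h.value_prev_prev, h.value_mixed, t0,
      t1, mkJet_one] at this
    linear_combination -this
  have l0 := lam_mul hx
  set α0x := dx C.α (q 1, q 0, q (-1))
  set α1z := dz C.α (q 2, q 1, q 0)
  set l := QChain.lam C.α (q 1, q 0, q (-1)) with hl
  have c00 := cr fun _ => 0
  have c11 := cr fun _ => 1
  have c10 := cr fun n => if n = 0 then 1 else 0
  have c01 := cr fun n => if n = 0 then 0 else 1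
  simp only [if_true, one_ne_zero, if_false, mul_zero, mul_one, zero_add] at c00 c11 c10 c01
  rw [l0] at c11 c10
  have r1 : dz (dz C.α) (q 2, q 1, q 0) = l * α1z := by
    refine mul_left_cancel₀ hx ?_
    linear_combination c11 - c10 - c01 + c00
  refine ⟨r1, ?_, ?_⟩
  · refine mul_left_cancel₀ hx ?_
    linear_combination c10 - c00
  · refine mul_left_cancel₀ hz ?_
    linear_combination c00 - c01 + dx C.γ (q 1, q 0, q (-1)) * r1

/-- Away from the zeros of g = Y_1 θ_0 = -W_1(u_{0,x}) proportionality gives W_2 = λ W_1. Commuting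
with D_x then leaves κ W_1 = 0, where κ is the last coefficient in `pair_commutation`. -/
theorem Chain.Reg.kappa_eq_zero (h : C.Reg D) (he : C.FirstExpansion D) (j : phaseSpace D)
    (hj : (h.Yd 1 (h.θ 0)).1 j ≠ 0) :
    (dtot D (base h.lam 0) + h.θ 0 * base h.lam 0 + 2 * h.Yd 0 (h.θ 1) + h.Yd 0 (h.θ 0)).1 j
      = 0 := by
  have fo : ∀ j : phaseSpace D, _ := fun j =>
    h.first_order he (q := fun i => j.1 (Sum.inl (i, 0))) j.2
  have t0 : ∀ j : phaseSpace D, triple j 0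
      = (j.1 (Sum.inl (1, 0)), j.1 (Sum.inl (0, 0)), j.1 (Sum.inl (-1, 0))) := fun _ => rfl
  have t1 : ∀ j : phaseSpace D, triple j 1
      = (j.1 (Sum.inl (2, 0)), j.1 (Sum.inl (1, 0)), j.1 (Sum.inl (0, 0))) := fun _ => rfl
  have hA : 2 * h.Yd 0 (h.Yd 1 (h.θ 0)) - h.Yd 1 (h.Yd 0 (h.θ 0))
      - base h.lam 0 * h.Yd 1 (h.θ 0) = 0 := by
    refine alg_ext fun j => ?_
    obtain ⟨-, -, f3⟩ := fo j
    have e1 := lam_mul (h.next _ (j.2 0))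
    rw [t0] at e1
    rw [alg_sub, alg_mul, base_apply, h.value_mixed, h.value_next, t0, alg_zero]
    linear_combination f3 + j.1 (Sum.inl (0, 1)) * e1
  have hB : h.Yd 0 (h.Yd 0 (h.θ 1)) - base h.lam 0 * h.Yd 0 (h.θ 1) = 0 := by
    refine alg_ext fun j => ?_
    obtain ⟨f1, f2, -⟩ := fo j
    rw [alg_sub, alg_mul, base_apply, h.value_prev_prev, h.value_prev, t0, t1, alg_zero]
    linear_combination f2 + j.1 (Sum.inl (1, 1)) * f1
  have hV := (h.isVF_Yd 0).bracket (h.isVF_Yd 1)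
  have hW : IsVF (⁅h.Yd 0, ⁅h.Yd 0, h.Yd 1⁆⁆ - base h.lam 0 • ⁅h.Yd 0, h.Yd 1⁆) :=
    ((h.isVF_Yd 0).bracket hV).sub (hV.smul _)
  set g := h.Yd 1 (h.θ 0) with hg
  have hT : g • (⁅h.Yd 0, ⁅h.Yd 0, h.Yd 1⁆⁆ - base h.lam 0 • ⁅h.Yd 0, h.Yd 1⁆) = 0 := by
    have key : ∀ s, (g • (⁅h.Yd 0, ⁅h.Yd 0, h.Yd 1⁆⁆ - base h.lam 0 • ⁅h.Yd 0, h.Yd 1⁆))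
        (crd s) = 0 := by
      intro s
      have := h.first_cross he s (Sum.inl (0, 1))
      rw [h.bracket_crd_zero, h.double_bracket_crd_zero] at this
      rw [Derivation.smul_apply, Derivation.sub_apply, Derivation.smul_apply, smul_eq_mul,
        smul_eq_mul]
      linear_combination -this + hA * ⁅h.Yd 0, h.Yd 1⁆ (crd s)
    rw [hW.smul g]
    refine Derivation.ext fun a => alg_ext fun j => ?_
    simp [key, vf_apply]
  have hT' : ∀ f, g * (⁅h.Yd 0, ⁅h.Yd 0, h.Yd 1⁆⁆ - base h.lam 0 • ⁅h.Yd 0, h.Yd 1⁆) f = 0 :=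
    fun f => DFunLike.congr_fun hT f
  have pc := pair_commutation _ _ _ _ _ (base h.lam 0) (h.dtot_Yd 0) (h.dtot_Yd 1)
    (crd (Sum.inl (0, 1)))
  rw [hA, hB, h.bracket_crd_zero, ← hg] at pc
  -- Division by `g` is avoided: differentiating `g * T(u_{0,x}) = 0`, where T is W_2 - λ W_1, and
  -- multiplying by `g` once more leads to g³ κ = 0.
  have p1 := congrArg (dtot D) (hT' (crd (Sum.inl (0, 1))))
  rw [map_zero, Derivation.leibniz, smul_eq_mul, smul_eq_mul, pc] at p1
  have p2 := hT' (crd (Sum.inl (0, 1)))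
  have p3 := hT' (dtot D (crd (Sum.inl (0, 1))))
  have fin : g * g * g * (dtot D (base h.lam 0) + h.θ 0 * base h.lam 0 + 2 * h.Yd 0 (h.θ 1)
      + h.Yd 0 (h.θ 0)) = 0 := by
    linear_combination g * p1 - (dtot D g) * p2 - g * p3 + g * (2 * h.θ 0 + h.θ 1) * p2
  have := congrArg (fun a => a.1 j) fin
  simp only [alg_mul _ (dtot D (base h.lam 0) + h.θ 0 * base h.lam 0 + 2 * h.Yd 0 (h.θ 1)
      + h.Yd 0 (h.θ 0)), alg_mul g, alg_mul (g * g), alg_zero, mul_eq_zero, hj, false_or] at this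
  exact this

/-- κ is affine in u_{1,x}, u_{0,x}, u_{-1,x} and vanishes wherever the nonconstant affine function
Y_1 θ_0 of u_{0,x} does not; its four coefficients are therefore zero. -/
theorem Chain.Reg.firstSys_of_expansion (h : C.Reg D) (he : C.FirstExpansion D) {q : ℤ → ℂ}
    (hq : IsConfig D q) : FirstSys C.α C.γ (q 1, q 0, q (-1)) (q 2, q 1, q 0) := by
  obtain ⟨r1, r2, r3⟩ := h.first_order he hq
  have hx : dx C.α (q 1, q 0, q (-1)) ≠ 0 := h.next _ (by simpa using hq 0)
  have t0 : ∀ ξ, triple (mkJet q ξ) 0 = (q 1, q 0, q (-1)) := fun ξ => rfl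
  have t1 : ∀ ξ, triple (mkJet q ξ) 1 = (q 2, q 1, q 0) := fun ξ => rfl
  have key : ∀ ξ : ℤ → ℂ, dx C.α (q 1, q 0, q (-1)) * ξ 0 + dx C.γ (q 1, q 0, q (-1)) ≠ 0 →
      ξ 1 * (dx (QChain.lam C.α) (q 1, q 0, q (-1)) + 2 * dz C.α (q 2, q 1, q 0))
      + ξ 0 * (dy (QChain.lam C.α) (q 1, q 0, q (-1))
        + C.α (q 1, q 0, q (-1)) * QChain.lam C.α (q 1, q 0, q (-1)) + dy C.α (q 1, q 0, q (-1))
        + C.α (q 1, q 0, q (-1)) ^ 2)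
      + ξ (-1) * dz (QChain.lam C.α) (q 1, q 0, q (-1))
      + (C.γ (q 1, q 0, q (-1)) * QChain.lam C.α (q 1, q 0, q (-1)) + 2 * dz C.γ (q 2, q 1, q 0)
        + dy C.γ (q 1, q 0, q (-1)) + C.α (q 1, q 0, q (-1)) * C.γ (q 1, q 0, q (-1))) = 0 := by
    intro ξ hξ
    have := h.kappa_eq_zero he ⟨mkJet q ξ, mkJet_mem hq ξ⟩
      (by rw [h.value_next]; exact hξ)
    simp only [dtot_base, Chain.Reg.θ, two_mul, map_add, Derivation.leibniz, h.Yd_base,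
      h.Yd_one] at this
    simp [t0, t1, mkJet_one] at this
    linear_combination this
  set c1 := dx (QChain.lam C.α) (q 1, q 0, q (-1)) + 2 * dz C.α (q 2, q 1, q 0)
  set c2 := dy (QChain.lam C.α) (q 1, q 0, q (-1))
        + C.α (q 1, q 0, q (-1)) * QChain.lam C.α (q 1, q 0, q (-1)) + dy C.α (q 1, q 0, q (-1))
        + C.α (q 1, q 0, q (-1)) ^ 2
  set c3 := dz (QChain.lam C.α) (q 1, q 0, q (-1))
  set c4 := C.γ (q 1, q 0, q (-1)) * QChain.lam C.α (q 1, q 0, q (-1)) + 2 * dz C.γ (q 2, q 1, q 0)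
        + dy C.γ (q 1, q 0, q (-1)) + C.α (q 1, q 0, q (-1)) * C.γ (q 1, q 0, q (-1))
  set a := dx C.α (q 1, q 0, q (-1))
  set b := dx C.γ (q 1, q 0, q (-1))
  -- The value of u_{0,x} is chosen so that Y_1 θ_0 takes the prescribed nonzero value `k`; four
  -- sample points then separate the coefficients.
  have ev : ∀ k x y : ℂ, k ≠ 0 → x * c1 + (k - b) / a * c2 + y * c3 + c4 = 0 := by
    intro k x y hk
    have := key (fun n => if n = 1 then x else if n = 0 then (k - b) / a else y)
      (by simp only [zero_ne_one, if_false, if_true]; field_simp; simpa using hk)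
    simpa using this
  have e1 := ev 1 0 0 one_ne_zero
  have e2 := ev 1 1 0 one_ne_zero
  have e3 := ev 1 0 1 one_ne_zero
  have e4 := ev 2 0 0 two_ne_zero
  have hc1 : c1 = 0 := by linear_combination e2 - e1
  have hc3 : c3 = 0 := by linear_combination e3 - e1
  have hc2 : c2 = 0 := by
    have : c2 / a = 0 := by linear_combination e4 - e1
    simpa [hx] using this
  have hc4 : c4 = 0 := by
    rw [hc2] at e1
    linear_combination e1
  exact ⟨r1, r2, r3, hc1, hc2, hc3, hc4⟩

end QChain

namespace QChain

/-! ### Consequences of the first system -/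

/-- Quadruples `(u_2, u_1, u_0, u_{-1})` of neighbours in a configuration. -/
def Link (D : Set (ℂ × ℂ × ℂ)) : Set (ℂ × ℂ × ℂ × ℂ) :=
  {v | ∃ q, IsConfig D q ∧ (q 2, q 1, q 0, q (-1)) = v}

/-- Triples `(u_1, u_0, u_{-1})` of neighbours in a configuration. -/
def Core (D : Set (ℂ × ℂ × ℂ)) : Set (ℂ × ℂ × ℂ) :=
  {v | ∃ q, IsConfig D q ∧ (q 1, q 0, q (-1)) = v}

variable {D : Set (ℂ × ℂ × ℂ)}

theorem IsConfig.shift {q : ℤ → ℂ} (hq : IsConfig D q) (m : ℤ) :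
    IsConfig D fun n => q (n + m) := by
  intro n
  have := hq (n + m)
  rwa [add_right_comm, add_sub_right_comm] at this

theorem IsConfig.link {q : ℤ → ℂ} (hq : IsConfig D q) (n : ℤ) :
    (q (n + 2), q (n + 1), q n, q (n - 1)) ∈ Link D :=
  ⟨_, hq.shift n, by simp only [add_comm _ n, add_zero]; rfl⟩

theorem IsConfig.core {q : ℤ → ℂ} (hq : IsConfig D q) (n : ℤ) :
    (q (n + 1), q n, q (n - 1)) ∈ Core D :=
  ⟨_, hq.shift n, by simp only [add_comm _ n, add_zero]; rfl⟩

theorem Core.mem {t : ℂ × ℂ × ℂ} (ht : t ∈ Core D) : t ∈ D := by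
  obtain ⟨q, hq, rfl⟩ := ht
  exact hq 0

theorem Link.tail {w : ℂ} {t : ℂ × ℂ × ℂ} (h : (w, t) ∈ Link D) : t ∈ Core D := by
  obtain ⟨q, hq, e⟩ := h
  exact ⟨q, hq, (Prod.mk.inj e).2⟩

theorem Link.head {w x y z : ℂ} (h : (w, x, y, z) ∈ Link D) : (w, x, y) ∈ Core D := by
  obtain ⟨q, hq, e⟩ := h
  simp only [Prod.mk.injEq] at e
  obtain ⟨rfl, rfl, rfl, rfl⟩ := e
  exact hq.core 1

theorem Core.exists_next {t : ℂ × ℂ × ℂ} (ht : t ∈ Core D) : ∃ w, (w, t) ∈ Link D := by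
  obtain ⟨q, hq, rfl⟩ := ht
  exact ⟨q 2, q, hq, rfl⟩

theorem Core.exists_prev {x y z : ℂ} (ht : (x, y, z) ∈ Core D) : ∃ v, (x, y, z, v) ∈ Link D := by
  obtain ⟨q, hq, e⟩ := ht
  simp only [Prod.mk.injEq] at e
  obtain ⟨rfl, rfl, rfl⟩ := e
  exact ⟨q (-2), by simpa using hq.link (-1)⟩

/-- The equations hold only along configurations, and a point of `D` need not belong to one. They
can still be differentiated, since a configuration may be perturbed at four sites with the rest
fixed. -/
theorem isOpen_link (hD : IsOpen D) : IsOpen (Link D) := by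
  rw [isOpen_iff_mem_nhds]
  rintro v₀ ⟨q, hq, rfl⟩
  let Q : ℂ × ℂ × ℂ × ℂ → ℤ → ℂ := fun v n => if n = 2 then v.1 else if n = 1 then v.2.1 else
    if n = 0 then v.2.2.1 else if n = -1 then v.2.2.2 else q n
  have hQc : ∀ n, Continuous fun v => Q v n := by
    intro n
    simp only [Q]
    split_ifs <;> fun_prop
  have hQq : Q (q 2, q 1, q 0, q (-1)) = q := by
    ext n
    simp only [Q]
    split_ifs <;> simp_all
  -- Changing the sites -1, …, 2 affects precisely the triples centred at -2, …, 3.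
  have h1 : ∀ n ∈ Finset.Icc (-2 : ℤ) 3, ∀ᶠ v in 𝓝 (q 2, q 1, q 0, q (-1)),
      (Q v (n + 1), Q v n, Q v (n - 1)) ∈ D := by
    intro n _
    have hc : Continuous fun v => (Q v (n + 1), Q v n, Q v (n - 1)) :=
      (hQc _).prodMk ((hQc _).prodMk (hQc _))
    refine hc.continuousAt.eventually_mem (hD.mem_nhds ?_)
    rw [hQq]
    exact hq n
  filter_upwards [(Finset.eventually_all _).2 h1] with v hv
  refine ⟨Q v, fun n => ?_, by simp [Q]⟩
  by_cases hn : n ∈ Finset.Icc (-2 : ℤ) 3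
  · exact hv n hn
  · have h2 : ∀ m, (m < -1 ∨ 2 < m) → Q v m = q m := by
      intro m hm
      simp only [Q]
      rw [if_neg, if_neg, if_neg, if_neg] <;> omega
    simp only [Finset.mem_Icc, not_and_or, not_le] at hn
    rw [h2 _ (by omega), h2 _ (by omega), h2 _ (by omega)]
    exact hq n

theorem isOpen_core (hD : IsOpen D) : IsOpen (Core D) := by
  rw [isOpen_iff_mem_nhds]
  intro t ht
  obtain ⟨w, hw⟩ := Core.exists_next ht
  have hc : Continuous fun t : ℂ × ℂ × ℂ => (w, t) := by fun_prop
  filter_upwards [hc.continuousAt.eventually_mem ((isOpen_link hD).mem_nhds hw)] with t' h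
  exact Link.tail h

theorem eq_zero_of_eventually {f : ℂ → ℂ} {c z : ℂ} (hf : HasDerivAt f c z)
    (h : ∀ᶠ z' in 𝓝 z, f z' = 0) : c = 0 := by
  have : HasDerivAt f 0 z := (hasDerivAt_const z (0 : ℂ)).congr_of_eventuallyEq h
  exact hf.unique this

/-- The hypothesis that the first system holds along all configurations. -/
def SysOn (C : Chain) (D : Set (ℂ × ℂ × ℂ)) : Prop :=
  ∀ q, IsConfig D q → FirstSys C.α C.γ (q 1, q 0, q (-1)) (q 2, q 1, q 0)

variable {C : Chain}

theorem SysOn.link (hs : SysOn C D) {w x y z : ℂ} (h : (w, x, y, z) ∈ Link D) :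
    FirstSys C.α C.γ (x, y, z) (w, x, y) := by
  obtain ⟨q, hq, e⟩ := h
  simp only [Prod.mk.injEq] at e
  obtain ⟨rfl, rfl, rfl, rfl⟩ := e
  exact hs q hq

theorem SysOn.core (hs : SysOn C D) {t : ℂ × ℂ × ℂ} (h : t ∈ Core D) :
    ∃ t1, FirstSys C.α C.γ t t1 := by
  obtain ⟨w, hw⟩ := Core.exists_next h
  exact ⟨_, hs.link hw⟩

theorem SysOn.core_prev (hs : SysOn C D) {t : ℂ × ℂ × ℂ} (h : t ∈ Core D) :
    ∃ t0, FirstSys C.α C.γ t0 t := by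
  obtain ⟨x, y, z⟩ := t
  obtain ⟨w, hw⟩ := Core.exists_prev h
  exact ⟨_, hs.link hw⟩

theorem eventually_core_fst (hD : IsOpen D) {t : ℂ × ℂ × ℂ} (h : t ∈ Core D) :
    ∀ᶠ z in 𝓝 t.1, (z, t.2.1, t.2.2) ∈ Core D :=
  (tendsto_fst t).eventually ((isOpen_core hD).mem_nhds h)

theorem eventually_core_snd (hD : IsOpen D) {t : ℂ × ℂ × ℂ} (h : t ∈ Core D) :
    ∀ᶠ z in 𝓝 t.2.1, (t.1, z, t.2.2) ∈ Core D :=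
  (tendsto_snd t).eventually ((isOpen_core hD).mem_nhds h)

theorem eventually_core_trd (hD : IsOpen D) {t : ℂ × ℂ × ℂ} (h : t ∈ Core D) :
    ∀ᶠ z in 𝓝 t.2.2, (t.1, t.2.1, z) ∈ Core D :=
  (tendsto_trd t).eventually ((isOpen_core hD).mem_nhds h)

section

variable (hD : IsOpen D) (h : C.Reg D) (hs : SysOn C D)
include hD h hs

/-- In `lam_next` the first argument of the upper triple occurs only through α_z, so the derivative
in it vanishes. -/
theorem alpha_mixed {t : ℂ × ℂ × ℂ} (ht : t ∈ Core D) : dx (dz C.α) t = 0 := by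
  obtain ⟨w, x, y⟩ := t
  obtain ⟨z, hw⟩ := Core.exists_prev ht
  have hc : Continuous fun w' : ℂ => (w', x, y, z) := by fun_prop
  have h1 : HasDerivAt (fun w' => dx (lam C.α) (x, y, z) + 2 * dz C.α (w', x, y))
      (2 * dx (dz C.α) (w, x, y)) w :=
    ((hasDerivAt_dx (h.α _ (Core.mem ht)).dz).const_mul 2).const_add _
  have := eq_zero_of_eventually h1 (by
    filter_upwards [hc.continuousAt.eventually_mem ((isOpen_link hD).mem_nhds hw)] with w' hw'
    exact (hs.link hw').lam_next)
  simpa using this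

/-- Differentiate `lam_self` in z. Since λ_z = 0, what is left is α_z λ + α_yz + 2α α_z = 0; divide
by α_z. -/
theorem lam_add_mu {t : ℂ × ℂ × ℂ} (ht : t ∈ Core D) :
    2 * C.α t + lam C.α t + mu C.α t = 0 := by
  have hA := h.α _ (Core.mem ht)
  have hL := h.lam _ (Core.mem ht)
  have h1 := (((hasDerivAt_dz hL.dy).add ((hasDerivAt_dz hA).mul (hasDerivAt_dz hL))).add
    (hasDerivAt_dz hA.dy)).add ((hasDerivAt_dz hA).pow 2)
  have h2 := eq_zero_of_eventually h1 (by
    filter_upwards [eventually_core_trd hD ht] with z hz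
    obtain ⟨_, s⟩ := hs.core hz
    exact s.lam_self)
  have h3 : dz (dy (lam C.α)) t = 0 := by
    rw [← dy_dz_comm hL]
    refine eq_zero_of_eventually (hasDerivAt_dy hL.dz) ?_
    filter_upwards [eventually_core_snd hD ht] with z hz
    obtain ⟨_, s⟩ := hs.core hz
    exact s.lam_prev
  have h4 : dz (lam C.α) t = 0 := (hs.core ht).choose_spec.lam_prev
  have h5 := mu_mul (h.prev _ (Core.mem ht))
  rw [dy_dz_comm hA] at h5
  rw [h3, h4, h5] at h2
  refine mul_left_cancel₀ (h.prev _ (Core.mem ht)) ?_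
  simp only [Nat.cast_ofNat, Nat.add_one_sub_one, pow_one] at h2
  linear_combination h2

/-- Differentiating `lam_self` in x and `lam_next` in y gives (λ + α)(α_x - α_z) = 0, with α_z at
the next triple. Only α in the first factor depends on z, so a further z-derivative leaves α_z(x, y,
z) times the second factor, and α_z is nonzero. -/
theorem alpha_link {w x y z : ℂ} (hl : (w, x, y, z) ∈ Link D) :
    dx C.α (x, y, z) = dz C.α (w, x, y) := by
  have key : ∀ z', (w, x, y, z') ∈ Link D →
      (lam C.α (x, y, z') + C.α (x, y, z')) * (dx C.α (x, y, z') - dz C.α (w, x, y)) = 0 := by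
    intro z hl
    have ht := Link.tail hl
    have hA := h.α _ (Core.mem ht)
    have hL := h.lam _ (Core.mem ht)
    have hA1 := h.α _ (Core.mem (Link.head hl))
    have s := hs.link hl
    have h1 := (((hasDerivAt_dx hL.dy).add ((hasDerivAt_dx hA).mul (hasDerivAt_dx hL))).add
      (hasDerivAt_dx hA.dy)).add ((hasDerivAt_dx hA).pow 2)
    have h2 := eq_zero_of_eventually h1 (by
      filter_upwards [eventually_core_fst hD ht] with z hz
      obtain ⟨_, s⟩ := hs.core hz
      exact s.lam_self)
    have h3 : dy (dx (lam C.α)) (x, y, z) + 2 * dz (dz C.α) (w, x, y) = 0 := by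
      have hc : Continuous fun y' : ℂ => (w, x, y', z) := by fun_prop
      refine eq_zero_of_eventually (z := y)
        ((hasDerivAt_dy hL.dx).add ((hasDerivAt_dz hA1.dz).const_mul 2)) ?_
      filter_upwards [hc.continuousAt.eventually_mem ((isOpen_link hD).mem_nhds hl)] with y' hy'
      exact (hs.link hy').lam_next
    rw [dx_dy_comm hL, dx_dy_comm hA, lam_mul (h.next _ (Core.mem ht))] at h2
    simp only [Nat.cast_ofNat, Nat.add_one_sub_one, pow_one] at h2
    have e1 := s.alpha_prev
    have e2 := s.lam_next
    linear_combination h2 / 2 - h3 / 2 + e1 - C.α (x, y, z) / 2 * e2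
  have ht := Link.tail hl
  have hA := h.α _ (Core.mem ht)
  have hL := h.lam _ (Core.mem ht)
  have hc : Continuous fun z' : ℂ => (w, x, y, z') := by fun_prop
  have h1 := ((hasDerivAt_dz hL).add (hasDerivAt_dz hA)).mul
    ((hasDerivAt_dz hA.dx).sub_const (dz C.α (w, x, y)))
  have h2 := eq_zero_of_eventually h1 (by
    filter_upwards [hc.continuousAt.eventually_mem ((isOpen_link hD).mem_nhds hl)] with z' hz'
    exact key z' hz')
  have h3 : dz (dx C.α) (x, y, z) = 0 := by
    rw [← dx_dz_comm hA]; exact alpha_mixed hD h hs ht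
  have h4 : dz (lam C.α) (x, y, z) = 0 := (hs.link hl).lam_prev
  rw [h3, h4] at h2
  have h5 : dz C.α (x, y, z) * (dx C.α (x, y, z) - dz C.α (w, x, y)) = 0 := by
    linear_combination h2
  rcases mul_eq_zero.1 h5 with h6 | h6
  · exact absurd h6 (h.prev _ (Core.mem ht))
  · exact sub_eq_zero.1 h6

theorem lam_dx {t : ℂ × ℂ × ℂ} (ht : t ∈ Core D) : dx (lam C.α) t = -2 * dx C.α t := by
  obtain ⟨w, hw⟩ := Core.exists_next ht
  obtain ⟨x, y, z⟩ := t
  rw [alpha_link hD h hs hw]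
  linear_combination (hs.link hw).lam_next

/-- `2 λ_y - λ² = 2 μ_y - μ²`. -/
theorem lam_mu_riccati {t : ℂ × ℂ × ℂ} (ht : t ∈ Core D) :
    2 * dy (lam C.α) t - lam C.α t ^ 2 = 2 * dy (mu C.α) t - mu C.α t ^ 2 := by
  have hA := h.α _ (Core.mem ht)
  have hL := h.lam _ (Core.mem ht)
  have hM := h.mu _ (Core.mem ht)
  have h1 := ((((hasDerivAt_dy hA).const_mul 2).add (hasDerivAt_dy hL)).add (hasDerivAt_dy hM))
  have h2 := eq_zero_of_eventually h1 (by
    filter_upwards [eventually_core_snd hD ht] with z hz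
    exact lam_add_mu hD h hs hz)
  have h3 := lam_add_mu hD h hs ht
  have h4 := (hs.core ht).choose_spec.lam_self
  have h5 : mu C.α t = -2 * C.α t - lam C.α t := by linear_combination h3
  have h6 : dy (mu C.α) t = -2 * dy C.α t - dy (lam C.α) t := by linear_combination h2
  rw [h5, h6]
  linear_combination 4 * h4

end

end QChain

namespace QChain

/-! ### Liouville's equation and the normalizing transformation -/

theorem const_on_ball {f : ℂ → ℂ} {y₀ : ℂ} {r : ℝ}
    (hf : ∀ y ∈ Metric.ball y₀ r, HasDerivAt f 0 y) {y : ℂ} (hy : y ∈ Metric.ball y₀ r) :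
    f y = f y₀ := by
  have hr : 0 < r := lt_of_le_of_lt dist_nonneg hy
  exact Metric.isOpen_ball.is_const_of_deriv_eq_zero (convex_ball y₀ r).isPreconnected
    (fun z hz => (hf z hz).differentiableAt.differentiableWithinAt)
    (fun z hz => (hf z hz).deriv) hy (Metric.mem_ball_self hr)

/-- Solutions `λ = φ'/φ` of the Riccati equation associated with `P''/P'`. -/
theorem riccati {y₀ : ℂ} {r : ℝ} {φ P P' l e l' e' : ℂ → ℂ}
    (hφ : ∀ y ∈ Metric.ball y₀ r, HasDerivAt φ (l y * φ y) y)
    (hφ0 : ∀ y ∈ Metric.ball y₀ r, φ y ≠ 0)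
    (hP : ∀ y ∈ Metric.ball y₀ r, HasDerivAt P (P' y) y)
    (hP' : ∀ y ∈ Metric.ball y₀ r, HasDerivAt P' (e y * P' y) y)
    (hP0 : ∀ y ∈ Metric.ball y₀ r, P' y ≠ 0)
    (hl : ∀ y ∈ Metric.ball y₀ r, HasDerivAt l (l' y) y)
    (he : ∀ y ∈ Metric.ball y₀ r, HasDerivAt e (e' y) y)
    (hle : ∀ y ∈ Metric.ball y₀ r, 2 * l' y - l y ^ 2 = 2 * e' y - e y ^ 2)
    {y : ℂ} (hy : y ∈ Metric.ball y₀ r) :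
    φ y * (2 * P' y₀ - (l y₀ - e y₀) * (P y - P y₀)) ^ 2 = 4 * φ y₀ * P' y₀ * P' y := by
  have hy0 : y₀ ∈ Metric.ball y₀ r := Metric.mem_ball_self (lt_of_le_of_lt dist_nonneg hy)
  set c := l y₀ - e y₀ with hc
  -- The Riccati equation says that l is the logarithmic derivative of a fractional linear function
  -- of P with the right value at y₀; Q is the denominator of that function.
  set Q : ℂ → ℂ := fun y => 2 * P' y₀ - c * (P y - P y₀) with hQ
  have hQd : ∀ y ∈ Metric.ball y₀ r, HasDerivAt Q (-(c * P' y)) y := fun y hy =>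
    (((hP y hy).sub_const _).const_mul c).const_sub _
  set d : ℂ → ℂ := fun y => l y * Q y - e y * Q y - 2 * c * P' y with hd
  have hdd : ∀ y ∈ Metric.ball y₀ r, HasDerivAt d ((l y + e y) / 2 * d y) y := by
    intro y hy
    have h1 := (((hl y hy).mul (hQd y hy)).sub ((he y hy).mul (hQd y hy))).sub
      ((hP' y hy).const_mul (2 * c))
    refine h1.congr_deriv ?_
    simp only [hd]
    linear_combination (Q y / 2) * hle y hy
  have hd0 : ∀ y ∈ Metric.ball y₀ r, d y = 0 := by
    intro y hy
    -- Uniqueness for the linear equation d' = (l + e)/2 · d without exponentials: φ P' has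
    -- logarithmic derivative l + e, so this quotient is constant, and d(y₀) = 0.
    have h1 : ∀ y ∈ Metric.ball y₀ r, HasDerivAt (fun y => d y ^ 2 / (φ y * P' y)) 0 y := by
      intro y hy
      refine (((hdd y hy).pow 2).div ((hφ y hy).mul (hP' y hy))
        (mul_ne_zero (hφ0 y hy) (hP0 y hy))).congr_deriv ?_
      rw [div_eq_zero_iff]
      left
      simp only [Pi.mul_apply, Pi.pow_apply]
      push_cast
      ring
    have h2 := const_on_ball h1 hy
    have h3 : d y₀ = 0 := by simp only [hd, hQ, hc]; ring
    simp only [h3] at h2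
    rw [zero_pow two_ne_zero, zero_div, div_eq_zero_iff] at h2
    rcases h2 with h2 | h2
    · simpa using h2
    · exact absurd h2 (mul_ne_zero (hφ0 y hy) (hP0 y hy))
  -- The derivative is proportional to `d`.
  have h1 : ∀ y ∈ Metric.ball y₀ r, HasDerivAt (fun y => φ y * Q y ^ 2 / P' y) 0 y := by
    intro y hy
    refine (((hφ y hy).mul ((hQd y hy).pow 2)).div (hP' y hy) (hP0 y hy)).congr_deriv ?_
    rw [div_eq_zero_iff]
    left
    have := hd0 y hy
    simp only [hd] at this
    simp only [Pi.mul_apply, Pi.pow_apply]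
    push_cast
    linear_combination (φ y * Q y * P' y) * this
  have h2 := const_on_ball h1 hy
  have h3 : Q y₀ = 2 * P' y₀ := by simp only [hQ]; ring
  simp only [h3] at h2
  have h4 := hP0 y hy
  have h5 := hP0 y₀ hy0
  field_simp at h2
  linear_combination h2

/-- A recursion by right multiplication can be solved over `ℤ`. -/
theorem exists_mul_recursion {G : Type*} [Group G] (K : ℤ → G) :
    ∃ A : ℤ → G, ∀ n, A (n + 1) = A n * K n := by
  let f : ℕ → G := fun m => Nat.rec 1 (fun k g => g * K k) m
  -- `b m` is the value at -m; the step from -k down to -(k+1) inverts the recursion at -(k+1).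
  let b : ℕ → G := fun m => Nat.rec 1 (fun k g => g * (K (-(k + 1 : ℕ)))⁻¹) m
  refine ⟨fun n => if 0 ≤ n then f n.toNat else b (-n).toNat, fun n => ?_⟩
  by_cases hn : 0 ≤ n
  · obtain ⟨m, rfl⟩ := Int.eq_ofNat_of_zero_le hn
    dsimp only
    rw [if_pos (by omega), if_pos hn]
    have : ((m : ℤ) + 1).toNat = m + 1 := by omega
    rw [this, Int.toNat_natCast]
  · obtain ⟨m, rfl⟩ : ∃ m : ℕ, n = -(m + 1 : ℕ) := ⟨(-n - 1).toNat, by omega⟩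
    dsimp only
    rw [if_neg hn]
    have e1 : (-(-((m + 1 : ℕ) : ℤ))).toNat = m + 1 := by omega
    have e2 : b (m + 1) * K (-(m + 1 : ℕ)) = b m := by
      change b m * (K (-(m + 1 : ℕ)))⁻¹ * K (-(m + 1 : ℕ)) = b m
      simp
    rw [e1, e2]
    rcases Nat.eq_zero_or_pos m with rfl | hm
    · rw [if_pos (by simp)]; rfl
    · rw [if_neg (by push_cast; omega)]
      congr 1
      push_cast; omega

/-- A pole can be chosen away from countably many points of the projective line. -/
theorem exists_avoiding {X Y : ℤ → ℂ} (h : ∀ n, X n ≠ 0 ∨ Y n ≠ 0) :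
    ∃ s : ℂ, ∀ n, s * X n + Y n ≠ 0 := by
  by_contra! hc
  have h1 : (Set.univ : Set ℂ) = ⋃ n, {s | s * X n + Y n = 0} := by
    ext s
    simpa using hc s
  have h2 : (⋃ n, {s : ℂ | s * X n + Y n = 0}).Countable := by
    refine Set.countable_iUnion fun n => Set.Subsingleton.countable ?_
    intro s hs s' hs'
    simp only [Set.mem_ofPred_eq] at hs hs'
    by_cases hX : X n = 0
    · simp only [hX, mul_zero, zero_add] at hs
      exact ((h n).elim (fun h => h hX) fun h => h hs).elim
    · refine mul_right_cancel₀ hX ?_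
      linear_combination hs - hs'
  rw [← h1] at h2
  exact not_countable_complex h2

/-- Local fractional linear changes of the `P_n` that turn the given kernel into the normal form
`p_{n+1}' p_n' / (p_{n+1} - p_n)²`. -/
theorem exists_normalization {P : ℤ → ℂ → ℂ} {q c : ℤ → ℂ} {φ : ℤ → ℂ × ℂ × ℂ → ℂ}
    (hP : ∀ n, AnalyticAt ℂ (P n) (q n)) (hP0 : ∀ n, deriv (P n) (q n) ≠ 0)
    (hφ : ∀ n, ∀ᶠ t in 𝓝 ((q (n + 1), q n, q (n - 1)) : ℂ × ℂ × ℂ),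
      φ n t * (2 * deriv (P n) (q n)
        - (P (n + 1) t.1 - c n) * (P n t.2.1 - P n (q n))) ^ 2
        = -2 * deriv (P n) (q n) * deriv (P (n + 1)) t.1 * deriv (P n) t.2.1) :
    ∃ p : ℤ → ℂ → ℂ, ∀ n, AnalyticAt ℂ (p n) (q n) ∧ deriv (p n) (q n) ≠ 0 ∧
      p (n + 1) (q (n + 1)) ≠ p n (q n) ∧
      ∀ᶠ t in 𝓝 ((q (n + 1), q n, q (n - 1)) : ℂ × ℂ × ℂ),
        φ n t = deriv (p (n + 1)) t.1 * deriv (p n) t.2.1 / (p (n + 1) t.1 - p n t.2.1) ^ 2 := by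
  set a : ℤ → ℂ := fun n => P n (q n) with ha
  set b : ℤ → ℂ := fun n => deriv (P n) (q n) with hb
  have hb0 : ∀ n, b n ≠ 0 := hP0
  -- The matrix sends P_{n+1} to the value of P_n at which the kernel has its pole, v = a + 2b/(u -
  -- c); its determinant is -2b. With A_{n+1} = A_n K_n the pole becomes p_{n+1} = p_n for p_n =
  -- A_n(P_n), at all sites simultaneously.
  obtain ⟨A, hA⟩ := exists_mul_recursion fun n =>
    Matrix.GeneralLinearGroup.mkOfDetNeZero !![a n, 2 * b n - a n * c n; 1, -c n]
      (by rw [Matrix.det_fin_two_of]; ring_nf; simpa using hb0 n)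
  have hA' : ∀ n, (A (n + 1)).1 = (A n).1 * !![a n, 2 * b n - a n * c n; 1, -c n] := by
    intro n; rw [hA]; rfl
  have hdet : ∀ n, (A n).1 0 0 * (A n).1 1 1 - (A n).1 0 1 * (A n).1 1 0 ≠ 0 := by
    intro n
    have := (A n).isUnit.map Matrix.detMonoidHom
    rw [Matrix.coe_detMonoidHom, isUnit_iff_ne_zero, Matrix.det_fin_two] at this
    exact this
  have r00 : ∀ n, (A (n + 1)).1 0 0 = (A n).1 0 0 * a n + (A n).1 0 1 := by
    intro n; rw [hA', Matrix.mul_apply, Fin.sum_univ_two]; simp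
  have r01 : ∀ n, (A (n + 1)).1 0 1
      = (A n).1 0 0 * (2 * b n - a n * c n) - (A n).1 0 1 * c n := by
    intro n; rw [hA', Matrix.mul_apply, Fin.sum_univ_two]; simp; ring
  have r10 : ∀ n, (A (n + 1)).1 1 0 = (A n).1 1 0 * a n + (A n).1 1 1 := by
    intro n; rw [hA', Matrix.mul_apply, Fin.sum_univ_two]; simp
  have r11 : ∀ n, (A (n + 1)).1 1 1
      = (A n).1 1 0 * (2 * b n - a n * c n) - (A n).1 1 1 * c n := by
    intro n; rw [hA', Matrix.mul_apply, Fin.sum_univ_two]; simp; ring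
  -- A common fractional linear change of all p_n leaves the kernel unchanged. The one with rows (1,
  -- 0) and (s, 1) is used to keep every p_n(q_n) finite; each n excludes at most one `s`.
  obtain ⟨s, hs⟩ := exists_avoiding (X := fun n => (A n).1 0 0 * a n + (A n).1 0 1)
    (Y := fun n => (A n).1 1 0 * a n + (A n).1 1 1) (by
      intro n
      by_contra! h
      refine hdet n ?_
      linear_combination (-(A n).1 1 0) * h.1 + (A n).1 0 0 * h.2)
  set B : ℤ → ℂ := fun n => (A n).1 0 0 with hB
  set E : ℤ → ℂ := fun n => (A n).1 0 1 with hE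
  set F : ℤ → ℂ := fun n => s * (A n).1 0 0 + (A n).1 1 0 with hF
  set G : ℤ → ℂ := fun n => s * (A n).1 0 1 + (A n).1 1 1 with hG
  have hd0 : ∀ n, B n * G n - E n * F n ≠ 0 := by
    intro n
    convert hdet n using 1
    simp only [hB, hE, hF, hG]; ring
  have rB : ∀ n, B (n + 1) = B n * a n + E n := r00
  have rE : ∀ n, E (n + 1) = B n * (2 * b n - a n * c n) - E n * c n := r01
  have rF : ∀ n, F (n + 1) = F n * a n + G n := by
    intro n; simp only [hF, hG, r00, r10]; ring
  have rG : ∀ n, G (n + 1) = F n * (2 * b n - a n * c n) - G n * c n := by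
    intro n; simp only [hF, hG, r01, r11]; ring
  have den0 : ∀ n, F n * P n (q n) + G n ≠ 0 := by
    intro n
    convert hs n using 1
    simp only [hF, hG, ha]; ring
  clear_value B E F G a b
  have den : ∀ n, ∀ᶠ u in 𝓝 (q n), F n * P n u + G n ≠ 0 := fun n =>
    (((hP n).continuousAt.const_mul (F n)).add_const (G n)).eventually_ne (den0 n)
  have hder : ∀ n, ∀ᶠ u in 𝓝 (q n),
      deriv (fun u => (B n * P n u + E n) / (F n * P n u + G n)) u
        = (B n * G n - E n * F n) * deriv (P n) u / (F n * P n u + G n) ^ 2 := by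
    intro n
    filter_upwards [den n, (hP n).eventually_analyticAt] with u h1 h2
    have h3 := h2.differentiableAt.hasDerivAt
    have h4 := ((h3.const_mul (B n)).add_const (E n)).div ((h3.const_mul (F n)).add_const (G n)) h1
    rw [show (fun u => (B n * P n u + E n) / (F n * P n u + G n)) =
      (fun u => B n * P n u + E n) / fun u => F n * P n u + G n from rfl, h4.deriv]
    congr 1
    ring
  have key : ∀ n, ∀ u v φ D1 D0 : ℂ, F (n + 1) * u + G (n + 1) ≠ 0 → F n * v + G n ≠ 0 →
      D1 ≠ 0 → D0 ≠ 0 →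
      φ * (2 * b n - (u - c n) * (v - a n)) ^ 2 = -2 * b n * D1 * D0 →
      (B (n + 1) * u + E (n + 1)) / (F (n + 1) * u + G (n + 1)) ≠ (B n * v + E n) / (F n * v + G n)
      ∧ φ = ((B (n + 1) * G (n + 1) - E (n + 1) * F (n + 1)) * D1 / (F (n + 1) * u + G (n + 1)) ^ 2)
        * ((B n * G n - E n * F n) * D0 / (F n * v + G n) ^ 2)
        / ((B (n + 1) * u + E (n + 1)) / (F (n + 1) * u + G (n + 1))
          - (B n * v + E n) / (F n * v + G n)) ^ 2 := by
    intro n u v φ D1 D0 h1 h0 hD1 hD0 h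
    have hQ : 2 * b n - (u - c n) * (v - a n) ≠ 0 := by
      intro hQ
      rw [hQ] at h
      have : b n * D1 * D0 = 0 := by linear_combination h / 2
      exact mul_ne_zero (mul_ne_zero (hb0 n) hD1) hD0 this
    -- The recursion for the matrices factors the cross-multiplied difference into the determinant
    -- and the denominator of the given kernel.
    have hdiff : (B (n + 1) * u + E (n + 1)) / (F (n + 1) * u + G (n + 1))
          - (B n * v + E n) / (F n * v + G n)
        = (B n * G n - E n * F n) * (2 * b n - (u - c n) * (v - a n))
          / ((F (n + 1) * u + G (n + 1)) * (F n * v + G n)) := by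
      rw [div_sub_div _ _ h1 h0]
      congr 1
      rw [rB, rE, rF, rG]
      ring
    have hdd : B (n + 1) * G (n + 1) - E (n + 1) * F (n + 1)
        = -2 * b n * (B n * G n - E n * F n) := by
      rw [rB, rE, rF, rG]; ring
    have hd := hd0 n
    refine ⟨?_, ?_⟩
    · rw [← sub_ne_zero, hdiff]
      exact div_ne_zero (mul_ne_zero hd hQ) (mul_ne_zero h1 h0)
    · rw [hdiff, hdd]
      set d := B n * G n - E n * F n
      set Q := 2 * b n - (u - c n) * (v - a n)
      set N1 := F (n + 1) * u + G (n + 1)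
      set N0 := F n * v + G n
      have : φ = -2 * b n * D1 * D0 / Q ^ 2 := by
        rw [eq_div_iff (pow_ne_zero 2 hQ), h]
      rw [this]
      field_simp
  have hPd : ∀ n, ∀ᶠ u in 𝓝 (q n), deriv (P n) u ≠ 0 := fun n =>
    (hP n).deriv.continuousAt.eventually_ne (hP0 n)
  refine ⟨fun n u => (B n * P n u + E n) / (F n * P n u + G n), fun n => ⟨?_, ?_, ?_, ?_⟩⟩
  · exact (((analyticAt_const.mul (hP n)).add analyticAt_const)).div
      ((analyticAt_const.mul (hP n)).add analyticAt_const) (den0 n)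
  · rw [(hder n).self_of_nhds]
    exact div_ne_zero (mul_ne_zero (hd0 n) (hP0 n)) (pow_ne_zero 2 (den0 n))
  · exact (key n _ _ _ _ _ (den0 _) (den0 _) (hP0 _) (hP0 _) (by
      have := (hφ n).self_of_nhds
      simpa [ha, hb] using this)).1
  · have c1 : Filter.Tendsto (fun t : ℂ × ℂ × ℂ => t.1) (𝓝 (q (n + 1), q n, q (n - 1)))
        (𝓝 (q (n + 1))) := continuous_fst.continuousAt
    have c2 : Filter.Tendsto (fun t : ℂ × ℂ × ℂ => t.2.1) (𝓝 (q (n + 1), q n, q (n - 1)))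
        (𝓝 (q n)) := (continuous_fst.comp continuous_snd).continuousAt
    filter_upwards [hφ n, c1.eventually (den (n + 1)), c2.eventually (den n),
      c1.eventually (hder (n + 1)), c2.eventually (hder n), c1.eventually (hPd (n + 1)),
      c2.eventually (hPd n)] with t h1 h2 h3 h4 h5 h6 h7
    rw [h4, h5]
    exact (key n _ _ _ _ _ h2 h3 h6 h7 (by simpa [ha, hb] using h1)).2

end QChain

/-! ### Frames of local coordinates and the standard form of α -/

namespace QChain

/-- Local coordinates `p_n` near `q_n` with distinct neighbouring values. -/
structure Frame (q : ℤ → ℂ) (p : ℤ → ℂ → ℂ) : Prop where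
  analytic : ∀ n, AnalyticAt ℂ (p n) (q n)
  deriv_ne : ∀ n, deriv (p n) (q n) ≠ 0
  ne : ∀ n, p (n + 1) (q (n + 1)) ≠ p n (q n)

/-- The conditions of a frame at the three entries of a triple. -/
structure FrameAt (p : ℤ → ℂ → ℂ) (n : ℤ) (t : ℂ × ℂ × ℂ) : Prop where
  an_next : AnalyticAt ℂ (p (n + 1)) t.1
  an_self : AnalyticAt ℂ (p n) t.2.1
  an_prev : AnalyticAt ℂ (p (n - 1)) t.2.2
  ne_next : deriv (p (n + 1)) t.1 ≠ 0
  ne_self : deriv (p n) t.2.1 ≠ 0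
  ne_prev : deriv (p (n - 1)) t.2.2 ≠ 0
  sub_next : p (n + 1) t.1 - p n t.2.1 ≠ 0
  sub_prev : p n t.2.1 - p (n - 1) t.2.2 ≠ 0

variable {q : ℤ → ℂ} {p : ℤ → ℂ → ℂ}

theorem tendsto_proj1 (x y z : ℂ) :
    Filter.Tendsto (fun t : ℂ × ℂ × ℂ => t.1) (𝓝 (x, y, z)) (𝓝 x) :=
  continuous_fst.continuousAt

theorem tendsto_proj2 (x y z : ℂ) :
    Filter.Tendsto (fun t : ℂ × ℂ × ℂ => t.2.1) (𝓝 (x, y, z)) (𝓝 y) :=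
  (continuous_fst.comp continuous_snd).continuousAt

theorem tendsto_proj3 (x y z : ℂ) :
    Filter.Tendsto (fun t : ℂ × ℂ × ℂ => t.2.2) (𝓝 (x, y, z)) (𝓝 z) :=
  (continuous_snd.comp continuous_snd).continuousAt

theorem Frame.eventually (h : Frame q p) (n : ℤ) :
    ∀ᶠ t in 𝓝 ((q (n + 1), q n, q (n - 1)) : ℂ × ℂ × ℂ), FrameAt p n t := by
  have c1 := tendsto_proj1 (q (n + 1)) (q n) (q (n - 1))
  have c2 := tendsto_proj2 (q (n + 1)) (q n) (q (n - 1))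
  have c3 := tendsto_proj3 (q (n + 1)) (q n) (q (n - 1))
  have d := fun n => (h.analytic n).deriv.continuousAt.eventually_ne (h.deriv_ne n)
  have e1 := h.ne n
  have e2 := h.ne (n - 1)
  rw [sub_add_cancel] at e2
  have s1 := ((h.analytic (n + 1)).continuousAt.tendsto.comp c1).sub
    ((h.analytic n).continuousAt.tendsto.comp c2)
  have s2 := ((h.analytic n).continuousAt.tendsto.comp c2).sub
    ((h.analytic (n - 1)).continuousAt.tendsto.comp c3)
  filter_upwards [c1.eventually (h.analytic (n + 1)).eventually_analyticAt,
    c2.eventually (h.analytic n).eventually_analyticAt,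
    c3.eventually (h.analytic (n - 1)).eventually_analyticAt,
    c1.eventually (d (n + 1)), c2.eventually (d n), c3.eventually (d (n - 1)),
    s1.eventually_ne (sub_ne_zero.2 e1), s2.eventually_ne (sub_ne_zero.2 e2)]
    with t h1 h2 h3 h4 h5 h6 h7 h8
  exact ⟨h1, h2, h3, h4, h5, h6, h7, h8⟩

/-- `p_{n+1}'(x) p_n'(y) / (p_{n+1}(x) - p_n(y))²`. -/
noncomputable def ker (p : ℤ → ℂ → ℂ) (n : ℤ) (x y : ℂ) : ℂ :=
  deriv (p (n + 1)) x * deriv (p n) y / (p (n + 1) x - p n y) ^ 2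

/-- The standard `α` in the coordinates `p_n`. -/
noncomputable def alphaOf (p : ℤ → ℂ → ℂ) (n : ℤ) (t : ℂ × ℂ × ℂ) : ℂ :=
  deriv (p n) t.2.1 / (p n t.2.1 - p (n - 1) t.2.2)
    - deriv (p n) t.2.1 / (p (n + 1) t.1 - p n t.2.1)
    - deriv (deriv (p n)) t.2.1 / deriv (p n) t.2.1

/-- `λ` in the coordinates `p_n`. -/
noncomputable def lamOf (p : ℤ → ℂ → ℂ) (n : ℤ) (t : ℂ × ℂ × ℂ) : ℂ :=
  deriv (deriv (p n)) t.2.1 / deriv (p n) t.2.1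
    + 2 * deriv (p n) t.2.1 / (p (n + 1) t.1 - p n t.2.1)

/-- `μ` in the coordinates `p_n`. -/
noncomputable def muOf (p : ℤ → ℂ → ℂ) (n : ℤ) (t : ℂ × ℂ × ℂ) : ℂ :=
  deriv (deriv (p n)) t.2.1 / deriv (p n) t.2.1
    - 2 * deriv (p n) t.2.1 / (p n t.2.1 - p (n - 1) t.2.2)

/-- The logarithmic derivative of the kernel in its middle variable. The square in the denominator
lets one formula serve both neighbours, giving λ for α_x and μ for α_z. -/
theorem hasDerivAt_kernel {f : ℂ → ℂ} {y : ℂ} (hf : AnalyticAt ℂ f y) (h0 : deriv f y ≠ 0)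
    (K c : ℂ) (h : c - f y ≠ 0) :
    HasDerivAt (fun y => K * deriv f y / (c - f y) ^ 2)
      (K * deriv f y / (c - f y) ^ 2
        * (deriv (deriv f) y / deriv f y + 2 * deriv f y / (c - f y))) y := by
  have h1 := hf.differentiableAt.hasDerivAt
  have h2 := hf.deriv.differentiableAt.hasDerivAt
  refine ((h2.const_mul K).div ((h1.const_sub c).pow 2) (pow_ne_zero 2 h)).congr_deriv ?_
  simp only [Pi.pow_apply]
  field_simp
  push_cast
  ring

variable {α : ℂ × ℂ × ℂ → ℂ} {n : ℤ} {t₀ : ℂ × ℂ × ℂ}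

/-- Both kernels are present in the first derivatives of `α`. -/
def KernelAt (α : ℂ × ℂ × ℂ → ℂ) (p : ℤ → ℂ → ℂ) (n : ℤ) (t : ℂ × ℂ × ℂ) : Prop :=
  dx α t = ker p n t.1 t.2.1 ∧ dz α t = ker p (n - 1) t.2.1 t.2.2

theorem lam_eq_of_kernel (hk : ∀ᶠ t in 𝓝 t₀, KernelAt α p n t)
    (hF : FrameAt p n t₀) : lam α t₀ = lamOf p n t₀ := by
  have h1 : dy (dx α) t₀ = dx α t₀ * lamOf p n t₀ := by
    rw [dy_congr (hk.mono fun t h => h.1), hk.self_of_nhds.1]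
    exact (hasDerivAt_kernel hF.an_self hF.ne_self (deriv (p (n + 1)) t₀.1) (p (n + 1) t₀.1)
      hF.sub_next).deriv
  have h2 : dx α t₀ ≠ 0 := by
    rw [hk.self_of_nhds.1]
    exact div_ne_zero (mul_ne_zero hF.ne_next hF.ne_self) (pow_ne_zero 2 hF.sub_next)
  rw [lam, h1, mul_div_cancel_left₀ _ h2]

theorem mu_eq_of_kernel (hk : ∀ᶠ t in 𝓝 t₀, KernelAt α p n t)
    (hF : FrameAt p n t₀) : mu α t₀ = muOf p n t₀ := by
  have h0 : p (n - 1) t₀.2.2 - p n t₀.2.1 ≠ 0 := by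
    rw [← neg_sub, neg_ne_zero]; exact hF.sub_prev
  have hker : ∀ y z, ker p (n - 1) y z
      = deriv (p (n - 1)) z * deriv (p n) y / (p (n - 1) z - p n y) ^ 2 := by
    intro y z
    rw [ker, sub_add_cancel, mul_comm, ← neg_sub (p (n - 1) z), neg_sq]
  have h1 : dy (dz α) t₀ = dz α t₀ * muOf p n t₀ := by
    rw [dy_congr (hk.mono fun t h => h.2), hk.self_of_nhds.2]
    have h2 := (hasDerivAt_kernel hF.an_self hF.ne_self (deriv (p (n - 1)) t₀.2.2)
      (p (n - 1) t₀.2.2) h0).deriv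
    simp only [dy, hker]
    rw [h2, muOf, ← neg_sub (p (n - 1) t₀.2.2), div_neg, sub_neg_eq_add]
  have h2 : dz α t₀ ≠ 0 := by
    rw [hk.self_of_nhds.2, hker]
    exact div_ne_zero (mul_ne_zero hF.ne_prev hF.ne_self) (pow_ne_zero 2 h0)
  rw [mu, h1, mul_div_cancel_left₀ _ h2]

variable {D : Set (ℂ × ℂ × ℂ)} {C : Chain}

theorem exists_radius {X : Type*} [PseudoMetricSpace X] {s : Set X} {x : X} (h : s ∈ 𝓝 x) :
    ∃ r > 0, Metric.ball x r ⊆ s := Metric.mem_nhds_iff.1 h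

/-- The kernel `α_x` expressed through the values of `λ` at a fixed point. -/
theorem kernel_identity (hD : IsOpen D) (h : C.Reg D) (hs : SysOn C D) {w₀ x₀ y₀ z₀ v₀ : ℂ}
    (h1 : (w₀, x₀, y₀, z₀) ∈ Link D) (h2 : (x₀, y₀, z₀, v₀) ∈ Link D) :
    ∀ᶠ t in 𝓝 ((x₀, y₀, z₀) : ℂ × ℂ × ℂ),
      dx C.α t * (2 * (-2 * dx C.α (y₀, z₀, v₀))
        - (lam C.α (t.1, y₀, z₀) - dx (dx C.α) (y₀, z₀, v₀) / dx C.α (y₀, z₀, v₀))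
          * (lam C.α (t.2.1, z₀, v₀) - lam C.α (y₀, z₀, v₀))) ^ 2
        = -2 * (-2 * dx C.α (y₀, z₀, v₀)) * (-2 * dx C.α (t.1, y₀, z₀))
          * (-2 * dx C.α (t.2.1, z₀, v₀)) := by
  have c1 : Continuous fun t : ℂ × ℂ × ℂ => (w₀, t.1, t.2.1, t.2.2) := by fun_prop
  have c1' : Continuous fun t : ℂ × ℂ × ℂ => (w₀, t.1, t.2.1, z₀) := by fun_prop
  have c2 : Continuous fun t : ℂ × ℂ × ℂ => (t.1, t.2.1, z₀, v₀) := by fun_prop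
  have hN := ((c1.continuousAt (x := (x₀, y₀, z₀))).eventually_mem
    ((isOpen_link hD).mem_nhds h1)).and
    (((c1'.continuousAt (x := (x₀, y₀, z₀))).eventually_mem ((isOpen_link hD).mem_nhds h1)).and
    ((c2.continuousAt (x := (x₀, y₀, z₀))).eventually_mem ((isOpen_link hD).mem_nhds h2)))
  obtain ⟨r, hr, hball⟩ := exists_radius hN
  filter_upwards [Metric.ball_mem_nhds (x₀, y₀, z₀) hr] with t ht
  obtain ⟨x, y, z⟩ := t
  simp only [Metric.mem_ball, Prod.dist_eq, max_lt_iff] at ht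
  obtain ⟨hx, hy, hz⟩ := ht
  have hm : ∀ y' ∈ Metric.ball y₀ r, (w₀, x, y', z₀) ∈ Link D ∧ (x, y', z₀, v₀) ∈ Link D := by
    intro y' hy'
    have := hball (show (x, y', z₀) ∈ Metric.ball (x₀, y₀, z₀) r by
      simp only [Metric.mem_ball, Prod.dist_eq, max_lt_iff]
      exact ⟨hx, hy', by simpa using hr⟩)
    exact this.2
  have hA : ∀ y' ∈ Metric.ball y₀ r, AnalyticAt ℂ C.α (x, y', z₀) := fun y' hy' =>
    h.α _ (Core.mem (Link.tail (hm y' hy').1))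
  have hA' : ∀ y' ∈ Metric.ball y₀ r, (y', z₀, v₀) ∈ Core D := fun y' hy' =>
    Link.tail (hm y' hy').2
  have hC : ∀ y' ∈ Metric.ball y₀ r, (x, y', z₀) ∈ Core D := fun y' hy' =>
    Link.tail (hm y' hy').1
  have hlink : ∀ y' ∈ Metric.ball y₀ r, dx C.α (y', z₀, v₀) = dz C.α (x, y', z₀) := fun y' hy' =>
    alpha_link hD h hs (hm y' hy').2
  have hy0 : y₀ ∈ Metric.ball y₀ r := Metric.mem_ball_self hr
  -- Here P = λ(·, z₀, v₀) has derivative -2α_x(·, z₀, v₀), which by `alpha_link` is -2α_z(x, ·,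
  -- z₀); hence P''/P' = μ, and `lam_mu_riccati` is the required hypothesis.
  have key := riccati (y₀ := y₀) (r := r) (φ := fun y => dx C.α (x, y, z₀))
    (P := fun y => lam C.α (y, z₀, v₀)) (P' := fun y => -2 * dz C.α (x, y, z₀))
    (l := fun y => lam C.α (x, y, z₀)) (e := fun y => mu C.α (x, y, z₀))
    (l' := fun y => dy (lam C.α) (x, y, z₀)) (e' := fun y => dy (mu C.α) (x, y, z₀))
    (fun y hy => by
      have := hasDerivAt_dy (hA y hy).dx
      rwa [lam_mul (h.next _ (Core.mem (hC y hy)))] at this)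
    (fun y hy => h.next _ (Core.mem (hC y hy)))
    (fun y hy => by
      have := hasDerivAt_dx (h.lam _ (Core.mem (hA' y hy)))
      rwa [lam_dx hD h hs (hA' y hy), hlink y hy] at this)
    (fun y hy => by
      have := (hasDerivAt_dy (hA y hy).dz).const_mul (-2)
      rw [mu_mul (h.prev _ (Core.mem (hC y hy)))] at this
      exact this.congr_deriv (by ring))
    (fun y hy => mul_ne_zero (by norm_num) (h.prev _ (Core.mem (hC y hy))))
    (fun y hy => hasDerivAt_dy (h.lam _ (Core.mem (hC y hy))))
    (fun y hy => hasDerivAt_dy (h.mu _ (Core.mem (hC y hy))))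
    (fun y hy => lam_mu_riccati hD h hs (hC y hy))
    (y := y) hy
  -- Both equal α_z at the upper triple (w₀, x, y), which contains neither z nor z₀.
  have e1 : dx C.α (x, y, z) = dx C.α (x, y, z₀) := by
    have := hball (show (x, y, z) ∈ Metric.ball (x₀, y₀, z₀) r by
      simp only [Metric.mem_ball, Prod.dist_eq, max_lt_iff]
      exact ⟨hx, hy, hz⟩)
    rw [alpha_link hD h hs this.1, alpha_link hD h hs (hm y hy).1]
  have e2 : mu C.α (x, y₀, z₀) = dx (dx C.α) (y₀, z₀, v₀) / dx C.α (y₀, z₀, v₀) := by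
    rw [mu, hlink y₀ hy0]
    congr 1
    refine Filter.EventuallyEq.deriv_eq ?_
    filter_upwards [Metric.ball_mem_nhds y₀ hr] with y' hy'
    exact (hlink y' hy').symm
  rw [hlink y hy, hlink y₀ hy0, e1, ← hlink y₀ hy0, ← e2, hlink y₀ hy0, key]
  ring

/-- The first system forces the standard form of `α` in suitable coordinates. -/
theorem SysOn.exists_frame (hD : IsOpen D) (h : C.Reg D) (hs : SysOn C D) {q : ℤ → ℂ}
    (hq : IsConfig D q) : ∃ p, Frame q p ∧
      ∀ n, ∀ᶠ t in 𝓝 ((q (n + 1), q n, q (n - 1)) : ℂ × ℂ × ℂ), C.α t = alphaOf p n t := by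
  -- λ with its last two arguments frozen at q is a local coordinate, since λ_x = -2α_x does not
  -- vanish.
  set P : ℤ → ℂ → ℂ := fun n u => lam C.α (u, q (n - 1), q (n - 2)) with hPdef
  have hcore : ∀ n, (q n, q (n - 1), q (n - 2)) ∈ Core D := by
    intro n
    have := hq.core (n - 1)
    rwa [sub_add_cancel, show n - 1 - 1 = n - 2 by ring] at this
  have hlink : ∀ n, (q (n + 1), q n, q (n - 1), q (n - 2)) ∈ Link D := by
    intro n
    have := hq.link (n - 1)
    rwa [sub_add_cancel, show n - 1 - 1 = n - 2 by ring, show n - 1 + 2 = n + 1 by ring] at this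
  have hPd : ∀ n, ∀ᶠ u in 𝓝 (q n), deriv (P n) u = -2 * dx C.α (u, q (n - 1), q (n - 2)) := by
    intro n
    filter_upwards [eventually_core_fst hD (hcore n)] with u hu
    rw [← lam_dx hD h hs hu]
    rfl
  have hPan : ∀ n, AnalyticAt ℂ (P n) (q n) := by
    intro n
    have := h.lam _ (Core.mem (hcore n))
    exact this.comp (f := fun u : ℂ => (u, q (n - 1), q (n - 2)))
      (analyticAt_id.prod (analyticAt_const.prod analyticAt_const))
  obtain ⟨p, hp⟩ := exists_normalization (P := P) (q := q) (φ := fun _ => dx C.α)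
    (c := fun n => dx (dx C.α) (q n, q (n - 1), q (n - 2)) / dx C.α (q n, q (n - 1), q (n - 2)))
    hPan (fun n => by
      rw [(hPd n).self_of_nhds]
      exact mul_ne_zero (by norm_num) (h.next _ (Core.mem (hcore n)))) (fun n => by
      have e1 := tendsto_proj1 (q (n + 1)) (q n) (q (n - 1))
      have e2 := tendsto_proj2 (q (n + 1)) (q n) (q (n - 1))
      filter_upwards [kernel_identity hD h hs (hq.link n) (hlink n),
        e1.eventually (hPd (n + 1)), e2.eventually (hPd n)] with t h1 h2 h3
      rw [h2, h3, (hPd n).self_of_nhds]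
      simp only [hPdef, add_sub_cancel_right, show n + 1 - 2 = n - 1 by ring]
      exact h1)
  have hF : Frame q p := ⟨fun n => (hp n).1, fun n => (hp n).2.1, fun n => (hp n).2.2.1⟩
  have hk : ∀ n, ∀ᶠ t in 𝓝 ((q (n + 1), q n, q (n - 1)) : ℂ × ℂ × ℂ), KernelAt C.α p n t := by
    intro n
    have c2 : Continuous fun t : ℂ × ℂ × ℂ => (t.1, t.2.1, t.2.2, q (n - 2)) := by fun_prop
    have c3 : Continuous fun t : ℂ × ℂ × ℂ => (t.2.1, t.2.2, q (n - 2)) := by fun_prop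
    have e := (hp (n - 1)).2.2.2
    rw [sub_add_cancel, show n - 1 - 1 = n - 2 by ring] at e
    filter_upwards [(hp n).2.2.2,
      (c3.tendsto (q (n + 1), q n, q (n - 1))).eventually e,
      (c2.continuousAt (x := (q (n + 1), q n, q (n - 1)))).eventually_mem
        ((isOpen_link hD).mem_nhds (hlink n))] with t h1 h2 h3
    refine ⟨h1, ?_⟩
    rw [← alpha_link hD h hs h3, h2, ker, sub_add_cancel]
  refine ⟨p, hF, fun n => ?_⟩
  filter_upwards [eventually_eventually_nhds.2 (hk n), hF.eventually n,
    (isOpen_core hD).mem_nhds (hq.core n)] with t h1 h2 h3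
  -- The kernels determine λ and μ, and λ + μ = -2α recovers α itself with no function of
  -- integration left over.
  have e1 := lam_add_mu hD h hs h3
  rw [lam_eq_of_kernel h1 h2, mu_eq_of_kernel h1 h2] at e1
  rw [alphaOf]
  rw [lamOf, muOf] at e1
  linear_combination e1 / 2

end QChain

namespace QChain

/-! ### The coefficient `γ` in normalizing coordinates -/

theorem hasDerivAt_quad (k : ℂ × ℂ × ℂ) (z : ℂ) : HasDerivAt (quad k) (k.1 * z + k.2.1) z := by
  have h := ((((hasDerivAt_id z).pow 2).const_mul (k.1 / 2)).add
    ((hasDerivAt_id z).const_mul k.2.1)).add_const k.2.2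
  refine h.congr_deriv ?_
  simp only [id]
  push_cast
  ring

theorem deriv_quad (k : ℂ × ℂ × ℂ) (z : ℂ) : deriv (quad k) z = k.1 * z + k.2.1 :=
  (hasDerivAt_quad k z).deriv

theorem analyticAt_quad (k : ℂ × ℂ × ℂ) (z : ℂ) : AnalyticAt ℂ (quad k) z := by
  unfold quad
  fun_prop

theorem quad_injective {k k' : ℂ × ℂ × ℂ} {z : ℂ} (h : ∀ᶠ v in 𝓝 z, quad k v = quad k' v) :
    k = k' := by
  have h1 : ∀ᶠ v in 𝓝 z, deriv (quad k) v = deriv (quad k') v :=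
    (eventually_eventually_nhds.2 h).mono fun v hv => Filter.EventuallyEq.deriv_eq hv
  have h2 : deriv (deriv (quad k)) z = deriv (deriv (quad k')) z :=
    Filter.EventuallyEq.deriv_eq h1
  have e : ∀ k : ℂ × ℂ × ℂ, deriv (deriv (quad k)) z = k.1 := by
    intro k
    rw [funext (deriv_quad k)]
    simp
  rw [e, e] at h2
  have h3 := h1.self_of_nhds
  have h4 := h.self_of_nhds
  rw [deriv_quad, deriv_quad, h2] at h3
  have h5 := add_left_cancel h3
  unfold quad at h4
  rw [h2, h5] at h4
  exact Prod.ext h2 (Prod.ext h5 (add_left_cancel h4))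

/-- `f''/f' + 2f'/(c - f)`. -/
noncomputable def liou (f : ℂ → ℂ) (c y : ℂ) : ℂ :=
  deriv (deriv f) y / deriv f y + 2 * deriv f y / (c - f y)

/-- The polynomial vector field `quad k` in the coordinate `f`. -/
noncomputable def rhoOf (k : ℂ × ℂ × ℂ) (f : ℂ → ℂ) (y : ℂ) : ℂ := quad k (f y) / deriv f y

theorem analyticAt_rhoOf (k : ℂ × ℂ × ℂ) {f : ℂ → ℂ} {y : ℂ} (hf : AnalyticAt ℂ f y)
    (h0 : deriv f y ≠ 0) : AnalyticAt ℂ (rhoOf k f) y :=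
  ((analyticAt_quad k _).comp hf).div hf.deriv h0

theorem hasDerivAt_rhoOf (k : ℂ × ℂ × ℂ) {f : ℂ → ℂ} {y : ℂ} (hf : AnalyticAt ℂ f y)
    (h0 : deriv f y ≠ 0) :
    HasDerivAt (rhoOf k f) (deriv (quad k) (f y)
      - rhoOf k f y * (deriv (deriv f) y / deriv f y)) y := by
  have h1 := hf.differentiableAt.hasDerivAt
  have h2 := hf.deriv.differentiableAt.hasDerivAt
  refine (((hasDerivAt_quad k (f y)).comp y h1).div h2 h0).congr_deriv ?_
  rw [deriv_quad, rhoOf]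
  simp only [Function.comp]
  field_simp

theorem hasDerivAt_liou {f : ℂ → ℂ} {y : ℂ} (hf : AnalyticAt ℂ f y) (h0 : deriv f y ≠ 0)
    (c : ℂ) (h : c - f y ≠ 0) :
    HasDerivAt (liou f c) (deriv (fun y => deriv (deriv f) y / deriv f y) y
      + 2 * deriv (deriv f) y / (c - f y) + 2 * deriv f y ^ 2 / (c - f y) ^ 2) y := by
  have h1 := hf.differentiableAt.hasDerivAt
  have h2 := hf.deriv.differentiableAt.hasDerivAt
  have h3 := (hf.deriv.deriv.div hf.deriv h0).differentiableAt.hasDerivAt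
  refine (h3.add ((h2.const_mul 2).div (h1.const_sub c) h)).congr_deriv ?_
  rw [add_assoc]
  congr 1
  field_simp
  ring

/-- The third-order equation for `rhoOf`, in terms of `liou`. -/
theorem rhoOf_ode (k : ℂ × ℂ × ℂ) {f : ℂ → ℂ} {y : ℂ} (hf : AnalyticAt ℂ f y)
    (h0 : deriv f y ≠ 0) (c : ℂ) (h : c - f y ≠ 0) :
    deriv (deriv (rhoOf k f)) y + deriv (rhoOf k f) y * liou f c y
      + rhoOf k f y * deriv (liou f c) y = 2 * quad k c * deriv f y / (c - f y) ^ 2 := by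
  -- The terms with f'' cancel. The derivative of the right-hand side collapses by the Taylor
  -- formula of the quadratic polynomial, expanded at f(y) and evaluated at c.
  have hev : ∀ᶠ y in 𝓝 y, deriv (rhoOf k f) y + rhoOf k f y * liou f c y
      = deriv (quad k) (f y) + 2 * quad k (f y) / (c - f y) := by
    filter_upwards [hf.eventually_analyticAt, hf.deriv.continuousAt.eventually_ne h0,
      (continuousAt_const.sub hf.continuousAt).eventually_ne h] with y hf h0 h
    simp only [Pi.sub_apply] at h
    rw [(hasDerivAt_rhoOf k hf h0).deriv, liou, rhoOf]
    field_simp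
    ring
  have hρ := analyticAt_rhoOf k hf h0
  have h1 := hf.differentiableAt.hasDerivAt
  have e1 := hρ.deriv.differentiableAt.hasDerivAt.add (hρ.differentiableAt.hasDerivAt.mul
    (hasDerivAt_liou hf h0 c h).differentiableAt.hasDerivAt)
  have hq : HasDerivAt (fun z => deriv (quad k) z) k.1 (f y) := by
    rw [funext (deriv_quad k)]
    simpa using ((hasDerivAt_id (f y)).const_mul k.1).add_const k.2.1
  have e2 := (hq.comp y h1).add ((((hasDerivAt_quad k (f y)).comp y h1).const_mul 2).div
    (h1.const_sub c) h)
  have e3 := (e2.congr_of_eventuallyEq hev).unique e1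
  rw [add_assoc, ← e3]
  simp only [Function.comp, quad]
  field_simp
  ring

/-- The standard `γ` in the coordinates `p_n`. -/
noncomputable def gammaOf (k : ℂ × ℂ × ℂ) (p : ℤ → ℂ → ℂ) (n : ℤ) (t : ℂ × ℂ × ℂ) : ℂ :=
  deriv (quad k) (p n t.2.1)
    - quad k (p n t.2.1) * stdAlpha (p (n + 1) t.1, p n t.2.1, p (n - 1) t.2.2)

variable {p : ℤ → ℂ → ℂ} {n : ℤ} {t : ℂ × ℂ × ℂ}

/-- The form ρ' - ρα is invariant under point transformations when ρ transforms as a vector field: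
the term p''/p' from ρ' cancels the one in α. -/
theorem FrameAt.gammaOf_eq (hF : FrameAt p n t) (k : ℂ × ℂ × ℂ) :
    gammaOf k p n t = deriv (rhoOf k (p n)) t.2.1 - rhoOf k (p n) t.2.1 * alphaOf p n t := by
  have h1 := hF.ne_self
  have h2 := hF.sub_next
  have h3 := hF.sub_prev
  rw [(hasDerivAt_rhoOf k hF.an_self hF.ne_self).deriv, gammaOf, rhoOf, alphaOf, stdAlpha]
  field_simp
  ring

theorem FrameAt.prev_sub (hF : FrameAt p n t) : p (n - 1) t.2.2 - p n t.2.1 ≠ 0 := by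
  rw [← neg_sub, neg_ne_zero]; exact hF.sub_prev

theorem muOf_eq (p : ℤ → ℂ → ℂ) (n : ℤ) (t : ℂ × ℂ × ℂ) :
    muOf p n t = liou (p n) (p (n - 1) t.2.2) t.2.1 := by
  rw [muOf, liou, ← neg_sub (p (n - 1) t.2.2), div_neg, sub_neg_eq_add]

theorem FrameAt.kernelAt {α : ℂ × ℂ × ℂ → ℂ} (hF : FrameAt p n t)
    (h : ∀ᶠ t in 𝓝 t, α t = alphaOf p n t) : KernelAt α p n t := by
  have h2 := hF.sub_next
  have h3 := hF.sub_prev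
  constructor
  · rw [dx_congr h]
    have e := hF.an_next.differentiableAt.hasDerivAt
    have := (((hasDerivAt_const t.1 (deriv (p n) t.2.1)).div (e.sub_const (p n t.2.1)) h2).const_sub
      (deriv (p n) t.2.1 / (p n t.2.1 - p (n - 1) t.2.2))).sub_const
      (deriv (deriv (p n)) t.2.1 / deriv (p n) t.2.1)
    refine this.deriv.trans ?_
    rw [ker]
    ring
  · rw [dz_congr h]
    have e := hF.an_prev.differentiableAt.hasDerivAt
    have := (((hasDerivAt_const t.2.2 (deriv (p n) t.2.1)).div (e.const_sub (p n t.2.1)) h3).sub_const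
      (deriv (p n) t.2.1 / (p (n + 1) t.1 - p n t.2.1))).sub_const
      (deriv (deriv (p n)) t.2.1 / deriv (p n) t.2.1)
    refine this.deriv.trans ?_
    rw [ker, sub_add_cancel]
    ring

end QChain

/-! ### The ratio ρ = -γ_z/α_z and the form γ = ρ_y - ρα -/

namespace QChain

variable {D : Set (ℂ × ℂ × ℂ)} {C : Chain}

/-- `-γ_z / α_z`. -/
noncomputable def Chain.ratio (C : Chain) (t : ℂ × ℂ × ℂ) : ℂ := -(dz C.γ t / dz C.α t)

theorem Chain.Reg.ratio (h : C.Reg D) : AnalyticOnNhd ℂ C.ratio D :=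
  fun t ht => (((h.γ t ht).dz).div (h.α t ht).dz (h.prev t ht)).neg

theorem Chain.Reg.gamma_dz (h : C.Reg D) {t : ℂ × ℂ × ℂ} (ht : t ∈ D) :
    dz C.γ t = -(C.ratio t * dz C.α t) := by
  have := h.prev t ht
  unfold Chain.ratio
  change dz C.α t ≠ 0 at this
  field_simp

/-- In z, both α_z and γ_z have logarithmic derivative λ of the preceding triple, so their quotient
is constant; `alpha_prev` and `gamma_prev` are stated without division. -/
theorem SysOn.ratio_dz (h : C.Reg D) (hs : SysOn C D) {t : ℂ × ℂ × ℂ} (ht : t ∈ Core D) :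
    dz C.ratio t = 0 := by
  obtain ⟨t0, s⟩ := hs.core_prev ht
  have hm := Core.mem ht
  have h0 : dz C.α t ≠ 0 := h.prev t hm
  have h1 := ((hasDerivAt_dz (h.γ t hm).dz).div (hasDerivAt_dz (h.α t hm).dz) h0).neg
  refine h1.deriv.trans ?_
  rw [s.alpha_prev, s.gamma_prev]
  field_simp
  ring

theorem SysOn.eventually_core_nhds (hD : IsOpen D) {t : ℂ × ℂ × ℂ} (ht : t ∈ Core D) :
    ∀ᶠ t in 𝓝 t, t ∈ Core D := (isOpen_core hD).mem_nhds ht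

theorem SysOn.gamma_dx_dz (hD : IsOpen D) (h : C.Reg D) (hs : SysOn C D) {t : ℂ × ℂ × ℂ}
    (ht : t ∈ Core D) : dz (dx C.γ) t = -(dx C.ratio t * dz C.α t) := by
  have hm := Core.mem ht
  rw [← dx_dz_comm (h.γ t hm)]
  have e : dz C.γ =ᶠ[𝓝 t] fun t => -(C.ratio t * dz C.α t) := by
    filter_upwards [hD.mem_nhds hm] with t ht using h.gamma_dz ht
  rw [dx_congr e]
  refine ((hasDerivAt_dx (h.ratio t hm)).mul (hasDerivAt_dx (h.α t hm).dz)).neg.deriv.trans ?_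
  rw [alpha_mixed hD h hs ht]
  ring

/-- A first expression of `γ_x`. -/
theorem SysOn.gamma_dx_aux (hD : IsOpen D) (h : C.Reg D) (hs : SysOn C D) {t : ℂ × ℂ × ℂ}
    (ht : t ∈ Core D) : dx C.γ t = -(C.ratio t * dx C.α t) - dy (dx C.ratio) t
      + dx C.ratio t * (3 * C.α t + 2 * lam C.α t) := by
  have hm := Core.mem ht
  have hA := h.α t hm
  have hG := h.γ t hm
  have h1 := ((hasDerivAt_dz hG.dx.dy).add ((hasDerivAt_dz hG).mul (hasDerivAt_dz hA.dx))).sub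
    ((hasDerivAt_dz hA).mul (hasDerivAt_dz hG.dx))
  -- The z-derivative of `gamma_next`; γ_xz = -ρ_x α_z then makes γ_x the only unknown, and division
  -- by α_z isolates it.
  have h2 := h1.sub ((hasDerivAt_dz (h.lam t hm)).mul (hasDerivAt_dz hG.dx))
  have h3 := eq_zero_of_eventually h2 (by
    filter_upwards [eventually_core_trd hD ht] with z hz
    obtain ⟨_, s⟩ := hs.core hz
    exact sub_eq_zero.2 s.gamma_next)
  have e : dz (dx C.γ) =ᶠ[𝓝 t] fun t => -(dx C.ratio t * dz C.α t) := by
    filter_upwards [SysOn.eventually_core_nhds hD ht] with t ht using hs.gamma_dx_dz hD h ht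
  have h4 : dz (dy (dx C.γ)) t = -(dy (dx C.ratio) t * dz C.α t + dx C.ratio t * dy (dz C.α) t) := by
    rw [← dy_dz_comm hG.dx, dy_congr e]
    exact ((hasDerivAt_dy (h.ratio t hm).dx).mul (hasDerivAt_dy hA.dz)).neg.deriv
  have h5 : dz (dx C.α) t = 0 := by
    rw [← dx_dz_comm hA]; exact alpha_mixed hD h hs ht
  have h6 : dz (lam C.α) t = 0 := (hs.core ht).choose_spec.lam_prev
  have h0 : dz C.α t ≠ 0 := h.prev t hm
  rw [h4, h5, h6, mu_mul h0, e.self_of_nhds, h.gamma_dz hm] at h3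
  have h7 := lam_add_mu hD h hs ht
  refine mul_left_cancel₀ h0 ?_
  linear_combination -h3 - dx C.ratio t * dz C.α t * h7

/-- A z-derivative of `SysOn.gamma_dx_aux` gives γ_xz = 3ρ_x α_z, while `SysOn.gamma_dx_dz` gives
-ρ_x α_z. Hence 4ρ_x α_z = 0. -/
theorem SysOn.ratio_dx (hD : IsOpen D) (h : C.Reg D) (hs : SysOn C D) {t : ℂ × ℂ × ℂ}
    (ht : t ∈ Core D) : dx C.ratio t = 0 := by
  have hm := Core.mem ht
  have hA := h.α t hm
  have hR := h.ratio t hm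
  have h1 := (hasDerivAt_dz (h.γ t hm).dx).sub ((((hasDerivAt_dz hR).mul (hasDerivAt_dz hA.dx)).neg.sub
    (hasDerivAt_dz hR.dx.dy)).add ((hasDerivAt_dz hR.dx).mul
      (((hasDerivAt_dz hA).const_mul 3).add ((hasDerivAt_dz (h.lam t hm)).const_mul 2))))
  have h3 := eq_zero_of_eventually h1 (by
    filter_upwards [eventually_core_trd hD ht] with z hz
    exact sub_eq_zero.2 (hs.gamma_dx_aux hD h hz))
  have e : dz C.ratio =ᶠ[𝓝 t] fun _ => 0 := by
    filter_upwards [SysOn.eventually_core_nhds hD ht] with t ht using hs.ratio_dz h ht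
  have e' : dz (dx C.ratio) =ᶠ[𝓝 t] fun _ => 0 := by
    filter_upwards [SysOn.eventually_core_nhds hD ht] with t ht
    have e : dz C.ratio =ᶠ[𝓝 t] fun _ => 0 := by
      filter_upwards [SysOn.eventually_core_nhds hD ht] with t ht using hs.ratio_dz h ht
    rw [← dx_dz_comm (h.ratio t (Core.mem ht)), dx_congr e]
    exact deriv_const _ _
  have h4 : dz (dy (dx C.ratio)) t = 0 := by
    rw [← dy_dz_comm hR.dx, dy_congr e']
    exact deriv_const _ _
  have h5 : dz (dx C.α) t = 0 := by
    rw [← dx_dz_comm hA]; exact alpha_mixed hD h hs ht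
  have h6 : dz (lam C.α) t = 0 := (hs.core ht).choose_spec.lam_prev
  rw [h4, h5, h6, e.self_of_nhds, e'.self_of_nhds, hs.gamma_dx_dz hD h ht] at h3
  have h0 : dz C.α t ≠ 0 := h.prev t hm
  refine (mul_eq_zero.1 (?_ : dx C.ratio t * dz C.α t = 0)).resolve_right h0
  linear_combination -h3 / 4

theorem SysOn.gamma_dx (hD : IsOpen D) (h : C.Reg D) (hs : SysOn C D) {t : ℂ × ℂ × ℂ}
    (ht : t ∈ Core D) : dx C.γ t = -(C.ratio t * dx C.α t) := by
  have e : dx C.ratio =ᶠ[𝓝 t] fun _ => 0 := by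
    filter_upwards [SysOn.eventually_core_nhds hD ht] with t ht using hs.ratio_dx hD h ht
  rw [hs.gamma_dx_aux hD h ht, dy_congr e, e.self_of_nhds]
  simp [dy]

/-- With γ_x = -ρα_x substituted, `gamma_next` becomes α_x times this identity. -/
theorem SysOn.gamma_eq (hD : IsOpen D) (h : C.Reg D) (hs : SysOn C D) {t : ℂ × ℂ × ℂ}
    (ht : t ∈ Core D) : C.γ t = dy C.ratio t - C.ratio t * C.α t := by
  have hm := Core.mem ht
  have hA := h.α t hm
  have e : dx C.γ =ᶠ[𝓝 t] fun t => -(C.ratio t * dx C.α t) := by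
    filter_upwards [SysOn.eventually_core_nhds hD ht] with t ht using hs.gamma_dx hD h ht
  have h4 : dy (dx C.γ) t = -(dy C.ratio t * dx C.α t + C.ratio t * dy (dx C.α) t) := by
    rw [dy_congr e]
    exact ((hasDerivAt_dy (h.ratio t hm)).mul (hasDerivAt_dy hA.dx)).neg.deriv
  have h0 : dx C.α t ≠ 0 := h.next t hm
  have h1 := (hs.core ht).choose_spec.gamma_next
  rw [h4, e.self_of_nhds, lam_mul h0] at h1
  refine mul_left_cancel₀ h0 ?_
  linear_combination h1

/-- This is `gamma_self` with γ eliminated, the terms in α being absorbed by `lam_self`. It is the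
only relation between ρ at neighbouring sites. -/
theorem SysOn.ratio_ode (hD : IsOpen D) (h : C.Reg D) (hs : SysOn C D) {w x y z : ℂ}
    (hl : (w, x, y, z) ∈ Link D) :
    dy (dy C.ratio) (x, y, z) + dy C.ratio (x, y, z) * lam C.α (x, y, z)
      + C.ratio (x, y, z) * dy (lam C.α) (x, y, z)
      = 2 * C.ratio (w, x, y) * dx C.α (x, y, z) := by
  have ht := Link.tail hl
  have hm := Core.mem ht
  have hA := h.α _ hm
  have hR := h.ratio _ hm
  have s := hs.link hl
  have e : C.γ =ᶠ[𝓝 (x, y, z)] fun t => dy C.ratio t - C.ratio t * C.α t := by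
    filter_upwards [SysOn.eventually_core_nhds hD ht] with t ht using hs.gamma_eq hD h ht
  have h4 : dy C.γ (x, y, z) = dy (dy C.ratio) (x, y, z)
      - (dy C.ratio (x, y, z) * C.α (x, y, z) + C.ratio (x, y, z) * dy C.α (x, y, z)) := by
    rw [dy_congr e]
    exact ((hasDerivAt_dy hR.dy).sub ((hasDerivAt_dy hR).mul (hasDerivAt_dy hA))).deriv
  have h1 := s.gamma_self
  have h2 := s.lam_self
  rw [h4, e.self_of_nhds, h.gamma_dz (Core.mem (Link.head hl)), ← alpha_link hD h hs hl] at h1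
  linear_combination h1 + C.ratio (x, y, z) * h2

theorem SysOn.eventually_ratio (hD : IsOpen D) (h : C.Reg D) (hs : SysOn C D) {x₀ y₀ z₀ : ℂ}
    (ht : (x₀, y₀, z₀) ∈ Core D) :
    ∀ᶠ t in 𝓝 ((x₀, y₀, z₀) : ℂ × ℂ × ℂ), C.ratio t = C.ratio (x₀, t.2.1, z₀) := by
  obtain ⟨r, hr, hball⟩ := exists_radius ((isOpen_core hD).mem_nhds ht)
  filter_upwards [Metric.ball_mem_nhds (x₀, y₀, z₀) hr] with t ht
  obtain ⟨x, y, z⟩ := t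
  simp only [Metric.mem_ball, Prod.dist_eq, max_lt_iff] at ht
  obtain ⟨hx, hy, hz⟩ := ht
  have hm : ∀ x ∈ Metric.ball x₀ r, ∀ z ∈ Metric.ball z₀ r, (x, y, z) ∈ Core D := by
    intro x hx z hz
    refine hball ?_
    simp only [Metric.mem_ball, Prod.dist_eq, max_lt_iff]
    exact ⟨hx, hy, hz⟩
  have hz0 := Metric.mem_ball_self (x := z₀) hr
  have h1 := const_on_ball (f := fun z => C.ratio (x, y, z)) (fun z hz => by
    have := hasDerivAt_dz (h.ratio _ (Core.mem (hm x hx z hz)))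
    rwa [hs.ratio_dz h (hm x hx z hz)] at this) hz
  have h2 := const_on_ball (f := fun x => C.ratio (x, y, z₀)) (fun x hx => by
    have := hasDerivAt_dx (h.ratio _ (Core.mem (hm x hx z₀ hz0)))
    rwa [hs.ratio_dx hD h (hm x hx z₀ hz0)] at this) hx
  exact h1.trans h2

/-! ### One quadratic polynomial for all sites -/

variable {q : ℤ → ℂ} {p : ℤ → ℂ → ℂ}

/-- The ratio along a configuration, as a function of the middle variable. -/
noncomputable def Chain.ratioAt (C : Chain) (q : ℤ → ℂ) (n : ℤ) (y : ℂ) : ℂ :=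
  C.ratio (q (n + 1), y, q (n - 1))

/-- The relation between consecutive ratios. -/
theorem SysOn.ratioAt_next (hD : IsOpen D) (h : C.Reg D) (hs : SysOn C D) (hq : IsConfig D q)
    (hF : Frame q p)
    (hα : ∀ n, ∀ᶠ t in 𝓝 ((q (n + 1), q n, q (n - 1)) : ℂ × ℂ × ℂ), C.α t = alphaOf p n t)
    (n : ℤ) : ∀ᶠ x in 𝓝 (q (n + 1)), p (n + 1) x - p n (q n) ≠ 0 ∧
      deriv (deriv (C.ratioAt q n)) (q n)
        + deriv (C.ratioAt q n) (q n) * liou (p n) (p (n + 1) x) (q n)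
        + C.ratioAt q n (q n) * deriv (liou (p n) (p (n + 1) x)) (q n)
        = 2 * C.ratioAt q (n + 1) x * (deriv (p (n + 1)) x * deriv (p n) (q n)
          / (p (n + 1) x - p n (q n)) ^ 2) := by
  have cx : Filter.Tendsto (fun x : ℂ => (x, q n, q (n - 1))) (𝓝 (q (n + 1)))
      (𝓝 (q (n + 1), q n, q (n - 1))) := tendsto_fst (q (n + 1), q n, q (n - 1))
  have c4 : Continuous fun x : ℂ => (q (n + 2), x, q n, q (n - 1)) := by fun_prop
  have hr := eventually_eventually_nhds.2 (hs.eventually_ratio hD h (hq.core n))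
  have hE := eventually_eventually_nhds.2 ((hF.eventually n).and (eventually_eventually_nhds.2 (hα n)))
  filter_upwards [cx.eventually hr, cx.eventually hE,
    c4.continuousAt.eventually_mem ((isOpen_link hD).mem_nhds (hq.link n))] with x h1 h2 h3
  have hFx := h2.self_of_nhds.1
  have hk : ∀ᶠ t in 𝓝 ((x, q n, q (n - 1)) : ℂ × ℂ × ℂ), KernelAt C.α p n t :=
    h2.mono fun t ht => ht.1.kernelAt ht.2
  have hk' := eventually_eventually_nhds.2 hk
  have e1 : dy C.ratio =ᶠ[𝓝 ((x, q n, q (n - 1)) : ℂ × ℂ × ℂ)]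
      fun t => deriv (C.ratioAt q n) t.2.1 := by
    filter_upwards [eventually_eventually_nhds.2 h1] with t ht
    exact dy_congr ht
  have e2 : lam C.α =ᶠ[𝓝 ((x, q n, q (n - 1)) : ℂ × ℂ × ℂ)] lamOf p n := by
    filter_upwards [hk', h2] with t h1 h2 using lam_eq_of_kernel h1 h2.1
  refine ⟨hFx.sub_next, ?_⟩
  have key := hs.ratio_ode hD h h3
  rw [dy_congr e1, e1.self_of_nhds, dy_congr e2, e2.self_of_nhds, h1.self_of_nhds,
    hk.self_of_nhds.1] at key
  have e3 : C.ratio (q (n + 2), x, q n) = C.ratioAt q (n + 1) x := by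
    rw [Chain.ratioAt, add_sub_cancel_right, show n + 1 + 1 = n + 2 by ring]
  rw [e3] at key
  exact key

/-- Fix u_n = q_n in the relation between ρ_n and ρ_{n+1} and let x vary. The left side is then a
polynomial of degree at most two in 1/(p_{n+1}(x) - p_n(q_n)), the right side is p_{n+1}' ρ_{n+1}
times the square of that quantity, up to a nonzero constant. -/
theorem SysOn.exists_quad (hD : IsOpen D) (h : C.Reg D) (hs : SysOn C D) (hq : IsConfig D q)
    (hF : Frame q p)
    (hα : ∀ n, ∀ᶠ t in 𝓝 ((q (n + 1), q n, q (n - 1)) : ℂ × ℂ × ℂ), C.α t = alphaOf p n t)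
    (n : ℤ) : ∃ k, ∀ᶠ x in 𝓝 (q (n + 1)), C.ratioAt q (n + 1) x = rhoOf k (p (n + 1)) x := by
  have h0 := hF.deriv_ne n
  set f0 := p n (q n)
  set f1 := deriv (p n) (q n)
  set f2 := deriv (deriv (p n)) (q n)
  set E := deriv (fun y => deriv (deriv (p n)) y / deriv (p n) y) (q n)
  set c0 := C.ratioAt q n (q n)
  set c1 := deriv (C.ratioAt q n) (q n)
  set c2 := deriv (deriv (C.ratioAt q n)) (q n)
  set A := (c2 + c1 * f2 / f1 + c0 * E) / (2 * f1)
  set B := c1 + c0 * f2 / f1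
  -- These are the coefficients of A(P - f0)² + B(P - f0) + c0 f1 expanded in P; the doubled first
  -- entry matches the factor k₁/2 in `quad`.
  refine ⟨(2 * A, B - 2 * A * f0, A * f0 ^ 2 - B * f0 + c0 * f1), ?_⟩
  filter_upwards [hs.ratioAt_next hD h hq hF hα n,
    (hF.analytic (n + 1)).deriv.continuousAt.eventually_ne (hF.deriv_ne (n + 1))] with x h1 h2
  obtain ⟨h3, h4⟩ := h1
  rw [(hasDerivAt_liou (hF.analytic n) h0 _ h3).deriv, liou] at h4
  rw [rhoOf, eq_div_iff h2, quad]
  change c2 + c1 * (f2 / f1 + 2 * f1 / (p (n + 1) x - f0)) + c0 * (E + 2 * f2 / (p (n + 1) x - f0)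
    + 2 * f1 ^ 2 / (p (n + 1) x - f0) ^ 2) = 2 * C.ratioAt q (n + 1) x *
      (deriv (p (n + 1)) x * f1 / (p (n + 1) x - f0) ^ 2) at h4
  change p (n + 1) x - f0 ≠ 0 at h3
  change f1 ≠ 0 at h0
  simp only [A, B]
  generalize p (n + 1) x = P at *
  field_simp at h4 ⊢
  linear_combination -h4

/-- By `rhoOf_ode` the standard ρ with the same k solves the relation, and the relation determines
ρ_{n+1} from ρ_n. -/
theorem SysOn.quad_next (hD : IsOpen D) (h : C.Reg D) (hs : SysOn C D) (hq : IsConfig D q)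
    (hF : Frame q p)
    (hα : ∀ n, ∀ᶠ t in 𝓝 ((q (n + 1), q n, q (n - 1)) : ℂ × ℂ × ℂ), C.α t = alphaOf p n t)
    (n : ℤ) {k : ℂ × ℂ × ℂ} (hk : ∀ᶠ y in 𝓝 (q n), C.ratioAt q n y = rhoOf k (p n) y) :
    ∀ᶠ x in 𝓝 (q (n + 1)), C.ratioAt q (n + 1) x = rhoOf k (p (n + 1)) x := by
  have h0 := hF.deriv_ne n
  have hk1 : ∀ᶠ y in 𝓝 (q n), deriv (C.ratioAt q n) y = deriv (rhoOf k (p n)) y :=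
    (eventually_eventually_nhds.2 hk).mono fun y hy => Filter.EventuallyEq.deriv_eq hy
  have hk2 : deriv (deriv (C.ratioAt q n)) (q n) = deriv (deriv (rhoOf k (p n))) (q n) :=
    Filter.EventuallyEq.deriv_eq hk1
  filter_upwards [hs.ratioAt_next hD h hq hF hα n,
    (hF.analytic (n + 1)).deriv.continuousAt.eventually_ne (hF.deriv_ne (n + 1))] with x h1 h2
  obtain ⟨h3, h4⟩ := h1
  rw [hk2, hk1.self_of_nhds, hk.self_of_nhds, rhoOf_ode k (hF.analytic n) h0 _ h3] at h4
  rw [rhoOf, eq_div_iff h2]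
  field_simp at h4
  linear_combination -h4

theorem Frame.quad_unique (hF : Frame q p) (n : ℤ) {k k' : ℂ × ℂ × ℂ}
    (h : ∀ᶠ y in 𝓝 (q n), rhoOf k (p n) y = rhoOf k' (p n) y) : k = k' := by
  have hm : Filter.map (p n) (𝓝 (q n)) = 𝓝 (p n (q n)) :=
    (hF.analytic n).hasStrictDerivAt.map_nhds_eq (hF.deriv_ne n)
  refine quad_injective (z := p n (q n)) ?_
  rw [← hm, Filter.eventually_map]
  filter_upwards [h, (hF.analytic n).deriv.continuousAt.eventually_ne (hF.deriv_ne n)] with y h1 h2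
  simpa [rhoOf, div_left_inj' h2] using h1

/-- The first system forces the standard form of `γ`, with one polynomial for all `n`, in every
frame in which `α` has the standard form. -/
theorem SysOn.exists_gammaOf (hD : IsOpen D) (h : C.Reg D) (hs : SysOn C D) (hq : IsConfig D q)
    (hF : Frame q p)
    (hα : ∀ n, ∀ᶠ t in 𝓝 ((q (n + 1), q n, q (n - 1)) : ℂ × ℂ × ℂ), C.α t = alphaOf p n t) :
    ∃ k, ∀ n, ∀ᶠ t in 𝓝 ((q (n + 1), q n, q (n - 1)) : ℂ × ℂ × ℂ), C.γ t = gammaOf k p n t := by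
  have hex : ∀ n, ∃ k, ∀ᶠ x in 𝓝 (q n), C.ratioAt q n x = rhoOf k (p n) x := by
    intro n
    have := hs.exists_quad hD h hq hF hα (n - 1)
    rwa [sub_add_cancel] at this
  choose κ hκ using hex
  have hstep : ∀ n, κ (n + 1) = κ n := by
    intro n
    refine hF.quad_unique (n + 1) ?_
    filter_upwards [hκ (n + 1), hs.quad_next hD h hq hF hα n (hκ n)] with x h1 h2
    rw [← h1, h2]
  have hconst : ∀ n, κ n = κ 0 := by
    intro n
    induction n using Int.induction_on with
    | zero => rfl
    | succ m ih => rw [hstep, ih]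
    | pred m ih => rw [← ih, ← hstep, sub_add_cancel]
  refine ⟨κ 0, fun n => ?_⟩
  have h1 := hκ n
  rw [hconst] at h1
  have hr : ∀ᶠ t in 𝓝 ((q (n + 1), q n, q (n - 1)) : ℂ × ℂ × ℂ),
      C.ratio t = rhoOf (κ 0) (p n) t.2.1 := by
    filter_upwards [hs.eventually_ratio hD h (hq.core n),
      (tendsto_proj2 (q (n + 1)) (q n) (q (n - 1))).eventually h1] with t h1 h2
    exact h1.trans h2
  filter_upwards [eventually_eventually_nhds.2 hr, hF.eventually n, hα n,
    SysOn.eventually_core_nhds hD (hq.core n)] with t h1 h2 h3 h4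
  rw [hs.gamma_eq hD h h4, h2.gammaOf_eq, ← h3, h1.self_of_nhds, dy_congr h1]
  rfl

end QChain

namespace QChain

/-! ### The systems for coefficients in standard form -/

/-- Near `t` the coefficients `α`, `γ` have the standard form in the coordinates `p_n`. -/
def FormAt (α γ : ℂ × ℂ × ℂ → ℂ) (k : ℂ × ℂ × ℂ) (p : ℤ → ℂ → ℂ) (n : ℤ) (t : ℂ × ℂ × ℂ) : Prop :=
  ∀ᶠ t in 𝓝 t, FrameAt p n t ∧ α t = alphaOf p n t ∧ γ t = gammaOf k p n t

variable {α γ : ℂ × ℂ × ℂ → ℂ} {k : ℂ × ℂ × ℂ} {p : ℤ → ℂ → ℂ} {n : ℤ} {t : ℂ × ℂ × ℂ}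

namespace FormAt

theorem frame (h : FormAt α γ k p n t) : FrameAt p n t := h.self_of_nhds.1

theorem nhds (h : FormAt α γ k p n t) : ∀ᶠ t in 𝓝 t, FormAt α γ k p n t :=
  eventually_eventually_nhds.2 h

theorem kernel (h : FormAt α γ k p n t) : KernelAt α p n t :=
  h.frame.kernelAt (h.mono fun _ h => h.2.1)

theorem dx_alpha (h : FormAt α γ k p n t) : dx α t = ker p n t.1 t.2.1 := h.kernel.1

theorem dz_alpha (h : FormAt α γ k p n t) : dz α t = ker p (n - 1) t.2.1 t.2.2 := h.kernel.2

theorem dx_alpha_ne (h : FormAt α γ k p n t) : dx α t ≠ 0 := by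
  rw [h.dx_alpha]
  exact div_ne_zero (mul_ne_zero h.frame.ne_next h.frame.ne_self)
    (pow_ne_zero 2 h.frame.sub_next)

theorem dz_alpha_ne (h : FormAt α γ k p n t) : dz α t ≠ 0 := by
  rw [h.dz_alpha, ker, sub_add_cancel]
  exact div_ne_zero (mul_ne_zero h.frame.ne_self h.frame.ne_prev)
    (pow_ne_zero 2 h.frame.sub_prev)

theorem lam_eq (h : FormAt α γ k p n t) : lam α t = liou (p n) (p (n + 1) t.1) t.2.1 :=
  lam_eq_of_kernel (h.nhds.mono fun _ h => h.kernel) h.frame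

theorem mu_eq (h : FormAt α γ k p n t) : mu α t = liou (p n) (p (n - 1) t.2.2) t.2.1 :=
  (mu_eq_of_kernel (h.nhds.mono fun _ h => h.kernel) h.frame).trans (muOf_eq p n t)

theorem lam_mu (h : FormAt α γ k p n t) : lam α t + 2 * α t + mu α t = 0 := by
  have h2 := h.frame.sub_next
  have h3 := h.frame.sub_prev
  have h4 := h.frame.prev_sub
  have h1 := h.frame.ne_self
  rw [h.lam_eq, h.mu_eq, h.self_of_nhds.2.1, alphaOf, liou, liou,
    ← neg_sub (p n t.2.1) (p (n - 1) t.2.2), div_neg]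
  ring

theorem alpha_mixed (h : FormAt α γ k p n t) : dz (dx α) t = 0 := by
  have e : dx α =ᶠ[𝓝 t] fun t => ker p n t.1 t.2.1 := h.nhds.mono fun _ h => h.dx_alpha
  rw [dz_congr e]
  simp only [dz, deriv_const]

theorem dz_lam (h : FormAt α γ k p n t) : dz (lam α) t = 0 := by
  have e : lam α =ᶠ[𝓝 t] fun t => liou (p n) (p (n + 1) t.1) t.2.1 :=
    h.nhds.mono fun _ h => h.lam_eq
  rw [dz_congr e]
  simp only [dz, deriv_const]

theorem dx_mu (h : FormAt α γ k p n t) : dx (mu α) t = 0 := by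
  have e : mu α =ᶠ[𝓝 t] fun t => liou (p n) (p (n - 1) t.2.2) t.2.1 :=
    h.nhds.mono fun _ h => h.mu_eq
  rw [dx_congr e]
  simp only [dx, deriv_const]

theorem deriv_liou_left {f g : ℂ → ℂ} {x y : ℂ} (hg : AnalyticAt ℂ g x) (h0 : g x - f y ≠ 0) :
    deriv (fun x => liou f (g x) y) x = -2 * (deriv g x * deriv f y / (g x - f y) ^ 2) := by
  have := ((hasDerivAt_const x (2 * deriv f y)).div
    (hg.differentiableAt.hasDerivAt.sub_const (f y)) h0).const_add (deriv (deriv f) y / deriv f y)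
  refine this.deriv.trans ?_
  ring

theorem dx_lam (h : FormAt α γ k p n t) : dx (lam α) t = -2 * ker p n t.1 t.2.1 := by
  have e : lam α =ᶠ[𝓝 t] fun t => liou (p n) (p (n + 1) t.1) t.2.1 :=
    h.nhds.mono fun _ h => h.lam_eq
  rw [dx_congr e]
  exact deriv_liou_left h.frame.an_next h.frame.sub_next

theorem dz_mu (h : FormAt α γ k p n t) : dz (mu α) t = -2 * ker p (n - 1) t.2.1 t.2.2 := by
  have e : mu α =ᶠ[𝓝 t] fun t => liou (p n) (p (n - 1) t.2.2) t.2.1 :=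
    h.nhds.mono fun _ h => h.mu_eq
  rw [dz_congr e, ker, sub_add_cancel, mul_comm (deriv (p n) t.2.1),
    ← neg_sub (p (n - 1) t.2.2), neg_sq]
  exact deriv_liou_left h.frame.an_prev h.frame.prev_sub

theorem dy_lam (h : FormAt α γ k p n t) :
    dy (lam α) t = deriv (liou (p n) (p (n + 1) t.1)) t.2.1 := by
  have e : lam α =ᶠ[𝓝 t] fun t => liou (p n) (p (n + 1) t.1) t.2.1 :=
    h.nhds.mono fun _ h => h.lam_eq
  exact dy_congr e

theorem dy_mu (h : FormAt α γ k p n t) :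
    dy (mu α) t = deriv (liou (p n) (p (n - 1) t.2.2)) t.2.1 := by
  have e : mu α =ᶠ[𝓝 t] fun t => liou (p n) (p (n - 1) t.2.2) t.2.1 :=
    h.nhds.mono fun _ h => h.mu_eq
  exact dy_congr e

theorem alpha_eq (h : FormAt α γ k p n t) :
    α t = -((liou (p n) (p (n + 1) t.1) t.2.1 + liou (p n) (p (n - 1) t.2.2) t.2.1) / 2) := by
  rw [← h.lam_eq, ← h.mu_eq]
  linear_combination h.lam_mu / 2

theorem hasDerivAt_alpha (h : FormAt α γ k p n t) :
    HasDerivAt (fun y => α (t.1, y, t.2.2)) (-((dy (lam α) t + dy (mu α) t) / 2)) t.2.1 := by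
  rw [h.dy_lam, h.dy_mu]
  have e : (fun y => α (t.1, y, t.2.2)) =ᶠ[𝓝 t.2.1] fun y =>
      -((liou (p n) (p (n + 1) t.1) y + liou (p n) (p (n - 1) t.2.2) y) / 2) :=
    ((tendsto_snd t).eventually h.nhds).mono fun _ h => h.alpha_eq
  refine HasDerivAt.congr_of_eventuallyEq ?_ e
  exact (((hasDerivAt_liou h.frame.an_self h.frame.ne_self _
    h.frame.sub_next).differentiableAt.hasDerivAt.add (hasDerivAt_liou h.frame.an_self
      h.frame.ne_self _ h.frame.prev_sub).differentiableAt.hasDerivAt).div_const 2).neg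

theorem dy_alpha (h : FormAt α γ k p n t) :
    dy α t = -((dy (lam α) t + dy (mu α) t) / 2) := h.hasDerivAt_alpha.deriv

/-- `2 λ_y - λ² = 2 μ_y - μ²`. -/
theorem riccati (h : FormAt α γ k p n t) :
    2 * dy (lam α) t - lam α t ^ 2 = 2 * dy (mu α) t - mu α t ^ 2 := by
  have h1 := h.frame.ne_self
  have h2 := h.frame.sub_next
  have h3 := h.frame.prev_sub
  rw [h.dy_lam, h.dy_mu, h.lam_eq, h.mu_eq, (hasDerivAt_liou h.frame.an_self h1 _ h2).deriv,
    (hasDerivAt_liou h.frame.an_self h1 _ h3).deriv, liou, liou]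
  field_simp
  ring

theorem lam_self (h : FormAt α γ k p n t) :
    dy (lam α) t + α t * lam α t + dy α t + α t ^ 2 = 0 := by
  have e : α t = -((lam α t + mu α t) / 2) := by linear_combination h.lam_mu / 2
  rw [h.dy_alpha, e]
  linear_combination h.riccati / 4

theorem mu_self (h : FormAt α γ k p n t) :
    dy (mu α) t + α t * mu α t + dy α t + α t ^ 2 = 0 := by
  have e : α t = -((lam α t + mu α t) / 2) := by linear_combination h.lam_mu / 2
  rw [h.dy_alpha, e]
  linear_combination -h.riccati / 4

theorem gamma_eq (h : FormAt α γ k p n t) :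
    γ t = deriv (rhoOf k (p n)) t.2.1 - rhoOf k (p n) t.2.1 * α t := by
  rw [h.self_of_nhds.2.2, h.frame.gammaOf_eq, h.self_of_nhds.2.1]

/-- `deriv` is zero by default where a function is not differentiable, so the nonvanishing of α_x
already gives differentiability. -/
theorem differentiable_dx (h : FormAt α γ k p n t) :
    DifferentiableAt ℂ (fun x => α (x, t.2.1, t.2.2)) t.1 :=
  differentiableAt_of_deriv_ne_zero h.dx_alpha_ne

theorem differentiable_dz (h : FormAt α γ k p n t) :
    DifferentiableAt ℂ (fun z => α (t.1, t.2.1, z)) t.2.2 :=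
  differentiableAt_of_deriv_ne_zero h.dz_alpha_ne

theorem dx_gamma (h : FormAt α γ k p n t) : dx γ t = -(rhoOf k (p n) t.2.1 * dx α t) := by
  have e : γ =ᶠ[𝓝 t] fun t => deriv (rhoOf k (p n)) t.2.1 - rhoOf k (p n) t.2.1 * α t :=
    h.nhds.mono fun _ h => h.gamma_eq
  rw [dx_congr e]
  exact ((h.differentiable_dx.hasDerivAt.const_mul (rhoOf k (p n) t.2.1)).const_sub
    (deriv (rhoOf k (p n)) t.2.1)).deriv

theorem dz_gamma (h : FormAt α γ k p n t) : dz γ t = -(rhoOf k (p n) t.2.1 * dz α t) := by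
  have e : γ =ᶠ[𝓝 t] fun t => deriv (rhoOf k (p n)) t.2.1 - rhoOf k (p n) t.2.1 * α t :=
    h.nhds.mono fun _ h => h.gamma_eq
  rw [dz_congr e]
  exact ((h.differentiable_dz.hasDerivAt.const_mul (rhoOf k (p n) t.2.1)).const_sub
    (deriv (rhoOf k (p n)) t.2.1)).deriv

theorem rho_analytic (h : FormAt α γ k p n t) : AnalyticAt ℂ (rhoOf k (p n)) t.2.1 :=
  analyticAt_rhoOf k h.frame.an_self h.frame.ne_self

theorem dy_gamma (h : FormAt α γ k p n t) :
    dy γ t = deriv (deriv (rhoOf k (p n))) t.2.1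
      - (deriv (rhoOf k (p n)) t.2.1 * α t + rhoOf k (p n) t.2.1 * dy α t) := by
  have e : γ =ᶠ[𝓝 t] fun t => deriv (rhoOf k (p n)) t.2.1 - rhoOf k (p n) t.2.1 * α t :=
    h.nhds.mono fun _ h => h.gamma_eq
  rw [dy_congr e, h.dy_alpha]
  exact (h.rho_analytic.deriv.differentiableAt.hasDerivAt.sub
    (h.rho_analytic.differentiableAt.hasDerivAt.mul h.hasDerivAt_alpha)).deriv

theorem hasDerivAt_dx_alpha (h : FormAt α γ k p n t) :
    HasDerivAt (fun y => dx α (t.1, y, t.2.2)) (dx α t * lam α t) t.2.1 := by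
  have e : (fun y => dx α (t.1, y, t.2.2)) =ᶠ[𝓝 t.2.1] fun y => ker p n t.1 y :=
    ((tendsto_snd t).eventually h.nhds).mono fun _ h => h.dx_alpha
  refine HasDerivAt.congr_of_eventuallyEq ?_ e
  rw [h.dx_alpha, h.lam_eq]
  exact hasDerivAt_kernel h.frame.an_self h.frame.ne_self (deriv (p (n + 1)) t.1) (p (n + 1) t.1)
    h.frame.sub_next

theorem hasDerivAt_dz_alpha (h : FormAt α γ k p n t) :
    HasDerivAt (fun y => dz α (t.1, y, t.2.2)) (dz α t * mu α t) t.2.1 := by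
  have e : (fun y => dz α (t.1, y, t.2.2)) =ᶠ[𝓝 t.2.1] fun y =>
      deriv (p (n - 1)) t.2.2 * deriv (p n) y / (p (n - 1) t.2.2 - p n y) ^ 2 := by
    refine ((tendsto_snd t).eventually h.nhds).mono fun y h => ?_
    refine h.dz_alpha.trans ?_
    rw [ker, sub_add_cancel, mul_comm, ← neg_sub (p (n - 1) t.2.2), neg_sq]
  refine HasDerivAt.congr_of_eventuallyEq ?_ e
  have e0 : dz α t = _ := e.self_of_nhds
  rw [e0, h.mu_eq]
  exact hasDerivAt_kernel h.frame.an_self h.frame.ne_self (deriv (p (n - 1)) t.2.2)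
    (p (n - 1) t.2.2) h.frame.prev_sub

theorem dy_dx_gamma (h : FormAt α γ k p n t) :
    dy (dx γ) t = -(deriv (rhoOf k (p n)) t.2.1 * dx α t
      + rhoOf k (p n) t.2.1 * (dx α t * lam α t)) := by
  have e : dx γ =ᶠ[𝓝 t] fun t => -(rhoOf k (p n) t.2.1 * dx α t) :=
    h.nhds.mono fun _ h => h.dx_gamma
  rw [dy_congr e]
  exact (h.rho_analytic.differentiableAt.hasDerivAt.mul h.hasDerivAt_dx_alpha).neg.deriv

theorem dy_dz_gamma (h : FormAt α γ k p n t) :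
    dy (dz γ) t = -(deriv (rhoOf k (p n)) t.2.1 * dz α t
      + rhoOf k (p n) t.2.1 * (dz α t * mu α t)) := by
  have e : dz γ =ᶠ[𝓝 t] fun t => -(rhoOf k (p n) t.2.1 * dz α t) :=
    h.nhds.mono fun _ h => h.dz_gamma
  rw [dy_congr e]
  exact (h.rho_analytic.differentiableAt.hasDerivAt.mul h.hasDerivAt_dz_alpha).neg.deriv

theorem gamma_mixed (h : FormAt α γ k p n t) : dz (dx γ) t = 0 := by
  have e : dx γ =ᶠ[𝓝 t] fun t => -(rhoOf k (p n) t.2.1 * ker p n t.1 t.2.1) :=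
    h.nhds.mono fun _ h => by rw [h.dx_gamma, h.dx_alpha]
  rw [dz_congr e]
  simp only [dz, deriv_const]

/-- This is `rhoOf_ode` at c = p_{n+1}(x), where the value of the polynomial is p_{n+1}' times the
ratio of the next site. -/
theorem ode_next (h : FormAt α γ k p n t) :
    deriv (deriv (rhoOf k (p n))) t.2.1 + deriv (rhoOf k (p n)) t.2.1 * lam α t
      + rhoOf k (p n) t.2.1 * dy (lam α) t = 2 * rhoOf k (p (n + 1)) t.1 * dx α t := by
  have h0 := h.frame.ne_next
  have h1 := h.frame.sub_next
  rw [h.lam_eq, h.dy_lam, rhoOf_ode k h.frame.an_self h.frame.ne_self _ h1, h.dx_alpha, ker, rhoOf]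
  field_simp

theorem ode_prev (h : FormAt α γ k p n t) :
    deriv (deriv (rhoOf k (p n))) t.2.1 + deriv (rhoOf k (p n)) t.2.1 * mu α t
      + rhoOf k (p n) t.2.1 * dy (mu α) t = 2 * rhoOf k (p (n - 1)) t.2.2 * dz α t := by
  have h0 := h.frame.ne_prev
  have h1 := h.frame.prev_sub
  rw [h.mu_eq, h.dy_mu, rhoOf_ode k h.frame.an_self h.frame.ne_self _ h1, h.dz_alpha, ker, rhoOf,
    sub_add_cancel, ← neg_sub (p (n - 1) t.2.2), neg_sq]
  field_simp

end FormAt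

/-! ### The three systems at consecutive triples -/

variable {w x y z v : ℂ}

/-- The same kernel gives α_z at the upper triple and α_x at the lower one, so its logarithmic
derivative in the shared variable is λ of the lower triple. -/
theorem dz_dz_alpha (h0 : FormAt α γ k p n (x, y, z)) (h1 : FormAt α γ k p (n + 1) (w, x, y)) :
    HasDerivAt (fun z => dz α (w, x, z)) (lam α (x, y, z) * dz α (w, x, y)) y := by
  have e : (fun z => dz α (w, x, z)) =ᶠ[𝓝 y] fun z => ker p n x z := by
    refine ((tendsto_trd (w, x, y)).eventually h1.nhds).mono fun z h => ?_
    refine h.dz_alpha.trans ?_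
    rw [add_sub_cancel_right]
  refine HasDerivAt.congr_of_eventuallyEq ?_ e
  rw [h0.lam_eq, h1.dz_alpha, add_sub_cancel_right, mul_comm]
  exact hasDerivAt_kernel h0.frame.an_self h0.frame.ne_self (deriv (p (n + 1)) x) (p (n + 1) x)
    h0.frame.sub_next

theorem dx_dx_alpha (h0 : FormAt α γ k p n (x, y, z)) (h1 : FormAt α γ k p (n + 1) (w, x, y)) :
    HasDerivAt (fun x => dx α (x, y, z)) (mu α (w, x, y) * dx α (x, y, z)) x := by
  have hs := h1.frame.prev_sub
  have e : (fun x => dx α (x, y, z)) =ᶠ[𝓝 x] fun x =>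
      deriv (p n) y * deriv (p (n + 1)) x / (p n y - p (n + 1) x) ^ 2 := by
    refine ((tendsto_fst (x, y, z)).eventually h0.nhds).mono fun x h => ?_
    refine h.dx_alpha.trans ?_
    rw [ker, mul_comm, ← neg_sub (p n y), neg_sq]
  refine HasDerivAt.congr_of_eventuallyEq ?_ e
  have e0 : dx α (x, y, z) = _ := e.self_of_nhds
  simp only [add_sub_cancel_right] at hs
  rw [e0, h1.mu_eq, add_sub_cancel_right, mul_comm]
  exact hasDerivAt_kernel h1.frame.an_self h1.frame.ne_self (deriv (p n) y) (p n y) hs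

theorem alpha_shift (h0 : FormAt α γ k p n (x, y, z)) (h1 : FormAt α γ k p (n + 1) (w, x, y)) :
    dz α (w, x, y) = dx α (x, y, z) := by
  rw [h0.dx_alpha, h1.dz_alpha, add_sub_cancel_right]

theorem firstSys_of_form (h0 : FormAt α γ k p n (x, y, z))
    (h1 : FormAt α γ k p (n + 1) (w, x, y)) : FirstSys α γ (x, y, z) (w, x, y) where
  alpha_prev := (dz_dz_alpha h0 h1).deriv
  gamma_prev := by
    have e : dz γ =ᶠ[𝓝 (w, x, y)] fun t => -(rhoOf k (p (n + 1)) t.2.1 * dz α t) :=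
      h1.nhds.mono fun _ h => h.dz_gamma
    rw [dz_congr e, e.self_of_nhds]
    refine ((dz_dz_alpha h0 h1).const_mul (rhoOf k (p (n + 1)) x)).neg.deriv.trans ?_
    ring
  gamma_next := by
    rw [h0.dy_dx_gamma, h0.dx_gamma, h0.gamma_eq]
    ring
  lam_next := by
    rw [h0.dx_lam, h1.dz_alpha, add_sub_cancel_right]
    ring
  lam_self := h0.lam_self
  lam_prev := h0.dz_lam
  gamma_self := by
    rw [h0.dy_gamma, h0.gamma_eq, h1.dz_gamma, alpha_shift h0 h1]
    linear_combination h0.ode_next - rhoOf k (p n) y * h0.lam_self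

theorem mirrorSys_of_form (h0 : FormAt α γ k p n (x, y, z))
    (h1 : FormAt α γ k p (n + 1) (w, x, y)) : MirrorSys α γ (x, y, z) (w, x, y) where
  alpha_next := (dx_dx_alpha h0 h1).deriv
  gamma_next := by
    have e : dx γ =ᶠ[𝓝 (x, y, z)] fun t => -(rhoOf k (p n) t.2.1 * dx α t) :=
      h0.nhds.mono fun _ h => h.dx_gamma
    rw [dx_congr e, e.self_of_nhds]
    refine ((dx_dx_alpha h0 h1).const_mul (rhoOf k (p n) y)).neg.deriv.trans ?_
    ring
  gamma_prev := by
    rw [h1.dy_dz_gamma, h1.dz_gamma, h1.gamma_eq]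
    ring
  mu_prev := by
    rw [h1.dz_mu, h0.dx_alpha, add_sub_cancel_right]
    ring
  mu_self := h1.mu_self
  mu_next := h1.dx_mu
  gamma_self := by
    have e := h1.ode_prev
    rw [add_sub_cancel_right] at e
    rw [h1.dy_gamma, h1.gamma_eq, h0.dx_gamma, ← alpha_shift h0 h1]
    linear_combination e - rhoOf k (p (n + 1)) x * h1.mu_self

theorem tripleSys_of_form (h0 : FormAt α γ k p n (x, y, z))
    (h1 : FormAt α γ k p (n + 1) (w, x, y)) (h2 : FormAt α γ k p (n + 1 + 1) (v, w, x)) :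
    TripleSys α γ (x, y, z) (w, x, y) (v, w, x) where
  alpha_prev := alpha_shift h0 h1
  alpha_next := (alpha_shift h1 h2).symm
  gamma_sum := by
    have e := (mirrorSys_of_form h0 h1).gamma_self
    have e' := (firstSys_of_form h1 h2).gamma_self
    -- Half the sum of the two `gamma_self` equations centred at the middle site; λ + 2α + μ = 0
    -- removes γ itself.
    linear_combination e / 2 + e' / 2 - γ (w, x, y) / 2 * h1.lam_mu
  lam_mu := h1.lam_mu
  gamma_next := by
    have e := (firstSys_of_form h1 h2).gamma_next
    linear_combination e + dx γ (w, x, y) * h1.lam_mu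
  gamma_prev := by
    have e := (mirrorSys_of_form h0 h1).gamma_prev
    linear_combination e + dz γ (w, x, y) * h1.lam_mu
  alpha_mixed := h1.alpha_mixed
  gamma_mixed := h1.gamma_mixed

variable {D : Set (ℂ × ℂ × ℂ)} {C : Chain}

/-- Each jet uses the frame of its own configuration. No gluing is needed, because the systems to be
verified mention only α, γ and their derivatives. -/
theorem Chain.Reg.expansions_of_form [Fact (IsOpen D)] (h : C.Reg D)
    (hf : ∀ q, IsConfig D q → ∃ (p : ℤ → ℂ → ℂ) (k : ℂ × ℂ × ℂ), Frame q p ∧ ∀ n,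
      ∀ᶠ t in 𝓝 ((q (n + 1), q n, q (n - 1)) : ℂ × ℂ × ℂ),
        C.α t = alphaOf p n t ∧ C.γ t = gammaOf k p n t) : C.Expansions D := by
  have key : ∀ j : phaseSpace D, ∃ (p : ℤ → ℂ → ℂ) (k : ℂ × ℂ × ℂ), ∀ n,
      FormAt C.α C.γ k p n (triple j n) := by
    intro j
    obtain ⟨p, k, hF, hp⟩ := hf (fun n => j.1 (Sum.inl (n, 0))) j.2
    exact ⟨p, k, fun n => (hF.eventually n).and (hp n)⟩
  have htr : ∀ (j : phaseSpace D) (n : ℤ), triple j (n + 1) = (j.1 (Sum.inl (n + 1 + 1, 0)),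
      j.1 (Sum.inl (n + 1, 0)), j.1 (Sum.inl (n, 0))) := by
    intro j n
    rw [triple, add_sub_cancel_right]
  refine h.expansions (fun j n => ?_) (fun j n => ?_) (fun j n => ?_)
  all_goals
    obtain ⟨p, k, hf⟩ := key j
    have h0 := hf n
    have h1 := hf (n + 1)
    rw [htr] at h1
  · rw [htr]
    exact firstSys_of_form h0 h1
  · rw [htr]
    exact mirrorSys_of_form h0 h1
  · have h2 := hf (n + 1 + 1)
    rw [htr] at h2
    rw [htr, htr]
    exact tripleSys_of_form h0 h1 h2

end QChain

namespace QChain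

/-! ### Point transformations -/

variable {D : Set (ℂ × ℂ × ℂ)} {C : Chain} {q : ℤ → ℂ} {p : ℤ → ℂ → ℂ}

/-- Comparison of coefficients in ξ and η. Under a point transformation α changes like a connection
coefficient, β and γ are scalars, and δ is multiplied by p_n'. -/
theorem rhs_transform_iff (C C' : Chain) (t v : ℂ × ℂ × ℂ) {a b : ℂ} (ha : a ≠ 0) :
    (∀ ξ η : ℂ, a * C.rhs t ξ η + b * ξ * η = C'.rhs v (a * ξ) (a * η)) ↔
      C'.α v = (a * C.α t + b) / a ^ 2 ∧ C'.β v = C.β t ∧ C'.γ v = C.γ t ∧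
        C'.δ v = a * C.δ t := by
  unfold Chain.rhs
  constructor
  · intro h
    have h00 := h 0 0
    have h10 := h 1 0
    have h01 := h 0 1
    have h11 := h 1 1
    simp only [mul_zero, mul_one, zero_mul, add_zero, zero_add] at h00 h10 h01 h11
    refine ⟨?_, mul_left_cancel₀ ha ?_, mul_left_cancel₀ ha ?_, h00.symm⟩
    · rw [eq_div_iff (pow_ne_zero 2 ha)]
      linear_combination h10 + h01 - h11 - h00
    · linear_combination h00 - h10
    · linear_combination h00 - h01
  · rintro ⟨h1, h2, h3, h4⟩ ξ η
    rw [h1, h2, h3, h4]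
    field_simp
    ring

/-- The triple of transformed variables. -/
def tripleMap (p : ℤ → ℂ → ℂ) (n : ℤ) (t : ℂ × ℂ × ℂ) : ℂ × ℂ × ℂ :=
  (p (n + 1) t.1, p n t.2.1, p (n - 1) t.2.2)

theorem tendsto_tripleMap {p' : ℤ → ℂ → ℂ} {q' : ℤ → ℂ}
    (h : ∀ n, Filter.Tendsto (p' n) (𝓝 (q n)) (𝓝 (q' n))) (n : ℤ) :
    Filter.Tendsto (tripleMap p' n) (𝓝 (q (n + 1), q n, q (n - 1)))
      (𝓝 (q' (n + 1), q' n, q' (n - 1))) :=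
  ((h _).comp (tendsto_proj1 _ _ _)).prodMk_nhds
    (((h _).comp (tendsto_proj2 _ _ _)).prodMk_nhds ((h _).comp (tendsto_proj3 _ _ _)))

theorem alphaOf_eq (p : ℤ → ℂ → ℂ) (n : ℤ) (t : ℂ × ℂ × ℂ) :
    alphaOf p n t = deriv (p n) t.2.1 * stdAlpha (tripleMap p n t)
      - deriv (deriv (p n)) t.2.1 / deriv (p n) t.2.1 := by
  rw [alphaOf, stdAlpha, tripleMap]
  ring

theorem Chain.TransformsTo.frame {C' : ℤ → Chain} (h : C.TransformsTo q p C')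
    (hα : ∀ n, ∀ᶠ v in 𝓝 ((p (n + 1) (q (n + 1)), p n (q n), p (n - 1) (q (n - 1))) : ℂ × ℂ × ℂ),
      (C' n).AlphaForm v) : Frame q p where
  analytic n := (h n).1
  deriv_ne n := (h n).2.1
  ne n := (hα n).self_of_nhds.2.1

/-- Pulling the standard form back along a point transformation. -/
theorem Chain.TransformsTo.pullback {C' : ℤ → Chain} (h : C.TransformsTo q p C')
    {Φ : Chain → ℂ × ℂ × ℂ → Prop}
    (hα : ∀ n, ∀ᶠ v in 𝓝 ((p (n + 1) (q (n + 1)), p n (q n), p (n - 1) (q (n - 1))) : ℂ × ℂ × ℂ),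
      (C' n).AlphaForm v ∧ Φ (C' n) v) (n : ℤ) :
    ∀ᶠ t in 𝓝 ((q (n + 1), q n, q (n - 1)) : ℂ × ℂ × ℂ), C.α t = alphaOf p n t ∧
      (C' n).α (tripleMap p n t) = stdAlpha (tripleMap p n t) ∧
      C.β t = (C' n).β (tripleMap p n t) ∧ C.γ t = (C' n).γ (tripleMap p n t) ∧
      Φ (C' n) (tripleMap p n t) := by
  have hF := h.frame fun n => (hα n).mono fun _ h => h.1
  have ht := tendsto_tripleMap (fun n => (hF.analytic n).continuousAt.tendsto) n
  filter_upwards [(h n).2.2, hF.eventually n, ht.eventually (hα n)] with t h1 h2 h3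
  obtain ⟨e1, e2, e3, -⟩ := (rhs_transform_iff C (C' n) t (tripleMap p n t) h2.ne_self).1 h1
  refine ⟨?_, h3.1.2.2, e2.symm, e3.symm, h3.2⟩
  have h4 := h2.ne_self
  rw [alphaOf_eq, ← h3.1.2.2, e1]
  field_simp
  ring

/-- In a frame for `α`, the chain can be transformed to one with the standard `α`. -/
theorem Frame.exists_transform (C : Chain) (hF : Frame q p)
    (hα : ∀ n, ∀ᶠ t in 𝓝 ((q (n + 1), q n, q (n - 1)) : ℂ × ℂ × ℂ), C.α t = alphaOf p n t) :
    ∃ C' : ℤ → Chain, C.TransformsTo q p C' ∧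
      (∀ n, ∀ᶠ v in 𝓝 ((p (n + 1) (q (n + 1)), p n (q n), p (n - 1) (q (n - 1))) : ℂ × ℂ × ℂ),
        (C' n).AlphaForm v) ∧
      (∀ n k, (∀ᶠ t in 𝓝 ((q (n + 1), q n, q (n - 1)) : ℂ × ℂ × ℂ), C.γ t = gammaOf k p n t) →
        ∀ᶠ v in 𝓝 ((p (n + 1) (q (n + 1)), p n (q n), p (n - 1) (q (n - 1))) : ℂ × ℂ × ℂ),
          (C' n).GammaForm k v) ∧
      (∀ n k, (∀ᶠ t in 𝓝 ((q (n + 1), q n, q (n - 1)) : ℂ × ℂ × ℂ), C.β t = gammaOf k p n t) →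
        ∀ᶠ v in 𝓝 ((p (n + 1) (q (n + 1)), p n (q n), p (n - 1) (q (n - 1))) : ℂ × ℂ × ℂ),
          (C' n).BetaForm k v) := by
  have hinv : ∀ n, ∃ s : ℂ → ℂ, (∀ᶠ u in 𝓝 (q n), s (p n u) = u) ∧
      (∀ᶠ v in 𝓝 (p n (q n)), p n (s v) = v) ∧
      Filter.Tendsto s (𝓝 (p n (q n))) (𝓝 (q n)) := by
    intro n
    have hs := (hF.analytic n).hasStrictDerivAt.hasStrictFDerivAt_equiv (hF.deriv_ne n)
    exact ⟨hs.localInverse, hs.eventually_left_inverse, hs.eventually_right_inverse,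
      hs.localInverse_tendsto⟩
  choose s hsl hsr hst using hinv
  -- The coefficients dictated by `rhs_transform_iff`, pulled back by local inverses `s n` of `p n`;
  -- only their values near the transformed configuration matter.
  let C' : ℤ → Chain := fun n =>
    { α := fun v => (deriv (p n) (s n v.2.1) * C.α (tripleMap s n v)
        + deriv (deriv (p n)) (s n v.2.1)) / deriv (p n) (s n v.2.1) ^ 2
      β := fun v => C.β (tripleMap s n v)
      γ := fun v => C.γ (tripleMap s n v)
      δ := fun v => deriv (p n) (s n v.2.1) * C.δ (tripleMap s n v) }
  have hto : ∀ n, Filter.Tendsto (tripleMap s n)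
      (𝓝 (p (n + 1) (q (n + 1)), p n (q n), p (n - 1) (q (n - 1))))
      (𝓝 (q (n + 1), q n, q (n - 1))) :=
    fun n => tendsto_tripleMap (q := fun n => p n (q n)) hst n
  have hright : ∀ n, ∀ᶠ v in 𝓝 ((p (n + 1) (q (n + 1)), p n (q n), p (n - 1) (q (n - 1))) :
      ℂ × ℂ × ℂ), tripleMap p n (tripleMap s n v) = v := by
    intro n
    filter_upwards [(tendsto_proj1 _ _ _).eventually (hsr (n + 1)),
      (tendsto_proj2 _ _ _).eventually (hsr n),
      (tendsto_proj3 _ _ _).eventually (hsr (n - 1))] with v h1 h2 h3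
    exact Prod.ext h1 (Prod.ext h2 h3)
  have hform : ∀ n, ∀ᶠ v in 𝓝 ((p (n + 1) (q (n + 1)), p n (q n), p (n - 1) (q (n - 1))) :
      ℂ × ℂ × ℂ), (C' n).AlphaForm v := by
    intro n
    filter_upwards [hright n, (hto n).eventually (hF.eventually n), (hto n).eventually (hα n)]
      with v h1 h2 h3
    have e1 := h2.sub_next
    have e2 := h2.sub_prev
    have e3 := h2.ne_self
    rw [alphaOf_eq, h1] at h3
    refine ⟨?_, ?_, ?_⟩
    · rw [← h1]; exact sub_ne_zero.1 e2
    · rw [← h1]; exact sub_ne_zero.1 e1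
    · simp only [C']
      change deriv (p n) (s n v.2.1) ≠ 0 at e3
      rw [h3]
      change (_ * (_ * _ - deriv (deriv (p n)) (s n v.2.1) / deriv (p n) (s n v.2.1)) + _) / _ = _
      simp only [tripleMap]
      field_simp
      ring
  refine ⟨C', fun n => ⟨hF.analytic n, hF.deriv_ne n, ?_⟩, hform, fun n k hk => ?_, fun n k hk => ?_⟩
  · filter_upwards [(tendsto_proj1 _ _ _).eventually (hsl (n + 1)),
      (tendsto_proj2 _ _ _).eventually (hsl n),
      (tendsto_proj3 _ _ _).eventually (hsl (n - 1)), hF.eventually n] with t h1 h2 h3 h4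
    have e : tripleMap s n (tripleMap p n t) = t := Prod.ext h1 (Prod.ext h2 h3)
    refine (rhs_transform_iff C (C' n) t (tripleMap p n t) h4.ne_self).2 ?_
    simp only [C', e]
    simp only [tripleMap, h2, and_self]
  · filter_upwards [hright n, hform n, (hto n).eventually hk] with v h1 h2 h3
    rw [Chain.GammaForm, h2.2.2]
    refine h3.trans ?_
    change deriv (quad k) (tripleMap p n (tripleMap s n v)).2.1
      - quad k (tripleMap p n (tripleMap s n v)).2.1 * stdAlpha (tripleMap p n (tripleMap s n v)) = _
    rw [h1]
  · filter_upwards [hright n, hform n, (hto n).eventually hk] with v h1 h2 h3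
    rw [Chain.BetaForm, h2.2.2]
    refine h3.trans ?_
    change deriv (quad k) (tripleMap p n (tripleMap s n v)).2.1
      - quad k (tripleMap p n (tripleMap s n v)).2.1 * stdAlpha (tripleMap p n (tripleMap s n v)) = _
    rw [h1]

/-! ### The equivalences -/

/-- Near `q`, the coefficients `α`, `γ` have the standard form in the coordinates `p_n`. -/
def FormNear (α γ : ℂ × ℂ × ℂ → ℂ) (q : ℤ → ℂ) (p : ℤ → ℂ → ℂ) (k : ℂ × ℂ × ℂ) : Prop :=
  ∀ n, ∀ᶠ t in 𝓝 ((q (n + 1), q n, q (n - 1)) : ℂ × ℂ × ℂ),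
    α t = alphaOf p n t ∧ γ t = gammaOf k p n t

theorem Chain.Reg.sysOn [Fact (IsOpen D)] (h : C.Reg D) (he : C.Expansions D) : SysOn C D :=
  fun _ hq => h.firstSys_of_expansion he.1 hq

theorem Chain.Reg.expansions_iff [hD : Fact (IsOpen D)] (h : C.Reg D) :
    C.Expansions D ↔ ∀ q, IsConfig D q → ∃ p k, Frame q p ∧ FormNear C.α C.γ q p k := by
  refine ⟨fun he q hq => ?_, h.expansions_of_form⟩
  have hs := h.sysOn he
  obtain ⟨p, hF, hα⟩ := hs.exists_frame hD.out h hq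
  obtain ⟨k, hk⟩ := hs.exists_gammaOf hD.out h hq hF hα
  exact ⟨p, k, hF, fun n => (hα n).and (hk n)⟩

theorem locallyReducible_gamma_iff (C : Chain) (D : Set (ℂ × ℂ × ℂ)) :
    C.LocallyReducible D (fun k C' v => C'.AlphaForm v ∧ C'.GammaForm k v) ↔
      ∀ q, IsConfig D q → ∃ p k, Frame q p ∧ FormNear C.α C.γ q p k := by
  refine forall₂_congr fun q _ => ⟨?_, ?_⟩
  · rintro ⟨p, C', k, hT, hΦ⟩
    refine ⟨p, k, hT.frame fun n => (hΦ n).mono fun _ h => h.1, fun n => ?_⟩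
    filter_upwards [hT.pullback (Φ := fun C v => C.GammaForm k v) hΦ n] with t ht
    obtain ⟨h1, h2, -, h3, h4⟩ := ht
    refine ⟨h1, h3.trans (h4.trans ?_)⟩
    rw [h2]
    rfl
  · rintro ⟨p, k, hF, hp⟩
    obtain ⟨C', hT, h1, h2, -⟩ := hF.exists_transform C fun n => (hp n).mono fun _ h => h.1
    exact ⟨p, C', k, hT, fun n => (h1 n).and (h2 n k ((hp n).mono fun _ h => h.2))⟩

theorem locallyReducible_beta_iff (C : Chain) (D : Set (ℂ × ℂ × ℂ)) :
    C.LocallyReducible D (fun k C' v => C'.AlphaForm v ∧ C'.BetaForm k v) ↔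
      ∀ q, IsConfig D q → ∃ p k, Frame q p ∧ FormNear C.α C.β q p k := by
  refine forall₂_congr fun q _ => ⟨?_, ?_⟩
  · rintro ⟨p, C', k, hT, hΦ⟩
    refine ⟨p, k, hT.frame fun n => (hΦ n).mono fun _ h => h.1, fun n => ?_⟩
    filter_upwards [hT.pullback (Φ := fun C v => C.BetaForm k v) hΦ n] with t ht
    obtain ⟨h1, h2, h3, -, h4⟩ := ht
    refine ⟨h1, h3.trans (h4.trans ?_)⟩
    rw [h2]
    rfl
  · rintro ⟨p, k, hF, hp⟩
    obtain ⟨C', hT, h1, -, h2⟩ := hF.exists_transform C fun n => (hp n).mono fun _ h => h.1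
    exact ⟨p, C', k, hT, fun n => (h1 n).and (h2 n k ((hp n).mono fun _ h => h.2))⟩

theorem Chain.Reg.swap (h : C.Reg D) : C.swap.Reg D where
  α := h.α
  β := h.γ
  γ := h.β
  δ := h.δ
  next := h.next
  prev := h.prev

theorem Chain.Reg.both_iff [hD : Fact (IsOpen D)] (h : C.Reg D) :
    C.Expansions D ∧ C.swap.Expansions D ↔
      C.LocallyReducible D (fun (k : (ℂ × ℂ × ℂ) × (ℂ × ℂ × ℂ)) C' v =>
        C'.AlphaForm v ∧ C'.GammaForm k.1 v ∧ C'.BetaForm k.2 v) := by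
  constructor
  · rintro ⟨he, he'⟩ q hq
    have hs := h.sysOn he
    obtain ⟨p, hF, hα⟩ := hs.exists_frame hD.out h hq
    obtain ⟨k, hk⟩ := hs.exists_gammaOf hD.out h hq hF hα
    -- The frame found for the first direction is reused: it depends on α only, and the swapped
    -- chain has the same α.
    obtain ⟨k', hk'⟩ := (h.swap.sysOn he').exists_gammaOf hD.out h.swap hq hF hα
    obtain ⟨C', hT, h1, h2, h3⟩ := hF.exists_transform C hα
    exact ⟨p, C', (k, k'), hT, fun n => (h1 n).and ((h2 n k (hk n)).and (h3 n k' (hk' n)))⟩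
  · intro hL
    refine ⟨h.expansions_iff.2 ((locallyReducible_gamma_iff C D).1 fun q hq => ?_),
      h.swap.expansions_iff.2 ((locallyReducible_beta_iff C D).1 fun q hq => ?_)⟩
    · obtain ⟨p, C', k, hT, hΦ⟩ := hL q hq
      exact ⟨p, C', k.1, hT, fun n => (hΦ n).mono fun _ h => ⟨h.1, h.2.1⟩⟩
    · obtain ⟨p, C', k, hT, hΦ⟩ := hL q hq
      exact ⟨p, C', k.2, hT, fun n => (hΦ n).mono fun _ h => ⟨h.1, h.2.2⟩⟩

theorem alphaOf_id (n : ℤ) (t : ℂ × ℂ × ℂ) : alphaOf (fun _ => id) n t = stdAlpha t := by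
  have h : deriv (id : ℂ → ℂ) = fun _ => 1 := funext fun z => deriv_id z
  simp [alphaOf_eq, tripleMap, h]

theorem gammaOf_id (k : ℂ × ℂ × ℂ) (n : ℤ) (t : ℂ × ℂ × ℂ) :
    gammaOf k (fun _ => id) n t = deriv (quad k) t.2.1 - quad k t.2.1 * stdAlpha t := rfl

/-- The expansions for a chain with standard `α`. -/
theorem Chain.Reg.expansions_iff_gammaForm [hD : Fact (IsOpen D)] (h : C.Reg D)
    (hconn : IsConnected D) (hconfig : ∃ q, IsConfig D q) (hα : ∀ t ∈ D, C.AlphaForm t) :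
    C.Expansions D ↔ ∃ k, ∀ t ∈ D, C.GammaForm k t := by
  have hF : ∀ q, IsConfig D q → Frame q fun _ => id := fun q hq =>
    ⟨fun _ => analyticAt_id, fun _ => by simp, fun n => (hα _ (hq n)).2.1⟩
  have hD' : ∀ q, IsConfig D q → ∀ n,
      ∀ᶠ t in 𝓝 ((q (n + 1), q n, q (n - 1)) : ℂ × ℂ × ℂ), t ∈ D :=
    fun q hq n => hD.out.mem_nhds (hq n)
  have hα' : ∀ q, IsConfig D q → ∀ n, ∀ᶠ t in 𝓝 ((q (n + 1), q n, q (n - 1)) : ℂ × ℂ × ℂ),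
      C.α t = alphaOf (fun _ => id) n t := fun q hq n =>
    (hD' q hq n).mono fun t ht => (hα t ht).2.2.trans (alphaOf_id n t).symm
  constructor
  · intro he
    obtain ⟨q, hq⟩ := hconfig
    obtain ⟨k, hk⟩ := (h.sysOn he).exists_gammaOf hD.out h hq (hF q hq) (hα' q hq)
    refine ⟨k, ?_⟩
    have hg : AnalyticOnNhd ℂ (fun t => deriv (quad k) t.2.1 - quad k t.2.1 * C.α t) D := by
      intro t ht
      have e : AnalyticAt ℂ (fun t : ℂ × ℂ × ℂ => t.2.1) t := analyticAt_fst.comp analyticAt_snd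
      exact ((analyticAt_quad k t.2.1).deriv.comp (f := fun t : ℂ × ℂ × ℂ => t.2.1) e).sub
        (((analyticAt_quad k t.2.1).comp (f := fun t : ℂ × ℂ × ℂ => t.2.1) e).mul (h.α t ht))
    -- The polynomial found near one triple of one configuration is valid on all of `D` by analytic
    -- continuation.
    refine h.γ.eqOn_of_preconnected_of_eventuallyEq hg hconn.isPreconnected (hq 0) ?_
    filter_upwards [hk 0, hD' q hq 0] with t h1 h2
    rw [h1, gammaOf_id, (hα t h2).2.2]
  · rintro ⟨k, hk⟩
    refine h.expansions_of_form fun q hq => ⟨_, k, hF q hq, fun n => ?_⟩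
    filter_upwards [hα' q hq n, hD' q hq n] with t h1 h2
    refine ⟨h1, ?_⟩
    rw [gammaOf_id, ← (hα t h2).2.2]
    exact hk t h2

end QChain

theorem theorem3 (C : QChain.Chain) (D : Set (ℂ × ℂ × ℂ))
    (hDopen : IsOpen D) (hDconn : IsConnected D)
    (hconfig : ∃ q : ℤ → ℂ, QChain.IsConfig D q)
    (hα : AnalyticOnNhd ℂ C.α D) (hβ : AnalyticOnNhd ℂ C.β D)
    (hγ : AnalyticOnNhd ℂ C.γ D) (hδ : AnalyticOnNhd ℂ C.δ D)
    (hα_next : ∀ t ∈ D, deriv (fun z => C.α (z, t.2.1, t.2.2)) t.1 ≠ 0)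
    (hα_prev : ∀ t ∈ D, deriv (fun z => C.α (t.1, t.2.1, z)) t.2.2 ≠ 0) :
    (C.Expansions D ↔
      C.LocallyReducible D (fun k C' v => C'.AlphaForm v ∧ C'.GammaForm k v)) ∧
    (C.swap.Expansions D ↔
      C.LocallyReducible D (fun k C' v => C'.AlphaForm v ∧ C'.BetaForm k v)) ∧
    (C.Expansions D ∧ C.swap.Expansions D ↔
      C.LocallyReducible D (fun (k : (ℂ × ℂ × ℂ) × (ℂ × ℂ × ℂ)) C' v =>
        C'.AlphaForm v ∧ C'.GammaForm k.1 v ∧ C'.BetaForm k.2 v)) ∧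
    ((∀ t ∈ D, C.AlphaForm t) →
      (C.Expansions D ↔ ∃ k : ℂ × ℂ × ℂ, ∀ t ∈ D, C.GammaForm k t) ∧
      (C.swap.Expansions D ↔ ∃ k : ℂ × ℂ × ℂ, ∀ t ∈ D, C.BetaForm k t)) := by
  have : Fact (IsOpen D) := ⟨hDopen⟩
  have h : C.Reg D := ⟨hα, hβ, hγ, hδ, hα_next, hα_prev⟩
  refine ⟨h.expansions_iff.trans (QChain.locallyReducible_gamma_iff C D).symm,
    h.swap.expansions_iff.trans (QChain.locallyReducible_beta_iff C D).symm, h.both_iff,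
    fun hf => ⟨h.expansions_iff_gammaForm hDconn hconfig hf,
      h.swap.expansions_iff_gammaForm hDconn hconfig hf⟩⟩
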